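/- All manifolds are taken locally: $N\subseteq\mathbb R^3$, $P\subseteq\mathbb R^8$, $U\subseteq\mathbb R^4$ are open and all data are smooth. Let $(\lambda,\mu)$ be a nondegenerate CR structure on $N$: $\lambda$ is a real and $\mu$ a complex $1$-form with $\lambda\wedge\mu\wedge\bar\mu\ne0$ and $d\lambda\wedge\lambda\neq 0$ everywhere. A *Cartan coframe* over $P$, with projection $\pi:P\to N$, consists of $1$-forms $\theta^1,\theta^2=\overline{\theta^1},\theta^3=\overline{\theta^3},\Omega_2,\bar\Omega_2,\Omega_3,\bar\Omega_3,\Omega_4=\bar\Omega_4$, linearly independent at each point of $P$, and functions $\mathcal R,\mathcal S:P\to\mathbb C$, with $\theta^1=b\,\pi^*\mu+c\,\pi^*\lambda$, $\theta^3=a\,\pi^*\lambda$ for functions $a\neq0$ real and $b\neq0$, $c$ complex, such that $$d\theta^1=\Omega_2\wedge\theta^1+\Omega_3\wedge\theta^3,\qquad d\theta^3=i\theta^1\wedge\theta^2+(\Omega_2+\bar\Omega_2)\wedge\theta^3,$$ $$d\Omega_2=2i\theta^1\wedge\bar\Omega_3+i\theta^2\wedge\Omega_3+\Omega_4\wedge\theta^3,\qquad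 d\Omega_3=\Omega_4\wedge\theta^1+\Omega_3\wedge\bar\Omega_2+\mathcal R\,\theta^2\wedge\theta^3,$$ $$d\Omega_4=i\Omega_3\wedge\bar\Omega_3+\Omega_4\wedge(\Omega_2+\bar\Omega_2)+\bar{\mathcal S}\,\theta^1\wedge\theta^3+\mathcal S\,\theta^2\wedge\theta^3 .$$ Let $\mathcal S_1$ be the coefficient of $\theta^1$ in the expansion of $d\mathcal S$ in this coframe. Put $\theta^4=\frac1{3i}(\Omega_2-\bar\Omega_2)$ and $G=2\theta^1\theta^2+2\theta^3\theta^4$. A *Fefferman metric* on $U$ is a metric $g_F=\varphi\,s^*G$, where $\varphi>0$ is a function and $s:U\to P$ is a local section of the projection of $P$ to the $4$-dimensional space of leaves of $\theta^1=\theta^2=\theta^3=\theta^4=0$ (that is, $s^*\theta^1,\dots,s^*\theta^4$ are linearly independent at each point). Let $$\tilde\omega=\begin{pmatrix} \frac12(\Omega_2+\bar\Omega_2)&\frac i2\bar\Omega_3&-\frac i2\Omega_3&-\Omega_4&\frac i{12}(\Omega_2-\bar\Omega_2)&0\\ \theta^1&-\frac13(\Omega_2-\bar\Omega_2)&0&-\Omega_3&\frac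 i2\theta^1&-\frac i2\Omega_3\\ \theta^2&0&\frac13(\Omega_2-\bar\Omega_2)&-\bar\Omega_3&-\frac i2\theta^2&\frac i2\bar\Omega_3\\ \theta^3&\frac i2\theta^2&-\frac i2\theta^1&-\frac12(\Omega_2+\bar\Omega_2)&0&\frac i{12}(\Omega_2-\bar\Omega_2)\\ \theta^4&\bar\Omega_3&\Omega_3&0&\frac12(\Omega_2+\bar\Omega_2)&-\Omega_4\\ 0&\theta^2&\theta^1&\theta^4&\theta^3&-\frac12(\Omega_2+\bar\Omega_2) \end{pmatrix},\qquad \tilde\Omega=d\tilde\omega+\tilde\omega\wedge\tilde\omega,$$ let $*$ be the Hodge star of $2\theta^1\theta^2+2\theta^3\theta^4$ on horizontal $2$-forms $\frac12\beta_{\mu\nu}\theta^\mu\wedge\theta^\nu$, with the orientation for which $*(\theta^3\wedge\theta^1)=i\,\theta^3\wedge\theta^1$, let $\tilde\Omega^\pm=\frac12(\tilde\Omega\mp i*\tilde\Omega)=\frac12\tilde\Omega^\pm_{\mu\nu}\theta^\mu\wedge\theta^\nu$, and let $M$ be the $6\times6$ matrix (rows and columns numbered $0,\dots,5$) with entries $1$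 at the positions $(0,3)$ and $(4,5)$ and $0$ elsewhere. Let $\omega$ be the $\mathfrak{su}(2,1)$-valued Cartan connection $$\omega=\begin{pmatrix}\frac13(2\Omega_2+\bar\Omega_2)&i\bar\Omega_3&-\frac12\Omega_4\\ \theta^1&\frac13(\bar\Omega_2-\Omega_2)&-\frac12\Omega_3\\ 2\theta^3&2i\theta^2&-\frac13(2\bar\Omega_2+\Omega_2)\end{pmatrix}.$$ Then a Cartan coframe with $\pi(P)=N$ exists, and every Cartan coframe has the following properties. 1. $\tilde\omega$ is a (pulled back) normal conformal connection: it is $\mathfrak{so}(4,2)$-valued with soldering forms $\theta^1,\dots,\theta^4$, and $\tilde\Omega$ is horizontal, with $\tilde\Omega^A{}_0=0$ for all $A$ (no torsion) and $\sum_{\mu=1}^4\tilde\Omega^\mu{}_{\nu\mu\sigma}=0$ for $1\le\nu,\sigma\le4$. 2. On $P$, $$\tilde D{*}\tilde\Omega:=d{*}\tilde\Omega+\tilde\omega\wedge{*}\tilde\Omega-{*}\tilde\Omega\wedge\tilde\omega=-\frac2i\,\mathcal S_1\,M\;\theta^1\wedge\theta^2\wedge\theta^3 .$$ 3. On $P$,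 $[\tilde\Omega^-_{32},\tilde\Omega^+_{31}]=i\,\mathcal R\bar{\mathcal R}\,M$. At each point of $P$, the commutator Baston–Mason condition $[\tilde\Omega^+_{\mu\nu},\tilde\Omega^-_{\rho\sigma}]=0$ (for all $\mu,\nu,\rho,\sigma$) holds if and only if $\mathcal R=0$, and $\mathcal S_1=0$ if and only if $d\mathcal S\wedge\theta^2\wedge\theta^3\wedge(2\Omega_2+3\bar\Omega_2)\wedge\bar\Omega_3=0$. 4. For every Fefferman metric $g_F=\varphi\,s^*G$ on $U$ and every $x\in U$, the Bach tensor of $g_F$ vanishes at $x$ if and only if $\mathcal S_1(s(x))=0$. In particular $g_F$ is Bach-flat if and only if $\mathcal S_1=0$ along $s$. 5. If a Fefferman metric $g_F=\varphi\,s^*G$ is conformal to an Einstein metric on $U$, then the CR structure is flat there: for every $x\in U$, $\mathcal R(s(x))=0$ and the curvature $d\omega+\omega\wedge\omega$ of $\omega$ vanishes at $s(x)$. -/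

import Mathlib

open scoped ContDiff BigOperators

noncomputable section

namespace CRFefferman

/-! ### Complex-valued differential forms on open subsets of `ℝⁿ` -/

/-- Complex-valued real-linear forms on `ℝⁿ`. -/
abbrev Cov (n : ℕ) := (Fin n → ℝ) →L[ℝ] ℂ

/-- Complex-valued alternating `k`-forms on `ℝⁿ`. -/
abbrev Alt (n k : ℕ) := (Fin n → ℝ) [⋀^Fin k]→L[ℝ] ℂ

/-- Fields of complex-valued `1`-forms on `ℝⁿ`. -/
abbrev OneForm (n : ℕ) := (Fin n → ℝ) → Cov n

/-- The standard basis vectors of `ℝⁿ`. -/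
def stdVec {n : ℕ} (k : Fin n) : Fin n → ℝ := Pi.single k 1

/-- A linear form, regarded as an alternating form in one variable. -/
def toAlt {n : ℕ} (α : Cov n) : Alt n 1 :=
  ContinuousAlternatingMap.ofSubsingleton ℝ (Fin n → ℝ) ℂ (0 : Fin 1) α

/-- The exterior product `α ∧ β` of a `1`-form and a `k`-form:
`(α ∧ β)(v₀, …, v_k) = ∑ᵢ (-1)ⁱ α(vᵢ) β(v₀, …, v̂ᵢ, …, v_k)`. -/
def wedge {n k : ℕ} (α : Cov n) (β : Alt n k) : Alt n (k + 1) :=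
  ContinuousAlternatingMap.alternatizeUncurryFin (α.smulRight β)

/-- The exterior product of two `1`-forms. -/
def wedge₁ {n : ℕ} (α β : Cov n) : Alt n 2 := wedge α (toAlt β)

/-- The exterior derivative of a `1`-form. -/
def extD {n : ℕ} (α : OneForm n) (p : Fin n → ℝ) : Alt n 2 :=
  extDeriv (fun q => toAlt (α q)) p

/-- The complex conjugate of a `1`-form. -/
def conj {n : ℕ} (α : OneForm n) : OneForm n :=
  fun p => (Complex.conjCLE : ℂ →L[ℝ] ℂ).comp (α p)

/-- A real `1`-form, regarded as a complex-valued one. -/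
def ofRealForm {n : ℕ} (α : (Fin n → ℝ) → (Fin n → ℝ) →L[ℝ] ℝ) : OneForm n :=
  fun p => Complex.ofRealCLM.comp (α p)

/-- The pullback of a `1`-form by a map. -/
def pull {m n : ℕ} (f : (Fin m → ℝ) → (Fin n → ℝ)) (α : OneForm n) : OneForm m :=
  fun x => (α (f x)).comp (fderiv ℝ f x)

/-! ### Three-dimensional CR structures -/

/-- A representative `(λ, μ)` of a CR structure on an open set `N ⊆ ℝ³`: `λ` is real, `μ` is
complex and `λ ∧ μ ∧ μ̄ ≠ 0`. -/
structure CRStructure (N : Set (Fin 3 → ℝ)) where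
  lam : (Fin 3 → ℝ) → (Fin 3 → ℝ) →L[ℝ] ℝ
  mu : OneForm 3
  lam_smooth : ContDiffOn ℝ ∞ lam N
  mu_smooth : ContDiffOn ℝ ∞ mu N
  indep : ∀ x ∈ N, wedge (ofRealForm lam x) (wedge₁ (mu x) (conj mu x)) ≠ 0

/-- The CR structure is nondegenerate: `dλ ∧ λ` vanishes nowhere. -/
def CRStructure.Nondegenerate {N : Set (Fin 3 → ℝ)} (cr : CRStructure N) : Prop :=
  ∀ x ∈ N, wedge (ofRealForm cr.lam x) (extD (ofRealForm cr.lam) x) ≠ 0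

/-! ### The Cartan coframe of a nondegenerate CR structure -/

/-- The forms `θ¹, θ³, Ω₂, Ω₃, Ω₄` (with `θ³, Ω₄` real) and the functions `𝓡, 𝓢` on an
8-dimensional space. Their laws are in `IsCartanCoframe`. -/
structure CoframeData where
  th1 : OneForm 8
  th3r : (Fin 8 → ℝ) → (Fin 8 → ℝ) →L[ℝ] ℝ
  Om2 : OneForm 8
  Om3 : OneForm 8
  Om4r : (Fin 8 → ℝ) → (Fin 8 → ℝ) →L[ℝ] ℝ
  R : (Fin 8 → ℝ) → ℂ
  S : (Fin 8 → ℝ) → ℂ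

namespace CoframeData

/-- `θ² = conj θ¹`. -/
def th2 (F : CoframeData) : OneForm 8 := conj F.th1

/-- `θ³` as a complex-valued form. -/
def th3 (F : CoframeData) : OneForm 8 := ofRealForm F.th3r

/-- `Ω̄₂`. -/
def Om2b (F : CoframeData) : OneForm 8 := conj F.Om2

/-- `Ω̄₃`. -/
def Om3b (F : CoframeData) : OneForm 8 := conj F.Om3

/-- `Ω₄` as a complex-valued form. -/
def Om4 (F : CoframeData) : OneForm 8 := ofRealForm F.Om4r

/-- The real form `θ⁴ = (1 / 3i) (Ω₂ - Ω̄₂)`. -/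
def th4 (F : CoframeData) : OneForm 8 :=
  fun p => (1 / (3 * Complex.I)) • (F.Om2 p - F.Om2b p)

/-- The null tetrad `θ¹, θ², θ³, θ⁴`. -/
def tetrad (F : CoframeData) : Fin 4 → OneForm 8 := ![F.th1, F.th2, F.th3, F.th4]

/-- The coframe `θ¹, θ², θ³, Ω₂, Ω̄₂, Ω₃, Ω̄₃, Ω₄`. -/
def coframe (F : CoframeData) : Fin 8 → OneForm 8 :=
  ![F.th1, F.th2, F.th3, F.Om2, F.Om2b, F.Om3, F.Om3b, F.Om4]

/-- The matrix of the coframe with respect to the standard basis. Its determinant is the value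
of `θ¹ ∧ θ² ∧ θ³ ∧ Ω₂ ∧ Ω̄₂ ∧ Ω₃ ∧ Ω̄₃ ∧ Ω₄` on that basis. -/
def coframeMatrix (F : CoframeData) (p : Fin 8 → ℝ) : Matrix (Fin 8) (Fin 8) ℂ :=
  Matrix.of fun j k => F.coframe j p (stdVec k)

/-- The basis `X₁, X₂, X₃, Y₂, Ȳ₂, Y₃, Ȳ₃, Y₄` of complex tangent vectors dual to the coframe,
given by their components with respect to the standard basis. -/
def dualVec (F : CoframeData) (p : Fin 8 → ℝ) (j : Fin 8) : Fin 8 → ℂ :=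
  fun k => (F.coframeMatrix p)⁻¹ k j

/-- The vectors `E₁, …, E₄` with `θ^μ(E_ν) = δ^μ_ν` that are annihilated by
`Ω₂ + Ω̄₂, Ω₃, Ω̄₃, Ω₄`. -/
def tetradVec (F : CoframeData) (p : Fin 8 → ℝ) : Fin 4 → Fin 8 → ℂ :=
  ![F.dualVec p 0, F.dualVec p 1, F.dualVec p 2,
    (3 * Complex.I / 2) • (F.dualVec p 3 - F.dualVec p 4)]

end CoframeData

/-- The complex-linear extension of a linear form, evaluated at a complex vector. -/
def evalC {n : ℕ} (α : Cov n) (Z : Fin n → ℂ) : ℂ := ∑ k, Z k * α (stdVec k)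

/-- The complex-bilinear extension of a `2`-form, evaluated at two complex vectors. -/
def evalC₂ {n : ℕ} (β : Alt n 2) (Z W : Fin n → ℂ) : ℂ :=
  ∑ k, ∑ l, Z k * W l * β ![stdVec k, stdVec l]

/-- `F` is a Cartan coframe, over the open set `P ⊆ ℝ⁸` with projection `π : P → N`, of the CR
structure `[(λ, μ)]`: `θ¹ = b μ + c λ`, `θ³ = a λ` with `a ≠ 0` real and `b ≠ 0`, `c` complex,
the eight forms are linearly independent at each point, and Cartan's structure equations hold.
(The equations for `dθ²`, `dΩ̄₂`, `dΩ̄₃` are the complex conjugates of those for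
`dθ¹`, `dΩ₂`, `dΩ₃`.) -/
structure IsCartanCoframe {N : Set (Fin 3 → ℝ)} (cr : CRStructure N) (P : Set (Fin 8 → ℝ))
    (π : (Fin 8 → ℝ) → (Fin 3 → ℝ)) (F : CoframeData) : Prop where
  isOpen : IsOpen P
  proj_smooth : ContDiffOn ℝ ∞ π P
  proj_mapsTo : Set.MapsTo π P N
  th1_smooth : ContDiffOn ℝ ∞ F.th1 P
  th3_smooth : ContDiffOn ℝ ∞ F.th3r P
  Om2_smooth : ContDiffOn ℝ ∞ F.Om2 P
  Om3_smooth : ContDiffOn ℝ ∞ F.Om3 P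
  Om4_smooth : ContDiffOn ℝ ∞ F.Om4r P
  R_smooth : ContDiffOn ℝ ∞ F.R P
  S_smooth : ContDiffOn ℝ ∞ F.S P
  adapted : ∀ p ∈ P, ∃ (a : ℝ) (b c : ℂ), a ≠ 0 ∧ b ≠ 0 ∧
    F.th1 p = b • pull π cr.mu p + c • pull π (ofRealForm cr.lam) p ∧
    F.th3 p = (a : ℂ) • pull π (ofRealForm cr.lam) p
  coframe_indep : ∀ p ∈ P, (F.coframeMatrix p).det ≠ 0
  d_th1 : ∀ p ∈ P, extD F.th1 p =
    wedge₁ (F.Om2 p) (F.th1 p) + wedge₁ (F.Om3 p) (F.th3 p)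
  d_th3 : ∀ p ∈ P, extD F.th3 p =
    Complex.I • wedge₁ (F.th1 p) (F.th2 p) + wedge₁ (F.Om2 p + F.Om2b p) (F.th3 p)
  d_Om2 : ∀ p ∈ P, extD F.Om2 p =
    (2 * Complex.I) • wedge₁ (F.th1 p) (F.Om3b p) + Complex.I • wedge₁ (F.th2 p) (F.Om3 p)
      + wedge₁ (F.Om4 p) (F.th3 p)
  d_Om3 : ∀ p ∈ P, extD F.Om3 p =
    wedge₁ (F.Om4 p) (F.th1 p) + wedge₁ (F.Om3 p) (F.Om2b p)
      + F.R p • wedge₁ (F.th2 p) (F.th3 p)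
  d_Om4 : ∀ p ∈ P, extD F.Om4 p =
    Complex.I • wedge₁ (F.Om3 p) (F.Om3b p) + wedge₁ (F.Om4 p) (F.Om2 p + F.Om2b p)
      + (starRingEnd ℂ (F.S p)) • wedge₁ (F.th1 p) (F.th3 p)
      + F.S p • wedge₁ (F.th2 p) (F.th3 p)

/-- The function `𝓢₁`: the coefficient of `θ¹` in the expansion of `d𝓢` in the coframe
`θ¹, θ², θ³, Ω₂, Ω̄₂, Ω₃, Ω̄₃, Ω₄`. -/
def CoframeData.S1 (F : CoframeData) (p : Fin 8 → ℝ) : ℂ :=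
  evalC (fderiv ℝ F.S p) (F.dualVec p 0)

/-! ### Matrices of forms -/

/-- Square matrices of `1`-forms. -/
abbrev MatForm (n m : ℕ) := Fin m → Fin m → OneForm n

/-- The curvature `dw + w ∧ w` of a matrix `w` of `1`-forms. -/
def curvature {n m : ℕ} (w : MatForm n m) (i j : Fin m) (p : Fin n → ℝ) : Alt n 2 :=
  extD (w i j) p + ∑ k, wedge₁ (w i k p) (w k j p)

/-- `dΨ + w ∧ Ψ - Ψ ∧ w` for a matrix of `1`-forms `w` and a matrix of `2`-forms `Ψ`
(a `1`-form and a `2`-form commute under the exterior product). -/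
def covExtD {n m : ℕ} (w : MatForm n m) (Ψ : Fin m → Fin m → (Fin n → ℝ) → Alt n 2)
    (i j : Fin m) (p : Fin n → ℝ) : Alt n 3 :=
  extDeriv (Ψ i j) p + ∑ k, wedge (w i k p) (Ψ k j p) - ∑ k, wedge (w k j p) (Ψ i k p)

namespace CoframeData

/-- The `𝔰𝔲(2,1)`-valued Cartan connection `ω`. -/
def suConn (F : CoframeData) : MatForm 8 3 :=
  ![![fun p => (1 / 3 : ℂ) • ((2 : ℂ) • F.Om2 p + F.Om2b p),
      fun p => Complex.I • F.Om3b p,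
      fun p => (-1 / 2 : ℂ) • F.Om4 p],
    ![F.th1,
      fun p => (1 / 3 : ℂ) • (F.Om2b p - F.Om2 p),
      fun p => (-1 / 2 : ℂ) • F.Om3 p],
    ![fun p => (2 : ℂ) • F.th3 p,
      fun p => (2 * Complex.I) • F.th2 p,
      fun p => (-1 / 3 : ℂ) • ((2 : ℂ) • F.Om2b p + F.Om2 p)]]

/-- The `𝔰𝔬(4,2)`-valued matrix of `1`-forms `ω̃`. -/
def confConn (F : CoframeData) : MatForm 8 6 :=
  let A : OneForm 8 := fun p => (1 / 2 : ℂ) • (F.Om2 p + F.Om2b p)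
  let B : OneForm 8 := fun p => (1 / 3 : ℂ) • (F.Om2 p - F.Om2b p)
  let D : OneForm 8 := fun p => (Complex.I / 12) • (F.Om2 p - F.Om2b p)
  let i2 : ℂ := Complex.I / 2
  ![![A, fun p => i2 • F.Om3b p, fun p => -(i2 • F.Om3 p), fun p => -F.Om4 p, D, 0],
    ![F.th1, fun p => -B p, 0, fun p => -F.Om3 p, fun p => i2 • F.th1 p,
      fun p => -(i2 • F.Om3 p)],
    ![F.th2, 0, B, fun p => -F.Om3b p, fun p => -(i2 • F.th2 p), fun p => i2 • F.Om3b p],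
    ![F.th3, fun p => i2 • F.th2 p, fun p => -(i2 • F.th1 p), fun p => -A p, 0, D],
    ![F.th4, F.Om3b, F.Om3, 0, A, fun p => -F.Om4 p],
    ![0, F.th2, F.th1, F.th4, F.th3, fun p => -A p]]

/-- The curvature `Ω̃` of `ω̃`. -/
def confCurv (F : CoframeData) : Fin 6 → Fin 6 → (Fin 8 → ℝ) → Alt 8 2 :=
  curvature F.confConn

/-- The components `β_{μν} = β(E_μ, E_ν)` of a `2`-form `β = ½ β_{μν} θ^μ ∧ θ^ν`. -/
def comp (F : CoframeData) (p : Fin 8 → ℝ) (β : Alt 8 2) : Matrix (Fin 4) (Fin 4) ℂ :=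
  Matrix.of fun μ ν => evalC₂ β (F.tetradVec p μ) (F.tetradVec p ν)

/-- The `2`-form `½ b_{μν} θ^μ ∧ θ^ν`. -/
def ofComp (F : CoframeData) (p : Fin 8 → ℝ) (b : Matrix (Fin 4) (Fin 4) ℂ) : Alt 8 2 :=
  (1 / 2 : ℂ) • ∑ μ, ∑ ν, b μ ν • wedge₁ (F.tetrad μ p) (F.tetrad ν p)

end CoframeData

/-- The components of the metric `2 θ¹ θ² + 2 θ³ θ⁴` in the null tetrad; this matrix is its own
inverse. -/
def gNull : Matrix (Fin 4) (Fin 4) ℂ := !![0, 1, 0, 0; 1, 0, 0, 0; 0, 0, 0, 1; 0, 0, 1, 0]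

/-- The components `η_{μνρσ}` of the volume form of `2 θ¹ θ² + 2 θ³ θ⁴`, for the orientation in
which `θ³ ∧ θ¹` is self-dual: `η = -i θ¹ ∧ θ² ∧ θ³ ∧ θ⁴`. -/
def volNull (μ ν ρ σ : Fin 4) : ℂ :=
  -Complex.I * Matrix.det (Matrix.of fun i j : Fin 4 => if ![μ, ν, ρ, σ] i = j then (1 : ℂ) else 0)

/-- The Hodge star on components of `2`-forms:
`(*β)_{μν} = ½ η_{μνρσ} g^{ρα} g^{σγ} β_{αγ}`. -/
def hodge (b : Matrix (Fin 4) (Fin 4) ℂ) : Matrix (Fin 4) (Fin 4) ℂ :=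
  Matrix.of fun μ ν => (1 / 2 : ℂ) *
    ∑ ρ, ∑ σ, ∑ α, ∑ γ, volNull μ ν ρ σ * gNull ρ α * gNull σ γ * b α γ

/-- The self-dual part (`*β = iβ`). -/
def sdPart (b : Matrix (Fin 4) (Fin 4) ℂ) : Matrix (Fin 4) (Fin 4) ℂ :=
  (1 / 2 : ℂ) • (b - Complex.I • hodge b)

/-- The anti-self-dual part (`*β = -iβ`). -/
def asdPart (b : Matrix (Fin 4) (Fin 4) ℂ) : Matrix (Fin 4) (Fin 4) ℂ :=
  (1 / 2 : ℂ) • (b + Complex.I • hodge b)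

/-- The invariant bilinear form of `𝔰𝔬(4,2)`. -/
def formSO : Matrix (Fin 6) (Fin 6) ℂ :=
  !![0, 0, 0, 0, 0, -1;
     0, 0, 1, 0, 0, 0;
     0, 1, 0, 0, 0, 0;
     0, 0, 0, 0, 1, 0;
     0, 0, 0, 1, 0, 0;
     -1, 0, 0, 0, 0, 0]

/-- The position of a tetrad index `μ` in the range `1, …, 4` among the indices `0, …, 5`. -/
def tIdx (μ : Fin 4) : Fin 6 := μ.succ.castSucc

namespace CoframeData

/-- The matrix of forms `w` is, at the points of `P`, a (pulled back) normal conformal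
connection of the metric `2 θ¹ θ² + 2 θ³ θ⁴`: it is `𝔰𝔬(4,2)`-valued, its soldering forms are the
`θ^μ`, and its curvature is horizontal, has no torsion (and no dilation) part, and has a
trace-free Weyl part: its components satisfy `∑_μ W^μ_{νμσ} = 0`. -/
structure IsNormalConformal (F : CoframeData) (P : Set (Fin 8 → ℝ)) (w : MatForm 8 6) : Prop where
  so_valued : ∀ p ∈ P, ∀ A B : Fin 6,
    ∑ C, (formSO A C • w C B p + formSO B C • w C A p) = 0
  soldering : ∀ p ∈ P, ∀ μ : Fin 4, w (tIdx μ) 0 p = F.tetrad μ p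
  soldering_last : ∀ p ∈ P, w 5 0 p = 0
  horizontal : ∀ p ∈ P, ∀ A B : Fin 6,
    curvature w A B p = F.ofComp p (F.comp p (curvature w A B p))
  torsion_free : ∀ p ∈ P, ∀ A : Fin 6, curvature w A 0 p = 0
  trace_free : ∀ p ∈ P, ∀ ν σ : Fin 4,
    ∑ μ, F.comp p (curvature w (tIdx μ) (tIdx ν) p) μ σ = 0

/-- The matrix of `2`-forms `*Ω̃`. -/
def starCurv (F : CoframeData) (A B : Fin 6) (p : Fin 8 → ℝ) : Alt 8 2 :=
  F.ofComp p (hodge (F.comp p (F.confCurv A B p)))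

/-- The Yang–Mills current `D̃*Ω̃ = d*Ω̃ + ω̃ ∧ *Ω̃ - *Ω̃ ∧ ω̃`. -/
def ymCurrent (F : CoframeData) (A B : Fin 6) (p : Fin 8 → ℝ) : Alt 8 3 :=
  covExtD F.confConn F.starCurv A B p

/-- The `6 × 6` matrix `Ω̃⁺_{μν}`. -/
def curvPlus (F : CoframeData) (p : Fin 8 → ℝ) (μ ν : Fin 4) : Matrix (Fin 6) (Fin 6) ℂ :=
  Matrix.of fun A B => sdPart (F.comp p (F.confCurv A B p)) μ ν

/-- The `6 × 6` matrix `Ω̃⁻_{μν}`. -/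
def curvMinus (F : CoframeData) (p : Fin 8 → ℝ) (μ ν : Fin 4) : Matrix (Fin 6) (Fin 6) ℂ :=
  Matrix.of fun A B => asdPart (F.comp p (F.confCurv A B p)) μ ν

/-- The commutator Baston–Mason condition at `p`: `[Ω̃⁺_{μν}, Ω̃⁻_{ρσ}] = 0`. -/
def BastonMasonCommutator (F : CoframeData) (p : Fin 8 → ℝ) : Prop :=
  ∀ μ ν ρ σ : Fin 4, ⁅F.curvPlus p μ ν, F.curvMinus p ρ σ⁆ = 0

end CoframeData

/-- The matrix with entries `1` at the positions `(0,3)` and `(4,5)` and `0` elsewhere. -/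
def matM : Matrix (Fin 6) (Fin 6) ℂ :=
  !![0, 0, 0, 1, 0, 0;
     0, 0, 0, 0, 0, 0;
     0, 0, 0, 0, 0, 0;
     0, 0, 0, 0, 0, 0;
     0, 0, 0, 0, 0, 1;
     0, 0, 0, 0, 0, 0]

/-! ### Curvature of a metric in four coordinates -/

/-- Fields of bilinear forms on (open subsets of) `ℝ⁴`, given by their components. -/
abbrev MetricField := (Fin 4 → ℝ) → Matrix (Fin 4) (Fin 4) ℝ

/-- The partial derivative `∂_k f`. -/
def pd (k : Fin 4) (f : (Fin 4 → ℝ) → ℝ) (x : Fin 4 → ℝ) : ℝ := fderiv ℝ f x (stdVec k)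

namespace MetricField

/-- Christoffel symbols `Γ^a_{bc}`. -/
def Γ (g : MetricField) (a b c : Fin 4) (x : Fin 4 → ℝ) : ℝ :=
  (1 / 2) * ∑ d, (g x)⁻¹ a d *
    (pd b (fun y => g y d c) x + pd c (fun y => g y d b) x - pd d (fun y => g y b c) x)

/-- The Riemann tensor `R^a_{bcd} = ∂_c Γ^a_{db} - ∂_d Γ^a_{cb} + Γ^a_{ce} Γ^e_{db} - Γ^a_{de} Γ^e_{cb}`. -/
def riem (g : MetricField) (a b c d : Fin 4) (x : Fin 4 → ℝ) : ℝ :=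
  pd c (Γ g a d b) x - pd d (Γ g a c b) x
    + ∑ e, (Γ g a c e x * Γ g e d b x - Γ g a d e x * Γ g e c b x)

/-- The Ricci tensor `R_{bd} = R^a_{bad}`. -/
def ric (g : MetricField) (b d : Fin 4) (x : Fin 4 → ℝ) : ℝ := ∑ a, riem g a b a d x

/-- The scalar curvature. -/
def scal (g : MetricField) (x : Fin 4 → ℝ) : ℝ := ∑ b, ∑ d, (g x)⁻¹ b d * ric g b d x

/-- The Schouten tensor `P_{ab} = ½ (R_{ab} - (R/6) g_{ab})`. -/
def schouten (g : MetricField) (a b : Fin 4) (x : Fin 4 → ℝ) : ℝ :=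
  (1 / 2) * (ric g a b x - scal g x / 6 * g x a b)

/-- The Weyl tensor `C_{abcd}`. -/
def weyl (g : MetricField) (a b c d : Fin 4) (x : Fin 4 → ℝ) : ℝ :=
  (∑ e, g x a e * riem g e b c d x)
    - (g x a c * schouten g b d x - g x a d * schouten g b c x
      - g x b c * schouten g a d x + g x b d * schouten g a c x)

/-- The covariant derivative `∇_c P_{ab}` of the Schouten tensor. -/
def covSchouten (g : MetricField) (c a b : Fin 4) (x : Fin 4 → ℝ) : ℝ :=
  pd c (schouten g a b) x
    - ∑ e, (Γ g e c a x * schouten g e b x + Γ g e c b x * schouten g a e x)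

/-- The Cotton tensor `C_{abc} = ∇_c P_{ab} - ∇_b P_{ac}`. -/
def cotton (g : MetricField) (a b c : Fin 4) (x : Fin 4 → ℝ) : ℝ :=
  covSchouten g c a b x - covSchouten g b a c x

/-- The covariant derivative `∇_d C_{abc}` of the Cotton tensor. -/
def covCotton (g : MetricField) (d a b c : Fin 4) (x : Fin 4 → ℝ) : ℝ :=
  pd d (cotton g a b c) x
    - ∑ e, (Γ g e d a x * cotton g e b c x + Γ g e d b x * cotton g a e c x
      + Γ g e d c x * cotton g a b e x)

/-- The Bach tensor `B_{ab} = ∇^c C_{abc} - P^{cd} C_{cabd}`. -/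
def bach (g : MetricField) (x : Fin 4 → ℝ) : Matrix (Fin 4) (Fin 4) ℝ :=
  Matrix.of fun a b =>
    (∑ c, ∑ d, (g x)⁻¹ c d * covCotton g d a b c x)
      - ∑ c, ∑ d, (∑ e, ∑ f, (g x)⁻¹ c e * (g x)⁻¹ d f * schouten g e f x) * weyl g c a b d x

/-- `Ric = Λ g` on `U`. The function `Λ` is then automatically locally constant. -/
def IsEinstein (g : MetricField) (U : Set (Fin 4 → ℝ)) : Prop :=
  ∃ Λ : (Fin 4 → ℝ) → ℝ, ∀ x ∈ U, ∀ a b, ric g a b x = Λ x * g x a b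

/-- Some positive smooth multiple of `g` is an Einstein metric on `U`. -/
def IsConformallyEinstein (g : MetricField) (U : Set (Fin 4 → ℝ)) : Prop :=
  ∃ ψ : (Fin 4 → ℝ) → ℝ, ContDiffOn ℝ ∞ ψ U ∧ (∀ x ∈ U, 0 < ψ x) ∧
    IsEinstein (fun x => ψ x • g x) U

end MetricField

/-! ### Fefferman metrics -/

/-- The bilinear form `G = 2 θ¹ θ² + (2 / 3i) θ³ (Ω₂ - Ω̄₂)`, where a product of `1`-forms is the
symmetrized one, `2 α β = α ⊗ β + β ⊗ α`. Its values are real. -/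
def CoframeData.G (F : CoframeData) (p u v : Fin 8 → ℝ) : ℂ :=
  F.th1 p u * F.th2 p v + F.th2 p u * F.th1 p v
    + 1 / (3 * Complex.I) *
      (F.th3 p u * (F.Om2 p v - F.Om2b p v) + (F.Om2 p u - F.Om2b p u) * F.th3 p v)

/-- `s : U → P` is a smooth local section of the projection of `P` to the 4-dimensional space
`P/∼` of leaves of the foliation `θ¹ = θ² = θ³ = Ω₂ - Ω̄₂ = 0`, i.e. a map defined on an open
subset of `ℝ⁴` (a chart of `P/∼`) and transversal to the leaves. -/
structure IsLeafSection (F : CoframeData) (P : Set (Fin 8 → ℝ)) (U : Set (Fin 4 → ℝ))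
    (s : (Fin 4 → ℝ) → (Fin 8 → ℝ)) : Prop where
  isOpen : IsOpen U
  smooth : ContDiffOn ℝ ∞ s U
  mapsTo : Set.MapsTo s U P
  transversal : ∀ x ∈ U,
    (Matrix.of fun μ k : Fin 4 => pull s (F.tetrad μ) x (stdVec k)).det ≠ 0

/-- `g` is, on the chart `U` of `P/∼` with local section `s`, a metric of the Fefferman conformal
class `[g_F]`: a positive multiple of the metric `s^*G` to which `G` descends. -/
def IsFeffermanMetric (F : CoframeData) (U : Set (Fin 4 → ℝ))
    (s : (Fin 4 → ℝ) → (Fin 8 → ℝ)) (g : MetricField) : Prop :=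
  ∃ φ : (Fin 4 → ℝ) → ℝ, ContDiffOn ℝ ∞ φ U ∧ (∀ x ∈ U, 0 < φ x) ∧
    ∀ x ∈ U, ∀ a b : Fin 4, g x a b = φ x *
      (F.G (s x) (fderiv ℝ s x (stdVec a)) (fderiv ℝ s x (stdVec b))).re

end CRFefferman

end

open CRFefferman

open scoped ContDiff BigOperators

noncomputable section

namespace CRFefferman

/-! ### Evaluation of exterior products and derivatives -/

section Forms

variable {n k : ℕ}

/-! Everything rests on one computation. In the curvature of `ω̃` the structure equations cancel
every term except those carrying `𝓡` and `𝓢`. What remains is `(R̄ N₁ - S̄ M) θ¹∧θ³ + (R N₂ - S M)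
θ²∧θ³` with constant nilpotent matrices (`confCurv_eq`). Normality is then read off the entries.
Since `θ¹∧θ³` is self-dual and `θ²∧θ³` anti-self-dual (`hodge_null`), these two terms are also the
self-dual and anti-self-dual parts. The commutator of their coefficients is computed from `[N₂, N₁]
= i M`, all products with `M` being zero.

Applying `d² = 0` to `Ω₃` and `Ω₄` expresses `d𝓡` and `d𝓢` modulo `θ²`, `θ³` (and `θ¹` for `𝓢`), and
it shows that `𝓢₁` is real. Hence the covariant derivatives of the two curvature coefficients are
known up to terms killed by `θ¹∧θ³`, respectively `θ²∧θ³`. The surviving terms `-𝓢₁ M θ²` and `-𝓢₁ M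
θ¹` cancel in `D̃Ω̃`, as the Bianchi identity demands, and add up in `D̃*Ω̃` (`ymCurrent_eq`).

For the Bach tensor, `s^*ω̃` is moved by an explicit gauge transformation `gaugeH` to the gauge in
which its first column is the coordinate coframe and its invariant form is built from `g_F`
(`isConfGauge`). A connection with these properties, no torsion and trace-free curvature is forced
to have the Levi-Civita connection as middle block and minus the Schouten tensor as top row. Its
curvature therefore consists of the Weyl and Cotton tensors, and the top row of its divergence is
the Bach tensor (`IsConfGauge.cast_bach`). The divergence is gauge covariant, and along the section
it equals `2 𝓢₁ φ⁻¹ θ³_b M` (`divM_connS`), so `B_{ab} = 2 𝓢₁ φ⁻¹ θ³_a θ³_b`.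

An Einstein metric in the conformal class makes the last column of the connection a scalar multiple
of the identity. The last column of the curvature then involves only the differential of that
scalar, and comparison with the explicit curvature through the gauge transformation forces `𝓡 = 𝓢 =
0` (`einstein_flat`). The structure equations then give `dω + ω∧ω = 0`.

Existence is Cartan's construction. A frame with `dr = i t∧t̄` is chosen on `N`, and the connection
forms are solved for algebraically; the Bianchi identities remove the unwanted coefficients
(`exists_isCartanSystem`). The solution is pulled back to `N × ℂ* × ℂ × ℝ` and transformed by the
gauge transformations `dilate`, `shear` and `boost` with the fibre coordinates as parameters. The
differentials of these parameters supply the five missing independent forms. -/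

@[simp]
theorem toAlt_apply (α : Cov n) (v : Fin 1 → Fin n → ℝ) : toAlt α v = α (v 0) := rfl

theorem wedge_apply (α : Cov n) (β : Alt n k) (v : Fin (k + 1) → Fin n → ℝ) :
    wedge α β v = ∑ i : Fin (k + 1), (-1 : ℂ) ^ (i : ℕ) * (α (v i) * β (i.removeNth v)) := by
  rw [wedge, ContinuousAlternatingMap.alternatizeUncurryFin_apply]
  refine Finset.sum_congr rfl fun i _ => ?_
  simp [zsmul_eq_mul]

@[simp]
theorem wedge₁_apply (α β : Cov n) (v : Fin 2 → Fin n → ℝ) :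
    wedge₁ α β v = α (v 0) * β (v 1) - α (v 1) * β (v 0) := by
  simp [wedge₁, wedge_apply, Fin.sum_univ_two, Fin.removeNth]
  ring

@[simp]
theorem wedge_two_apply (α : Cov n) (β : Alt n 2) (v : Fin 3 → Fin n → ℝ) :
    wedge α β v = α (v 0) * β ![v 1, v 2] - α (v 1) * β ![v 0, v 2] + α (v 2) * β ![v 0, v 1] := by
  have h0 : (0 : Fin 3).removeNth v = ![v 1, v 2] := by ext i; fin_cases i <;> rfl
  have h1 : (1 : Fin 3).removeNth v = ![v 0, v 2] := by ext i; fin_cases i <;> rfl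
  have h2 : (2 : Fin 3).removeNth v = ![v 0, v 1] := by ext i; fin_cases i <;> rfl
  rw [wedge_apply, Fin.sum_univ_three, h0, h1, h2]
  simp
  ring

theorem wedge_add_left (α α' : Cov n) (β : Alt n k) :
    wedge (α + α') β = wedge α β + wedge α' β := by
  ext v; simp [wedge_apply, add_mul, mul_add, Finset.sum_add_distrib]

theorem wedge_smul_left (c : ℂ) (α : Cov n) (β : Alt n k) :
    wedge (c • α) β = c • wedge α β := by
  ext v; simp only [wedge_apply, ContinuousAlternatingMap.smul_apply,
    _root_.smul_apply, smul_eq_mul, Finset.mul_sum]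
  exact Finset.sum_congr rfl fun i _ => by ring

theorem wedge_add_right (α : Cov n) (β β' : Alt n k) :
    wedge α (β + β') = wedge α β + wedge α β' := by
  ext v; simp [wedge_apply, mul_add, Finset.sum_add_distrib]

/-- Differentiation of wedge products of fields of forms goes through the derivative of a bounded
bilinear map. -/
theorem isBoundedBilinearMap_wedge :
    IsBoundedBilinearMap ℝ (fun q : Cov n × Alt n k => wedge q.1 q.2) where
  add_left := wedge_add_left
  add_right := wedge_add_right
  smul_left c α β := by
    ext v
    simp [wedge_apply, Finset.mul_sum]
    exact Finset.sum_congr rfl fun i _ => by ring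
  smul_right c α β := by
    ext v
    simp [wedge_apply, Finset.mul_sum]
    exact Finset.sum_congr rfl fun i _ => by ring
  bound := by
    refine ⟨k + 1, by positivity, fun α β => ?_⟩
    refine (ContinuousAlternatingMap.norm_alternatizeUncurryFin_le _).trans ?_
    rw [mul_assoc]
    refine mul_le_mul_of_nonneg_left ?_ (by positivity)
    refine ContinuousLinearMap.opNorm_le_bound _ (by positivity) fun x => ?_
    rw [ContinuousLinearMap.smulRight_apply, norm_smul]
    calc ‖α x‖ * ‖β‖ ≤ ‖α‖ * ‖x‖ * ‖β‖ :=
          mul_le_mul_of_nonneg_right (α.le_opNorm x) (norm_nonneg _)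
      _ = ‖α‖ * ‖β‖ * ‖x‖ := by ring

theorem isBoundedBilinearMap_wedge₁ :
    IsBoundedBilinearMap ℝ (fun q : Cov n × Cov n => wedge₁ q.1 q.2) := by
  have h := (isBoundedBilinearMap_wedge (n := n) (k := 1))
  exact
  { add_left := fun a b c => h.add_left a b (toAlt c)
    smul_left := fun a b c => h.smul_left a b (toAlt c)
    add_right := fun a b c => h.add_right a (toAlt b) (toAlt c)
    smul_right := fun a b c => h.smul_right a b (toAlt c)
    bound := by
      obtain ⟨C, hC, hb⟩ := h.bound
      refine ⟨C, hC, fun a b => (hb a (toAlt b)).trans (le_of_eq ?_)⟩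
      rw [toAlt, ContinuousAlternatingMap.norm_ofSubsingleton] }

theorem extDeriv_two_apply {w : (Fin n → ℝ) → Alt n 2} {p : Fin n → ℝ} (v : Fin 3 → Fin n → ℝ) :
    extDeriv w p v = fderiv ℝ w p (v 0) ![v 1, v 2] - fderiv ℝ w p (v 1) ![v 0, v 2]
      + fderiv ℝ w p (v 2) ![v 0, v 1] := by
  have h0 : (0 : Fin 3).removeNth v = ![v 1, v 2] := by ext i; fin_cases i <;> rfl
  have h1 : (1 : Fin 3).removeNth v = ![v 0, v 2] := by ext i; fin_cases i <;> rfl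
  have h2 : (2 : Fin 3).removeNth v = ![v 0, v 1] := by ext i; fin_cases i <;> rfl
  rw [extDeriv, ContinuousAlternatingMap.alternatizeUncurryFin_apply]
  rw [Fin.sum_univ_three, h0, h1, h2]
  simp
  ring

theorem hasFDerivAt_toAlt {α : OneForm n} {p : Fin n → ℝ} (h : DifferentiableAt ℝ α p) :
    HasFDerivAt (fun q => toAlt (α q))
      ((ContinuousAlternatingMap.ofSubsingletonLIE (𝕜 := ℝ) (E := Fin n → ℝ) (F := ℂ) (0 : Fin 1) :
        Cov n →L[ℝ] Alt n 1).comp (fderiv ℝ α p)) p :=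
  (ContinuousAlternatingMap.ofSubsingletonLIE (𝕜 := ℝ) (E := Fin n → ℝ) (F := ℂ) (0 : Fin 1) :
    Cov n →L[ℝ] Alt n 1).hasFDerivAt.comp p h.hasFDerivAt

theorem extD_apply {α : OneForm n} {p : Fin n → ℝ} (h : DifferentiableAt ℝ α p)
    (v : Fin 2 → Fin n → ℝ) :
    extD α p v = fderiv ℝ α p (v 0) (v 1) - fderiv ℝ α p (v 1) (v 0) := by
  rw [extD, extDeriv, (hasFDerivAt_toAlt h).fderiv,
    ContinuousAlternatingMap.alternatizeUncurryFin_apply]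
  simp [Fin.sum_univ_two, Fin.removeNth, ContinuousAlternatingMap.ofSubsingletonLIE]
  rfl

theorem fderiv_wedge₁ {α β : OneForm n} {p : Fin n → ℝ} (hα : DifferentiableAt ℝ α p)
    (hβ : DifferentiableAt ℝ β p) (u : Fin n → ℝ) :
    fderiv ℝ (fun q => wedge₁ (α q) (β q)) p u =
      wedge₁ (α p) (fderiv ℝ β p u) + wedge₁ (fderiv ℝ α p u) (β p) := by
  have h := (isBoundedBilinearMap_wedge₁ (n := n)).hasFDerivAt (α p, β p)
  have h2 := h.comp p (hα.hasFDerivAt.prodMk hβ.hasFDerivAt)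
  have h3 : HasFDerivAt (fun q => wedge₁ (α q) (β q)) _ p := h2
  rw [h3.fderiv]
  simp

theorem differentiableAt_wedge₁ {α β : OneForm n} {p : Fin n → ℝ} (hα : DifferentiableAt ℝ α p)
    (hβ : DifferentiableAt ℝ β p) : DifferentiableAt ℝ (fun q => wedge₁ (α q) (β q)) p :=
  DifferentiableAt.comp (g := fun q : Cov n × Cov n => wedge₁ q.1 q.2) p
    ((isBoundedBilinearMap_wedge₁ (n := n)).differentiableAt (α p, β p)) (hα.prodMk hβ)

/-- The Leibniz rule `d(α ∧ β) = β ∧ dα - α ∧ dβ`. -/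
theorem extDeriv_wedge₁ {α β : OneForm n} {p : Fin n → ℝ} (hα : DifferentiableAt ℝ α p)
    (hβ : DifferentiableAt ℝ β p) :
    extDeriv (fun q => wedge₁ (α q) (β q)) p =
      wedge (β p) (extD α p) - wedge (α p) (extD β p) := by
  ext v
  rw [extDeriv_two_apply]
  simp [fderiv_wedge₁ hα hβ, extD_apply hα, extD_apply hβ]
  ring

theorem fderiv_smul_form {f : (Fin n → ℝ) → ℂ} {w : (Fin n → ℝ) → Alt n k} {p : Fin n → ℝ}
    (hf : DifferentiableAt ℝ f p) (hw : DifferentiableAt ℝ w p) (u : Fin n → ℝ) :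
    fderiv ℝ (fun q => f q • w q) p u = f p • fderiv ℝ w p u + fderiv ℝ f p u • w p := by
  rw [fderiv_fun_smul hf hw]
  simp

/-- The Leibniz rule `d(f β) = df ∧ β + f dβ` for a `2`-form `β`. -/
theorem extDeriv_smul_two {f : (Fin n → ℝ) → ℂ} {w : (Fin n → ℝ) → Alt n 2} {p : Fin n → ℝ}
    (hf : DifferentiableAt ℝ f p) (hw : DifferentiableAt ℝ w p) :
    extDeriv (fun q => f q • w q) p = wedge (fderiv ℝ f p) (w p) + f p • extDeriv w p := by
  ext v
  simp only [extDeriv_two_apply, fderiv_smul_form hf hw, ContinuousAlternatingMap.add_apply,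
    ContinuousAlternatingMap.smul_apply, wedge_two_apply, smul_eq_mul]
  ring

theorem extD_smul_apply {f : (Fin n → ℝ) → ℂ} {α : OneForm n} {p : Fin n → ℝ}
    (hf : DifferentiableAt ℝ f p) (hα : DifferentiableAt ℝ α p) :
    extD (fun q => f q • α q) p = wedge₁ (fderiv ℝ f p) (α p) + f p • extD α p := by
  ext v
  rw [extD_apply (hf.fun_smul hα), fderiv_fun_smul hf hα]
  simp [extD_apply hα]
  ring

theorem extD_const_smul {α : OneForm n} {p : Fin n → ℝ} (c : ℂ) (hα : DifferentiableAt ℝ α p) :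
    extD (fun q => c • α q) p = c • extD α p := by
  ext v
  rw [extD_apply (hα.fun_const_smul c), fderiv_fun_const_smul hα]
  simp [extD_apply hα]
  ring

theorem extD_add {α β : OneForm n} {p : Fin n → ℝ} (hα : DifferentiableAt ℝ α p)
    (hβ : DifferentiableAt ℝ β p) :
    extD (fun q => α q + β q) p = extD α p + extD β p := by
  ext v
  rw [extD_apply (hα.fun_add hβ), fderiv_fun_add hα hβ]
  simp [extD_apply hα, extD_apply hβ]
  ring

theorem extD_sub {α β : OneForm n} {p : Fin n → ℝ} (hα : DifferentiableAt ℝ α p)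
    (hβ : DifferentiableAt ℝ β p) :
    extD (fun q => α q - β q) p = extD α p - extD β p := by
  ext v
  rw [extD_apply (hα.fun_sub hβ), fderiv_fun_sub hα hβ]
  simp [extD_apply hα, extD_apply hβ]
  ring

theorem extD_neg {α : OneForm n} {p : Fin n → ℝ} (hα : DifferentiableAt ℝ α p) :
    extD (fun q => -α q) p = -extD α p := by
  ext v
  rw [extD_apply hα.fun_neg, fderiv_fun_neg]
  simp [extD_apply hα]
  ring

@[simp]
theorem extD_zero (p : Fin n → ℝ) : extD (0 : OneForm n) p = 0 := by
  ext v
  have h := extD_apply (α := (0 : OneForm n)) (p := p) (differentiableAt_const (0 : Cov n)) v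
  rw [h]
  simp

@[simp]
theorem conj_apply (α : OneForm n) (p u : Fin n → ℝ) : conj α p u = starRingEnd ℂ (α p u) := rfl

@[simp]
theorem ofRealForm_apply (α : (Fin n → ℝ) → (Fin n → ℝ) →L[ℝ] ℝ) (p u : Fin n → ℝ) :
    ofRealForm α p u = (α p u : ℂ) := rfl

theorem hasFDerivAt_conj {α : OneForm n} {p : Fin n → ℝ} (hα : DifferentiableAt ℝ α p) :
    HasFDerivAt (conj α) ((ContinuousLinearMap.compL ℝ (Fin n → ℝ) ℂ ℂ
      (Complex.conjCLE : ℂ →L[ℝ] ℂ)).comp (fderiv ℝ α p)) p :=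
  ((ContinuousLinearMap.compL ℝ (Fin n → ℝ) ℂ ℂ
      (Complex.conjCLE : ℂ →L[ℝ] ℂ)).hasFDerivAt).comp p hα.hasFDerivAt

theorem differentiableAt_conj {α : OneForm n} {p : Fin n → ℝ} (hα : DifferentiableAt ℝ α p) :
    DifferentiableAt ℝ (conj α) p :=
  (hasFDerivAt_conj hα).differentiableAt

theorem extD_conj_apply {α : OneForm n} {p : Fin n → ℝ} (hα : DifferentiableAt ℝ α p)
    (v : Fin 2 → Fin n → ℝ) : extD (conj α) p v = starRingEnd ℂ (extD α p v) := by
  rw [extD_apply (differentiableAt_conj hα), extD_apply hα, (hasFDerivAt_conj hα).fderiv]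
  simp

theorem contDiffOn_conj {α : OneForm n} {s : Set (Fin n → ℝ)} (hα : ContDiffOn ℝ ∞ α s) :
    ContDiffOn ℝ ∞ (conj α) s :=
  ((ContinuousLinearMap.compL ℝ (Fin n → ℝ) ℂ ℂ
      (Complex.conjCLE : ℂ →L[ℝ] ℂ)).contDiff).comp_contDiffOn hα

theorem contDiffOn_ofRealForm {α : (Fin n → ℝ) → (Fin n → ℝ) →L[ℝ] ℝ} {s : Set (Fin n → ℝ)}
    (hα : ContDiffOn ℝ ∞ α s) : ContDiffOn ℝ ∞ (ofRealForm α) s :=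
  ((ContinuousLinearMap.compL ℝ (Fin n → ℝ) ℝ ℂ Complex.ofRealCLM).contDiff).comp_contDiffOn hα

theorem fderiv_conj_fun {f : (Fin n → ℝ) → ℂ} {p : Fin n → ℝ} (hf : DifferentiableAt ℝ f p)
    (u : Fin n → ℝ) :
    fderiv ℝ (fun q => starRingEnd ℂ (f q)) p u = starRingEnd ℂ (fderiv ℝ f p u) := by
  have h : HasFDerivAt (fun q => starRingEnd ℂ (f q))
      ((Complex.conjCLE : ℂ →L[ℝ] ℂ).comp (fderiv ℝ f p)) p :=
    (Complex.conjCLE : ℂ →L[ℝ] ℂ).hasFDerivAt.comp p hf.hasFDerivAt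
  rw [h.fderiv]
  rfl

theorem contDiffOn_toAlt {α : OneForm n} {s : Set (Fin n → ℝ)} (hα : ContDiffOn ℝ ∞ α s) :
    ContDiffOn ℝ ∞ (fun q => toAlt (α q)) s :=
  (ContinuousAlternatingMap.ofSubsingletonLIE (𝕜 := ℝ) (E := Fin n → ℝ) (F := ℂ)
    (0 : Fin 1)).contDiff.comp_contDiffOn hα

theorem two_le_infty : (2 : WithTop ℕ∞) ≤ ∞ := by
  have h : ((2 : ℕ∞) : WithTop ℕ∞) ≤ ((⊤ : ℕ∞) : WithTop ℕ∞) := WithTop.coe_le_coe.2 le_top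
  exact h

/-- `d² = 0`. -/
theorem extDeriv_extD {α : OneForm n} {s : Set (Fin n → ℝ)} (hs : IsOpen s)
    (hα : ContDiffOn ℝ ∞ α s) {p : Fin n → ℝ} (hp : p ∈ s) :
    extDeriv (fun q => extD α q) p = 0 :=
  extDeriv_extDeriv_apply (((contDiffOn_toAlt hα).contDiffAt (hs.mem_nhds hp)))
    (by rw [minSmoothness_of_isRCLikeNormedField]; exact two_le_infty)

theorem contDiffOn_pull {m : ℕ} {f : (Fin m → ℝ) → (Fin n → ℝ)} {α : OneForm n}
    {U : Set (Fin m → ℝ)} {s : Set (Fin n → ℝ)} (hU : IsOpen U) (hf : ContDiffOn ℝ ∞ f U)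
    (hα : ContDiffOn ℝ ∞ α s) (hfs : Set.MapsTo f U s) : ContDiffOn ℝ ∞ (pull f α) U :=
  (hα.comp hf hfs).clm_comp (hf.fderiv_of_isOpen hU (by simp))

theorem extD_pull {m : ℕ} {f : (Fin m → ℝ) → (Fin n → ℝ)} {α : OneForm n} {x : Fin m → ℝ}
    (hα : DifferentiableAt ℝ α (f x)) (hf : ContDiffAt ℝ ∞ f x) :
    extD (pull f α) x = (extD α (f x)).compContinuousLinearMap (fderiv ℝ f x) :=
  extDeriv_pullback (hasFDerivAt_toAlt hα).differentiableAt hf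
    (by rw [minSmoothness_of_isRCLikeNormedField]; exact two_le_infty)

end Forms

/-! ### Complex vectors -/

section Eval

variable {n : ℕ}

theorem evalC_add (α β : Cov n) (Z : Fin n → ℂ) : evalC (α + β) Z = evalC α Z + evalC β Z := by
  simp [evalC, mul_add, Finset.sum_add_distrib]

theorem evalC_smul (c : ℂ) (α : Cov n) (Z : Fin n → ℂ) : evalC (c • α) Z = c * evalC α Z := by
  simp only [evalC, _root_.smul_apply, smul_eq_mul, Finset.mul_sum]
  exact Finset.sum_congr rfl fun i _ => by ring

theorem evalC_sub (α β : Cov n) (Z : Fin n → ℂ) : evalC (α - β) Z = evalC α Z - evalC β Z := by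
  simp [evalC, mul_sub, Finset.sum_sub_distrib]

theorem evalC_vec_smul (c : ℂ) (α : Cov n) (Z : Fin n → ℂ) : evalC α (c • Z) = c * evalC α Z := by
  simp [evalC, Finset.mul_sum, mul_assoc]

theorem evalC_vec_sub (α : Cov n) (Z W : Fin n → ℂ) :
    evalC α (Z - W) = evalC α Z - evalC α W := by
  simp [evalC, sub_mul, Finset.sum_sub_distrib]

theorem cov_apply_eq_sum (α : Cov n) (u : Fin n → ℝ) : α u = ∑ k, (u k : ℂ) * α (stdVec k) := by
  conv_lhs => rw [pi_eq_sum_univ' u]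
  simp only [map_sum, map_smul, Complex.real_smul]
  rfl

theorem evalC₂_add (β γ : Alt n 2) (Z W : Fin n → ℂ) :
    evalC₂ (β + γ) Z W = evalC₂ β Z W + evalC₂ γ Z W := by
  simp [evalC₂, mul_add, Finset.sum_add_distrib]

theorem evalC₂_smul (c : ℂ) (β : Alt n 2) (Z W : Fin n → ℂ) :
    evalC₂ (c • β) Z W = c * evalC₂ β Z W := by
  simp only [evalC₂, ContinuousAlternatingMap.smul_apply, smul_eq_mul, Finset.mul_sum]
  exact Finset.sum_congr rfl fun i _ => Finset.sum_congr rfl fun j _ => by ring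

theorem evalC₂_wedge₁ (α β : Cov n) (Z W : Fin n → ℂ) :
    evalC₂ (wedge₁ α β) Z W = evalC α Z * evalC β W - evalC α W * evalC β Z := by
  have h : ∑ i, ∑ j, W i * α (stdVec i) * (Z j * β (stdVec j)) =
      ∑ j, ∑ i, W i * α (stdVec i) * (Z j * β (stdVec j)) := Finset.sum_comm
  simp only [evalC₂, evalC, Finset.sum_mul_sum]
  rw [h, ← Finset.sum_sub_distrib]
  refine Finset.sum_congr rfl fun i _ => ?_
  rw [← Finset.sum_sub_distrib]
  refine Finset.sum_congr rfl fun j _ => ?_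
  simp
  ring

/-- Contraction of a form with a complex vector. -/
def contr {k : ℕ} (Z : Fin n → ℂ) (T : Alt n (k + 1)) : Alt n k :=
  ∑ j, Z j • T.curryLeft (stdVec j)

theorem contr_apply {k : ℕ} (Z : Fin n → ℂ) (T : Alt n (k + 1)) (v : Fin k → Fin n → ℝ) :
    contr Z T v = ∑ j, Z j * T (Matrix.vecCons (stdVec j) v) := by
  simp [contr]

theorem contr_zero {k : ℕ} (Z : Fin n → ℂ) : contr Z (0 : Alt n (k + 1)) = 0 := by
  ext v; simp [contr_apply]

theorem contr_add {k : ℕ} (Z : Fin n → ℂ) (T T' : Alt n (k + 1)) :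
    contr Z (T + T') = contr Z T + contr Z T' := by
  ext v; simp [contr_apply, mul_add, Finset.sum_add_distrib]

theorem evalC₂_zero (Z W : Fin n → ℂ) : evalC₂ (0 : Alt n 2) Z W = 0 := by
  simp [evalC₂]

theorem evalC₂_sub (β γ : Alt n 2) (Z W : Fin n → ℂ) :
    evalC₂ (β - γ) Z W = evalC₂ β Z W - evalC₂ γ Z W := by
  simp [evalC₂, mul_sub, Finset.sum_sub_distrib]

/-- Contraction is an antiderivation. With a vector of the dual frame it strips a factor from a
wedge product, which turns identities between products into identities between coefficients. -/
theorem contr_wedge {k : ℕ} (Z : Fin n → ℂ) (α : Cov n) (T : Alt n (k + 1)) :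
    contr Z (wedge α T) = evalC α Z • T - wedge α (contr Z T) := by
  ext v
  have key : ∀ j, wedge α T (Matrix.vecCons (stdVec j) v) =
      α (stdVec j) * T v - ∑ i : Fin (k + 1), (-1 : ℂ) ^ (i : ℕ) *
        (α (v i) * T (Matrix.vecCons (stdVec j) (i.removeNth v))) := by
    intro j
    rw [wedge_apply, Fin.sum_univ_succ, sub_eq_add_neg, ← Finset.sum_neg_distrib]
    congr 1
    · simp [Fin.removeNth_zero]
    · refine Finset.sum_congr rfl fun i _ => ?_
      have : (i.succ).removeNth (Matrix.vecCons (stdVec j) v) =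
          Matrix.vecCons (stdVec j) (i.removeNth v) := by
        ext a b
        refine Fin.cases ?_ (fun a => ?_) a
        · simp [Fin.removeNth]
        · simp [Fin.removeNth]
      rw [this]
      simp [pow_succ]
  simp only [contr_apply, key, ContinuousAlternatingMap.sub_apply,
    ContinuousAlternatingMap.smul_apply, wedge_apply, evalC, mul_sub, Finset.sum_sub_distrib,
    Finset.mul_sum, smul_eq_mul, Finset.sum_mul]
  congr 1
  · exact Finset.sum_congr rfl fun i _ => by ring
  · rw [Finset.sum_comm]
    exact Finset.sum_congr rfl fun i _ => Finset.sum_congr rfl fun j _ => by ring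

theorem contr_wedge₁ (Z : Fin n → ℂ) (α β : Cov n) :
    contr Z (wedge₁ α β) = toAlt (evalC α Z • β - evalC β Z • α) := by
  ext v
  simp only [contr_apply, evalC, toAlt_apply, _root_.sub_apply, _root_.smul_apply,
    smul_eq_mul, Finset.sum_mul, ← Finset.sum_sub_distrib]
  refine Finset.sum_congr rfl fun i _ => ?_
  simp
  ring

end Eval

/-! ### The dual frame -/

section DualFrame

variable {F : CoframeData} {p : Fin 8 → ℝ}

theorem evalC_coframe (h : (F.coframeMatrix p).det ≠ 0) (j k : Fin 8) :
    evalC (F.coframe j p) (F.dualVec p k) = if j = k then 1 else 0 := by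
  have h1 := congrFun (congrFun (Matrix.mul_nonsing_inv (F.coframeMatrix p) h.isUnit) j) k
  rw [Matrix.mul_apply, Matrix.one_apply] at h1
  rw [← h1]
  exact Finset.sum_congr rfl fun i _ => by simp [CoframeData.dualVec, CoframeData.coframeMatrix,
    mul_comm]

/-- A right inverse of a square matrix is also a left inverse, so the dual vectors resolve the
identity on covectors as well. -/
theorem cov_eq_sum_coframe (h : (F.coframeMatrix p).det ≠ 0) (α : Cov 8) :
    α = ∑ j, evalC α (F.dualVec p j) • F.coframe j p := by
  have key : ∀ k, α (stdVec k) = ∑ j, evalC α (F.dualVec p j) * F.coframe j p (stdVec k) := by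
    intro k
    have h1 : ∀ l, ∑ j, (F.coframeMatrix p)⁻¹ l j * F.coframe j p (stdVec k) =
        if l = k then 1 else 0 := by
      intro l
      have h2 := congrFun (congrFun (Matrix.nonsing_inv_mul (F.coframeMatrix p) h.isUnit) l) k
      rw [Matrix.mul_apply, Matrix.one_apply] at h2
      rw [← h2]
      rfl
    simp only [evalC, Finset.sum_mul]
    rw [Finset.sum_comm]
    have h3 : ∀ l, ∑ j, F.dualVec p j l * α (stdVec l) * F.coframe j p (stdVec k) =
        α (stdVec l) * if l = k then 1 else 0 := by
      intro l
      rw [← h1 l, Finset.mul_sum]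
      exact Finset.sum_congr rfl fun j _ => by simp [CoframeData.dualVec]; ring
    simp [h3]
  ext u
  rw [cov_apply_eq_sum α u, cov_apply_eq_sum (∑ j, evalC α (F.dualVec p j) • F.coframe j p) u]
  refine Finset.sum_congr rfl fun k _ => ?_
  rw [key k]
  simp

variable (h : (F.coframeMatrix p).det ≠ 0)
include h

theorem evalC_th1 (k : Fin 8) : evalC (F.th1 p) (F.dualVec p k) = if 0 = k then 1 else 0 :=
  evalC_coframe h 0 k
theorem evalC_th2 (k : Fin 8) : evalC (F.th2 p) (F.dualVec p k) = if 1 = k then 1 else 0 :=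
  evalC_coframe h 1 k
theorem evalC_th3 (k : Fin 8) : evalC (F.th3 p) (F.dualVec p k) = if 2 = k then 1 else 0 :=
  evalC_coframe h 2 k
theorem evalC_Om2 (k : Fin 8) : evalC (F.Om2 p) (F.dualVec p k) = if 3 = k then 1 else 0 :=
  evalC_coframe h 3 k
theorem evalC_Om2b (k : Fin 8) : evalC (F.Om2b p) (F.dualVec p k) = if 4 = k then 1 else 0 :=
  evalC_coframe h 4 k
theorem evalC_Om3b (k : Fin 8) : evalC (F.Om3b p) (F.dualVec p k) = if 6 = k then 1 else 0 :=
  evalC_coframe h 6 k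

theorem wedge_th2_th3_ne_zero : wedge₁ (F.th2 p) (F.th3 p) ≠ 0 := by
  intro h0
  have h1 := evalC₂_wedge₁ (F.th2 p) (F.th3 p) (F.dualVec p 1) (F.dualVec p 2)
  rw [h0, evalC_th2 h, evalC_th2 h, evalC_th3 h, evalC_th3 h] at h1
  simp [evalC₂] at h1

/-- A form of Cartan's lemma. -/
theorem eq_of_wedge_th2_th3_eq_zero (X : Cov 8)
    (hX : wedge X (wedge₁ (F.th2 p) (F.th3 p)) = 0) :
    X = evalC X (F.dualVec p 1) • F.th2 p + evalC X (F.dualVec p 2) • F.th3 p := by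
  have h0 : ∀ j : Fin 8, j ≠ 1 → j ≠ 2 → evalC X (F.dualVec p j) = 0 := by
    intro j h1 h2
    -- The vector dual to neither `θ²` nor `θ³` annihilates `θ²∧θ³`, so the contraction leaves the
    -- coefficient times `θ²∧θ³`.
    have h3 := contr_wedge (F.dualVec p j) X (wedge₁ (F.th2 p) (F.th3 p))
    have h4 : contr (F.dualVec p j) (wedge₁ (F.th2 p) (F.th3 p)) = 0 := by
      rw [contr_wedge₁, evalC_th2 h, evalC_th3 h, if_neg h1.symm, if_neg h2.symm]
      ext v; simp
    rw [hX, contr_zero, h4] at h3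
    have h5 : wedge X (0 : Alt 8 1) = 0 := by ext v; simp [wedge_apply]
    rw [h5, sub_zero] at h3
    exact (smul_eq_zero.1 h3.symm).resolve_right (wedge_th2_th3_ne_zero h)
  conv_lhs => rw [cov_eq_sum_coframe h X]
  rw [Fin.sum_univ_eight, h0 0 (by decide) (by decide), h0 3 (by decide) (by decide),
    h0 4 (by decide) (by decide), h0 5 (by decide) (by decide), h0 6 (by decide) (by decide),
    h0 7 (by decide) (by decide)]
  ext u
  simp [CoframeData.coframe]

end DualFrame

/-! ### Consequences of the structure equations -/

namespace IsCartanCoframe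

variable {N : Set (Fin 3 → ℝ)} {cr : CRStructure N} {P : Set (Fin 8 → ℝ)}
  {π : (Fin 8 → ℝ) → (Fin 3 → ℝ)} {F : CoframeData}

section Smooth

variable (hF : IsCartanCoframe cr P π F)
include hF

theorem th2_smooth : ContDiffOn ℝ ∞ F.th2 P := contDiffOn_conj hF.th1_smooth
theorem cth3_smooth : ContDiffOn ℝ ∞ F.th3 P := contDiffOn_ofRealForm hF.th3_smooth
theorem cOm4_smooth : ContDiffOn ℝ ∞ F.Om4 P := contDiffOn_ofRealForm hF.Om4_smooth
theorem Om2b_smooth : ContDiffOn ℝ ∞ F.Om2b P := contDiffOn_conj hF.Om2_smooth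
theorem Om3b_smooth : ContDiffOn ℝ ∞ F.Om3b P := contDiffOn_conj hF.Om3_smooth

variable {p : Fin 8 → ℝ} (hp : p ∈ P)
include hp

theorem differentiableAt_of {E : Type*} [NormedAddCommGroup E] [NormedSpace ℝ E]
    {f : (Fin 8 → ℝ) → E} (hf : ContDiffOn ℝ ∞ f P) : DifferentiableAt ℝ f p :=
  (hf.contDiffAt (hF.isOpen.mem_nhds hp)).differentiableAt (by simp)

theorem extD_th2_apply (v : Fin 2 → Fin 8 → ℝ) : extD F.th2 p v =
    (wedge₁ (F.Om2b p) (F.th2 p) + wedge₁ (F.Om3b p) (F.th3 p)) v := by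
  rw [CoframeData.th2, extD_conj_apply (hF.differentiableAt_of hp hF.th1_smooth), hF.d_th1 p hp]
  simp [CoframeData.Om2b, CoframeData.Om3b, CoframeData.th3]

theorem extD_Om2b_apply (v : Fin 2 → Fin 8 → ℝ) : extD F.Om2b p v =
    ((-2 * Complex.I) • wedge₁ (F.th2 p) (F.Om3 p) + (-Complex.I) • wedge₁ (F.th1 p) (F.Om3b p)
      + wedge₁ (F.Om4 p) (F.th3 p)) v := by
  rw [CoframeData.Om2b, extD_conj_apply (hF.differentiableAt_of hp hF.Om2_smooth),
    hF.d_Om2 p hp]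
  simp [CoframeData.th2, CoframeData.Om3b, CoframeData.th3, CoframeData.Om4, Complex.conj_ofNat]

theorem extD_Om3b_apply (v : Fin 2 → Fin 8 → ℝ) : extD F.Om3b p v =
    (wedge₁ (F.Om4 p) (F.th2 p) + wedge₁ (F.Om3b p) (F.Om2 p)
      + (starRingEnd ℂ (F.R p)) • wedge₁ (F.th1 p) (F.th3 p)) v := by
  rw [CoframeData.Om3b, extD_conj_apply (hF.differentiableAt_of hp hF.Om3_smooth),
    hF.d_Om3 p hp]
  simp [CoframeData.th2, CoframeData.Om2b, CoframeData.th3, CoframeData.Om4]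

end Smooth

variable (hF : IsCartanCoframe cr P π F) {p : Fin 8 → ℝ} (hp : p ∈ P)
include hF hp

/-- This is `d(dΩ₃) = 0`: after substitution of the structure equations, only terms with the factor
`θ²∧θ³` survive. -/
theorem wedge_fderiv_R :
    wedge (fderiv ℝ F.R p + (F.S p • F.th1 p + F.R p • (F.Om2 p + (3 : ℂ) • F.Om2b p)))
      (wedge₁ (F.th2 p) (F.th3 p)) = 0 := by
  have d1 := hF.differentiableAt_of hp hF.th1_smooth
  have d2 := hF.differentiableAt_of hp hF.th2_smooth
  have d3 := hF.differentiableAt_of hp hF.cth3_smooth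
  have dO2b := hF.differentiableAt_of hp hF.Om2b_smooth
  have dO3 := hF.differentiableAt_of hp hF.Om3_smooth
  have dO4 := hF.differentiableAt_of hp hF.cOm4_smooth
  have dR := hF.differentiableAt_of hp hF.R_smooth
  have h0 := extDeriv_extD hF.isOpen hF.Om3_smooth hp
  have h1 : (fun q => extD F.Om3 q) =ᶠ[nhds p] fun q =>
      wedge₁ (F.Om4 q) (F.th1 q) + wedge₁ (F.Om3 q) (F.Om2b q)
      + F.R q • wedge₁ (F.th2 q) (F.th3 q) :=
    Filter.eventuallyEq_of_mem (hF.isOpen.mem_nhds hp) hF.d_Om3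
  rw [h1.extDeriv_eq, extDeriv_fun_add ((differentiableAt_wedge₁ dO4 d1).fun_add
    (differentiableAt_wedge₁ dO3 dO2b)) (dR.fun_smul (differentiableAt_wedge₁ d2 d3)),
    extDeriv_fun_add (differentiableAt_wedge₁ dO4 d1) (differentiableAt_wedge₁ dO3 dO2b),
    extDeriv_smul_two dR (differentiableAt_wedge₁ d2 d3), extDeriv_wedge₁ dO4 d1,
    extDeriv_wedge₁ dO3 dO2b, extDeriv_wedge₁ d2 d3] at h0
  ext v
  have h2 := congrArg (fun T => T v) h0
  simp [hF.d_th1 p hp, hF.d_th3 p hp, hF.d_Om3 p hp, hF.d_Om4 p hp, hF.extD_th2_apply hp,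
    hF.extD_Om2b_apply hp] at h2 ⊢
  rw [← h2]
  ring

theorem exists_fderiv_R : ∃ R2 R3 : ℂ, fderiv ℝ F.R p = -F.S p • F.th1 p + R2 • F.th2 p
    + R3 • F.th3 p - F.R p • (F.Om2 p + (3 : ℂ) • F.Om2b p) := by
  have h := eq_of_wedge_th2_th3_eq_zero (hF.coframe_indep p hp) _ (hF.wedge_fderiv_R hp)
  set X := fderiv ℝ F.R p + (F.S p • F.th1 p + F.R p • (F.Om2 p + (3 : ℂ) • F.Om2b p)) with hX
  refine ⟨evalC X (F.dualVec p 1), evalC X (F.dualVec p 2), ?_⟩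
  nth_rewrite 1 [hX] at h
  rw [← eq_sub_iff_add_eq] at h
  rw [h]
  ext u
  simp
  ring

/-- This is `d(dΩ₄) = 0`. The terms with `𝓡` come from `i Ω₃∧Ω̄₃` through `dΩ₃` and `dΩ̄₃`. -/
theorem wedge_fderiv_S :
    wedge (fderiv ℝ F.S p + (F.S p • ((2 : ℂ) • F.Om2 p + (3 : ℂ) • F.Om2b p)
        + (Complex.I * F.R p) • F.Om3b p))
      (wedge₁ (F.th2 p) (F.th3 p)) +
    wedge (fderiv ℝ (fun q => starRingEnd ℂ (F.S q)) p + (starRingEnd ℂ (F.S p) •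
        ((2 : ℂ) • F.Om2b p + (3 : ℂ) • F.Om2 p)
        - (Complex.I * starRingEnd ℂ (F.R p)) • F.Om3 p))
      (wedge₁ (F.th1 p) (F.th3 p)) = 0 := by
  have d1 := hF.differentiableAt_of hp hF.th1_smooth
  have d2 := hF.differentiableAt_of hp hF.th2_smooth
  have d3 := hF.differentiableAt_of hp hF.cth3_smooth
  have dO2 := hF.differentiableAt_of hp hF.Om2_smooth
  have dO2b := hF.differentiableAt_of hp hF.Om2b_smooth
  have dO3 := hF.differentiableAt_of hp hF.Om3_smooth
  have dO3b := hF.differentiableAt_of hp hF.Om3b_smooth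
  have dO4 := hF.differentiableAt_of hp hF.cOm4_smooth
  have dS := hF.differentiableAt_of hp hF.S_smooth
  have dSb : DifferentiableAt ℝ (fun q => starRingEnd ℂ (F.S q)) p :=
    (Complex.conjCLE : ℂ →L[ℝ] ℂ).differentiableAt.comp p dS
  have h0 := extDeriv_extD hF.isOpen hF.cOm4_smooth hp
  have h1 : (fun q => extD F.Om4 q) =ᶠ[nhds p] fun q =>
      Complex.I • wedge₁ (F.Om3 q) (F.Om3b q) + wedge₁ (F.Om4 q) (F.Om2 q + F.Om2b q)
      + (starRingEnd ℂ (F.S q)) • wedge₁ (F.th1 q) (F.th3 q)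
      + F.S q • wedge₁ (F.th2 q) (F.th3 q) :=
    Filter.eventuallyEq_of_mem (hF.isOpen.mem_nhds hp) hF.d_Om4
  have e1 := (differentiableAt_wedge₁ dO3 dO3b)
  have dc : DifferentiableAt ℝ (fun _ : Fin 8 → ℝ => Complex.I) p := differentiableAt_const _
  have e2 := differentiableAt_wedge₁ dO4 (dO2.fun_add dO2b)
  have e3 := dSb.fun_smul (differentiableAt_wedge₁ d1 d3)
  have e4 := dS.fun_smul (differentiableAt_wedge₁ d2 d3)
  rw [h1.extDeriv_eq, extDeriv_fun_add (((dc.fun_smul e1).fun_add e2).fun_add e3) e4,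
    extDeriv_fun_add ((dc.fun_smul e1).fun_add e2) e3, extDeriv_fun_add (dc.fun_smul e1) e2,
    extDeriv_smul_two dc e1, extDeriv_smul_two dS (differentiableAt_wedge₁ d2 d3),
    extDeriv_smul_two dSb (differentiableAt_wedge₁ d1 d3), extDeriv_wedge₁ dO3 dO3b,
    extDeriv_wedge₁ dO4 (dO2.fun_add dO2b), extDeriv_wedge₁ d2 d3, extDeriv_wedge₁ d1 d3,
    extD_add dO2 dO2b] at h0
  ext v
  have h2 := congrArg (fun T => T v) h0
  simp [hF.d_th1 p hp, hF.d_th3 p hp, hF.d_Om2 p hp, hF.d_Om3 p hp, hF.d_Om4 p hp,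
    hF.extD_th2_apply hp, hF.extD_Om2b_apply hp, hF.extD_Om3b_apply hp] at h2 ⊢
  rw [← h2]
  ring

/-- A second Cartan lemma. The two products have the common factor `θ³` and the different factors
`θ²` and `θ¹`, so the identity only excludes components of `d𝓢` beyond `θ¹, θ², θ³`. The `θ¹`
component is left free, and it is `𝓢₁`. -/
theorem exists_fderiv_S : ∃ S2 S3 : ℂ, fderiv ℝ F.S p = F.S1 p • F.th1 p + S2 • F.th2 p
    + S3 • F.th3 p - F.S p • ((2 : ℂ) • F.Om2 p + (3 : ℂ) • F.Om2b p)
    - (Complex.I * F.R p) • F.Om3b p := by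
  have hd := hF.coframe_indep p hp
  set X := fderiv ℝ F.S p + (F.S p • ((2 : ℂ) • F.Om2 p + (3 : ℂ) • F.Om2b p)
        + (Complex.I * F.R p) • F.Om3b p) with hX
  have h0 : ∀ j : Fin 8, j ≠ 0 → j ≠ 1 → j ≠ 2 → evalC X (F.dualVec p j) = 0 := by
    intro j j0 j1 j2
    have h1 := congrArg (contr (F.dualVec p j)) (hF.wedge_fderiv_S hp)
    rw [contr_zero, contr_add, ← hX, contr_wedge, contr_wedge, contr_wedge₁, contr_wedge₁,
      evalC_th1 hd, evalC_th2 hd, evalC_th3 hd, if_neg j0.symm, if_neg j1.symm,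
      if_neg j2.symm] at h1
    -- The vectors dual to `θ²` and `θ³` see `θ²∧θ³` but not `θ¹∧θ³`, which separates `d𝓢` from its
    -- conjugate.
    have h2 := congrArg (fun T => evalC₂ T (F.dualVec p 1) (F.dualVec p 2)) h1
    have h6 : ∀ α β : Cov 8, wedge α (toAlt β) = wedge₁ α β := fun _ _ => rfl
    simpa [h6, evalC₂_sub, evalC_sub, evalC_smul, evalC₂_add, evalC₂_smul, evalC₂_wedge₁,
      evalC_th1 hd, evalC_th2 hd,
      evalC_th3 hd, evalC₂_zero] using h2
  have h1 : X = evalC X (F.dualVec p 0) • F.th1 p + evalC X (F.dualVec p 1) • F.th2 p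
      + evalC X (F.dualVec p 2) • F.th3 p := by
    conv_lhs => rw [cov_eq_sum_coframe hd X]
    rw [Fin.sum_univ_eight, h0 3 (by decide) (by decide) (by decide),
      h0 4 (by decide) (by decide) (by decide), h0 5 (by decide) (by decide) (by decide),
      h0 6 (by decide) (by decide) (by decide), h0 7 (by decide) (by decide) (by decide)]
    ext u
    simp [CoframeData.coframe]
  have h2 : evalC X (F.dualVec p 0) = F.S1 p := by
    simp [hX, evalC_add, evalC_smul, evalC_Om2 hd, evalC_Om2b hd, evalC_Om3b hd, CoframeData.S1]
  rw [h2] at h1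
  nth_rewrite 1 [hX] at h1
  rw [← eq_sub_iff_add_eq] at h1
  exact ⟨_, _, h1.trans (by abel)⟩

theorem exists_fderiv_Rb : ∃ R1 R3 : ℂ, fderiv ℝ (fun q => starRingEnd ℂ (F.R q)) p =
    -starRingEnd ℂ (F.S p) • F.th2 p + R1 • F.th1 p + R3 • F.th3 p
    - starRingEnd ℂ (F.R p) • (F.Om2b p + (3 : ℂ) • F.Om2 p) := by
  obtain ⟨R2, R3, h⟩ := hF.exists_fderiv_R hp
  refine ⟨starRingEnd ℂ R2, starRingEnd ℂ R3, ?_⟩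
  ext u
  rw [fderiv_conj_fun (hF.differentiableAt_of hp hF.R_smooth), h]
  simp [CoframeData.th2, CoframeData.Om2b, CoframeData.th3, Complex.conj_ofNat]

/-- Beyond conjugation of `exists_fderiv_S`, the content is that `𝓢₁` is real. The `θ¹∧θ²∧θ³`
coefficient of `d(dΩ₄) = 0` is `𝓢₁` minus its conjugate. -/
theorem exists_fderiv_Sb : ∃ T1 T3 : ℂ, fderiv ℝ (fun q => starRingEnd ℂ (F.S q)) p =
    F.S1 p • F.th2 p + T1 • F.th1 p + T3 • F.th3 p
    - starRingEnd ℂ (F.S p) • ((2 : ℂ) • F.Om2b p + (3 : ℂ) • F.Om2 p)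
    + (Complex.I * starRingEnd ℂ (F.R p)) • F.Om3 p := by
  have hd := hF.coframe_indep p hp
  obtain ⟨S2, S3, h⟩ := hF.exists_fderiv_S hp
  have h1 : fderiv ℝ (fun q => starRingEnd ℂ (F.S q)) p =
      starRingEnd ℂ (F.S1 p) • F.th2 p + starRingEnd ℂ S2 • F.th1 p + starRingEnd ℂ S3 • F.th3 p
      - starRingEnd ℂ (F.S p) • ((2 : ℂ) • F.Om2b p + (3 : ℂ) • F.Om2 p)
      + (Complex.I * starRingEnd ℂ (F.R p)) • F.Om3 p := by
    ext u
    rw [fderiv_conj_fun (hF.differentiableAt_of hp hF.S_smooth), h]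
    simp [CoframeData.th2, CoframeData.Om2b, CoframeData.Om3b, CoframeData.th3,
      Complex.conj_ofNat]
  refine ⟨starRingEnd ℂ S2, starRingEnd ℂ S3, ?_⟩
  suffices hs : starRingEnd ℂ (F.S1 p) = F.S1 p by rw [hs] at h1; exact h1
  -- Contraction with the vector dual to `θ¹`, followed by evaluation on those dual to `θ²` and
  -- `θ³`, reads off the `θ¹∧θ²∧θ³` coefficient.
  have h2 := congrArg (contr (F.dualVec p 0)) (hF.wedge_fderiv_S hp)
  rw [contr_zero, contr_add, contr_wedge, contr_wedge, contr_wedge₁, contr_wedge₁,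
    evalC_th1 hd, evalC_th2 hd, evalC_th3 hd, h, h1] at h2
  have h3 := congrArg (fun T => evalC₂ T (F.dualVec p 1) (F.dualVec p 2)) h2
  have h6 : ∀ α β : Cov 8, wedge α (toAlt β) = wedge₁ α β := fun _ _ => rfl
  simp [h6, evalC₂_add, evalC₂_sub, evalC₂_smul, evalC₂_wedge₁, evalC_th1 hd,
    evalC_th2 hd, evalC_th3 hd, evalC₂_zero, evalC_add, evalC_sub, evalC_smul] at h3
  exact (sub_eq_zero.1 h3).symm

end IsCartanCoframe

/-! ### The curvature of the conformal connection -/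

/-- The coefficient matrix of `R̄ θ¹ ∧ θ³` in the curvature of `ω̃`. -/
def matN₁ : Matrix (Fin 6) (Fin 6) ℂ :=
  !![0, Complex.I / 2, 0, 0, 0, 0;
     0, 0, 0, 0, 0, 0;
     0, 0, 0, -1, 0, Complex.I / 2;
     0, 0, 0, 0, 0, 0;
     0, 1, 0, 0, 0, 0;
     0, 0, 0, 0, 0, 0]

/-- The coefficient matrix of `R θ² ∧ θ³` in the curvature of `ω̃`. -/
def matN₂ : Matrix (Fin 6) (Fin 6) ℂ :=
  !![0, 0, -(Complex.I / 2), 0, 0, 0;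
     0, 0, 0, -1, 0, -(Complex.I / 2);
     0, 0, 0, 0, 0, 0;
     0, 0, 0, 0, 0, 0;
     0, 0, 1, 0, 0, 0;
     0, 0, 0, 0, 0, 0]

namespace CoframeData

/-- The `θ¹ ∧ θ³` component of the curvature of `ω̃`. -/
def curv₁ (F : CoframeData) (p : Fin 8 → ℝ) : Matrix (Fin 6) (Fin 6) ℂ :=
  starRingEnd ℂ (F.R p) • matN₁ - starRingEnd ℂ (F.S p) • matM

/-- The `θ² ∧ θ³` component of the curvature of `ω̃`. -/
def curv₂ (F : CoframeData) (p : Fin 8 → ℝ) : Matrix (Fin 6) (Fin 6) ℂ :=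
  F.R p • matN₂ - F.S p • matM

end CoframeData

/-- The values of the entries of `ω̃`. -/
theorem CoframeData.confConn_apply (F : CoframeData) (p u : Fin 8 → ℝ) (A B : Fin 6) :
    F.confConn A B p u =
    !![1 / 2 * (F.Om2 p u + F.Om2b p u), Complex.I / 2 * F.Om3b p u, -(Complex.I / 2 * F.Om3 p u),
        -F.Om4 p u, Complex.I / 12 * (F.Om2 p u - F.Om2b p u), 0;
      F.th1 p u, -(1 / 3 * (F.Om2 p u - F.Om2b p u)), 0, -F.Om3 p u, Complex.I / 2 * F.th1 p u,
        -(Complex.I / 2 * F.Om3 p u);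
      F.th2 p u, 0, 1 / 3 * (F.Om2 p u - F.Om2b p u), -F.Om3b p u, -(Complex.I / 2 * F.th2 p u),
        Complex.I / 2 * F.Om3b p u;
      F.th3 p u, Complex.I / 2 * F.th2 p u, -(Complex.I / 2 * F.th1 p u),
        -(1 / 2 * (F.Om2 p u + F.Om2b p u)), 0, Complex.I / 12 * (F.Om2 p u - F.Om2b p u);
      1 / (3 * Complex.I) * (F.Om2 p u - F.Om2b p u), F.Om3b p u, F.Om3 p u, 0,
        1 / 2 * (F.Om2 p u + F.Om2b p u), -F.Om4 p u;
      0, F.th2 p u, F.th1 p u, 1 / (3 * Complex.I) * (F.Om2 p u - F.Om2b p u), F.th3 p u,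
        -(1 / 2 * (F.Om2 p u + F.Om2b p u))] A B := by
  fin_cases A <;> fin_cases B <;> rfl

theorem inv_three_I : 1 / (3 * Complex.I) = -(1 / 3) * Complex.I := by
  field_simp
  simp

namespace IsCartanCoframe

variable {N : Set (Fin 3 → ℝ)} {cr : CRStructure N} {P : Set (Fin 8 → ℝ)}
  {π : (Fin 8 → ℝ) → (Fin 3 → ℝ)} {F : CoframeData}
  (hF : IsCartanCoframe cr P π F) {p : Fin 8 → ℝ} (hp : p ∈ P)
include hF hp

/-- The exterior derivatives of the entries of `ω̃`. -/
theorem extD_confConn_apply (A B : Fin 6) (v : Fin 2 → Fin 8 → ℝ) :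
    extD (F.confConn A B) p v =
    !![1 / 2 * (extD F.Om2 p v + extD F.Om2b p v), Complex.I / 2 * extD F.Om3b p v,
        -(Complex.I / 2 * extD F.Om3 p v), -extD F.Om4 p v,
        Complex.I / 12 * (extD F.Om2 p v - extD F.Om2b p v), 0;
      extD F.th1 p v, -(1 / 3 * (extD F.Om2 p v - extD F.Om2b p v)), 0, -extD F.Om3 p v,
        Complex.I / 2 * extD F.th1 p v, -(Complex.I / 2 * extD F.Om3 p v);
      extD F.th2 p v, 0, 1 / 3 * (extD F.Om2 p v - extD F.Om2b p v), -extD F.Om3b p v,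
        -(Complex.I / 2 * extD F.th2 p v), Complex.I / 2 * extD F.Om3b p v;
      extD F.th3 p v, Complex.I / 2 * extD F.th2 p v, -(Complex.I / 2 * extD F.th1 p v),
        -(1 / 2 * (extD F.Om2 p v + extD F.Om2b p v)), 0,
        Complex.I / 12 * (extD F.Om2 p v - extD F.Om2b p v);
      1 / (3 * Complex.I) * (extD F.Om2 p v - extD F.Om2b p v), extD F.Om3b p v, extD F.Om3 p v,
        0, 1 / 2 * (extD F.Om2 p v + extD F.Om2b p v), -extD F.Om4 p v;
      0, extD F.th2 p v, extD F.th1 p v, 1 / (3 * Complex.I) * (extD F.Om2 p v - extD F.Om2b p v),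
        extD F.th3 p v, -(1 / 2 * (extD F.Om2 p v + extD F.Om2b p v))] A B := by
  have d1 := hF.differentiableAt_of hp hF.th1_smooth
  have d2 := hF.differentiableAt_of hp hF.th2_smooth
  have dO2 := hF.differentiableAt_of hp hF.Om2_smooth
  have dO2b := hF.differentiableAt_of hp hF.Om2b_smooth
  have dO3 := hF.differentiableAt_of hp hF.Om3_smooth
  have dO3b := hF.differentiableAt_of hp hF.Om3b_smooth
  have dO4 := hF.differentiableAt_of hp hF.cOm4_smooth
  have m : ∀ {α : OneForm 8} (c : ℂ), DifferentiableAt ℝ α p →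
      extD (fun q => c • α q) p v = c * extD α p v := fun c h => by
    rw [extD_const_smul c h]
    rfl
  have n : ∀ {α : OneForm 8}, DifferentiableAt ℝ α p → extD (fun q => -α q) p v = -extD α p v :=
    fun h => by
      rw [extD_neg h]
      rfl
  have nm : ∀ {α : OneForm 8} (c : ℂ), DifferentiableAt ℝ α p →
      extD (fun q => -(c • α q)) p v = -(c * extD α p v) := fun c h => by
    rw [n (h.fun_const_smul c), m c h]
  have a : ∀ c : ℂ, extD (fun q => c • (F.Om2 q + F.Om2b q)) p v =
      c * (extD F.Om2 p v + extD F.Om2b p v) := fun c => by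
    rw [m c (dO2.fun_add dO2b), extD_add dO2 dO2b]
    rfl
  have b : ∀ c : ℂ, extD (fun q => c • (F.Om2 q - F.Om2b q)) p v =
      c * (extD F.Om2 p v - extD F.Om2b p v) := fun c => by
    rw [m c (dO2.fun_sub dO2b), extD_sub dO2 dO2b]
    rfl
  have na : ∀ c : ℂ, extD (fun q => -(c • (F.Om2 q + F.Om2b q))) p v =
      -(c * (extD F.Om2 p v + extD F.Om2b p v)) := fun c => by
    rw [n ((dO2.fun_add dO2b).fun_const_smul c), a]
  have nb : ∀ c : ℂ, extD (fun q => -(c • (F.Om2 q - F.Om2b q))) p v =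
      -(c * (extD F.Om2 p v - extD F.Om2b p v)) := fun c => by
    rw [n ((dO2.fun_sub dO2b).fun_const_smul c), b]
  have z : extD (0 : OneForm 8) p v = 0 := by
    rw [extD_zero]
    rfl
  fin_cases A <;> fin_cases B
  exacts [a _, m _ dO3b, nm _ dO3, n dO4, b _, z, rfl, nb _, z, n dO3, m _ d1, nm _ dO3,
    rfl, z, b _, n dO3b, nm _ d2, m _ dO3b, rfl, m _ d2, nm _ d1, na _, z, b _,
    b _, rfl, rfl, z, a _, n dO4, z, rfl, rfl, b _, rfl, na _]

-- The quadratic terms of `ω̃∧ω̃` cancel those of the structure equations. Only the torsion-like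
-- terms of `dΩ₃`, `dΩ̄₃` and `dΩ₄` remain: `matN₂` and `matN₁` record where `Ω₃` and `Ω̄₃` stand in
-- `ω̃`, and `-matM` where `Ω₄` stands.
set_option maxHeartbeats 2000000 in
theorem confCurv_eq (A B : Fin 6) : F.confCurv A B p =
    F.curv₁ p A B • wedge₁ (F.th1 p) (F.th3 p) + F.curv₂ p A B • wedge₁ (F.th2 p) (F.th3 p) := by
  rw [CoframeData.confCurv, curvature]
  ext v
  simp only [ContinuousAlternatingMap.add_apply,
    ContinuousAlternatingMap.smul_apply, smul_eq_mul, hF.extD_confConn_apply hp, wedge₁_apply,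
    F.confConn_apply, Fin.sum_univ_six, hF.d_th1 p hp, hF.d_th3 p hp, hF.d_Om2 p hp,
    hF.d_Om3 p hp, hF.d_Om4 p hp, hF.extD_th2_apply hp, hF.extD_Om2b_apply hp,
    hF.extD_Om3b_apply hp, CoframeData.curv₁, CoframeData.curv₂, matN₁, matN₂, matM,
    Matrix.sub_apply, Matrix.smul_apply, inv_three_I, _root_.add_apply]
  generalize F.Om2 p (v 0) = a, F.Om2b p (v 0) = b, F.Om3 p (v 0) = c, F.Om3b p (v 0) = d,
    F.Om4 p (v 0) = e, F.th1 p (v 0) = f, F.th2 p (v 0) = g, F.th3 p (v 0) = h,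
    F.Om2 p (v 1) = a', F.Om2b p (v 1) = b', F.Om3 p (v 1) = c', F.Om3b p (v 1) = d',
    F.Om4 p (v 1) = e', F.th1 p (v 1) = f', F.th2 p (v 1) = g', F.th3 p (v 1) = h',
    starRingEnd ℂ (F.R p) = r, starRingEnd ℂ (F.S p) = s
  fin_cases A <;> fin_cases B <;> simp <;>
    ring_nf <;> (try simp only [Complex.I_sq]) <;> (try ring_nf)

end IsCartanCoframe

/-! ### Anticommutation of exterior factors -/

section Wedge

variable {n k : ℕ}

theorem alt_zero_smul (T : Alt n k) : (0 : ℂ) • T = 0 := by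
  ext v; simp

theorem alt_smul_eq_zero {c : ℂ} {T : Alt n k} (h : c • T = 0) : c = 0 ∨ T = 0 := by
  by_cases hc : c = 0
  · exact Or.inl hc
  · refine Or.inr ?_
    ext v
    have h1 := congrArg (fun T => T v) h
    simpa [hc] using h1

theorem wedge_zero_right (α : Cov n) : wedge α (0 : Alt n k) = 0 := by
  ext v; simp [wedge_apply]

/-- The product is a double alternation of `(x, y) ↦ α(x) α(y) T`, which is symmetric in `x` and `y`
and is therefore killed. Polarization gives anticommutation of the factors. -/
theorem wedge_self_wedge (α : Cov n) (T : Alt n k) : wedge α (wedge α T) = 0 := by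
  let L : ℂ →L[ℝ] Alt n k := (ContinuousLinearMap.id ℝ ℂ).smulRight T
  let f : (Fin n → ℝ) →L[ℝ] (Fin n → ℝ) →L[ℝ] Alt n k :=
    (ContinuousLinearMap.compL ℝ (Fin n → ℝ) ℂ (Alt n k) L).comp
      ((ContinuousLinearMap.mul ℝ ℂ).bilinearComp α α)
  have hf : ∀ x y, f x y = (α x * α y) • T := fun x y => rfl
  have h := ContinuousAlternatingMap.alternatizeUncurryFin_alternatizeUncurryFinCLM_comp_of_symmetric
    (f := f) (fun x y => by rw [hf, hf, mul_comm])
  rw [← h, wedge]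
  congr 1
  ext x v
  have h1 : f x = (α x) • α.smulRight T := by
    ext1 y
    rw [hf, mul_smul]
    rfl
  simp only [ContinuousLinearMap.smulRight_apply, ContinuousLinearMap.comp_apply, h1,
    ContinuousAlternatingMap.alternatizeUncurryFinCLM_apply,
    ContinuousAlternatingMap.alternatizeUncurryFin_smul]
  rfl

theorem wedge_left_comm (α β : Cov n) (T : Alt n k) :
    wedge α (wedge β T) = -wedge β (wedge α T) := by
  have h := wedge_self_wedge (α + β) T
  rw [wedge_add_left α β T, wedge_add_left, wedge_add_right, wedge_add_right, wedge_self_wedge,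
    wedge_self_wedge, zero_add, add_zero] at h
  exact eq_neg_of_add_eq_zero_left h

end Wedge

/-! ### The Hodge star on null bivectors -/

theorem hodge_apply (b : Matrix (Fin 4) (Fin 4) ℂ) (μ ν : Fin 4) : hodge b μ ν =
    (1 / 2 : ℂ) * ∑ ρ, ∑ σ, volNull μ ν ρ σ * b (Equiv.swap 0 1 (Equiv.swap 2 3 ρ))
      (Equiv.swap 0 1 (Equiv.swap 2 3 σ)) := by
  -- The metric of the null tetrad is the permutation matrix exchanging `θ¹` with `θ²` and `θ³` with
  -- `θ⁴`, so raising an index is a relabelling.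
  have hg : ∀ ρ α : Fin 4, gNull ρ α =
      if α = Equiv.swap 0 1 (Equiv.swap 2 3 ρ) then 1 else 0 := by
    intro ρ α
    fin_cases ρ <;> fin_cases α <;> simp [gNull, Equiv.swap_apply_def]
  simp only [hodge, Matrix.of_apply]
  congr 1
  refine Finset.sum_congr rfl fun ρ _ => Finset.sum_congr rfl fun σ _ => ?_
  simp [hg]

theorem det_rows (x y z w : Fin 4 → ℂ) : Matrix.det (Matrix.of ![x, y, z, w]) =
    (x 0 * y 1 - x 1 * y 0) * (z 2 * w 3 - z 3 * w 2)
    - (x 0 * y 2 - x 2 * y 0) * (z 1 * w 3 - z 3 * w 1)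
    + (x 0 * y 3 - x 3 * y 0) * (z 1 * w 2 - z 2 * w 1)
    + (x 1 * y 2 - x 2 * y 1) * (z 0 * w 3 - z 3 * w 0)
    - (x 1 * y 3 - x 3 * y 1) * (z 0 * w 2 - z 2 * w 0)
    + (x 2 * y 3 - x 3 * y 2) * (z 0 * w 1 - z 1 * w 0) := by
  rw [Matrix.det_succ_row_zero]
  simp [Fin.sum_univ_four, Matrix.det_fin_three, Fin.succAbove]
  ring

theorem volNull_eq (μ ν ρ σ : Fin 4) : volNull μ ν ρ σ = -Complex.I *
    Matrix.det (Matrix.of ![fun j => if μ = j then (1 : ℂ) else 0, fun j => if ν = j then 1 else 0,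
      fun j => if ρ = j then 1 else 0, fun j => if σ = j then 1 else 0]) := by
  rw [volNull]
  congr 2
  ext i j
  fin_cases i <;> rfl

/-- The matrix stands for `a θ¹∧θ³ + b θ²∧θ³`; the two bivectors are eigenvectors of the star for
`i` and `-i`. -/
theorem hodge_null (a b : ℂ) :
    hodge !![0, 0, a, 0; 0, 0, b, 0; -a, -b, 0, 0; 0, 0, 0, 0] =
      !![0, 0, Complex.I * a, 0; 0, 0, -(Complex.I * b), 0;
         -(Complex.I * a), Complex.I * b, 0, 0; 0, 0, 0, 0] := by
  ext μ ν
  have h : hodge !![0, 0, a, 0; 0, 0, b, 0; -a, -b, 0, 0; 0, 0, 0, 0] μ ν =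
      (1 / 2 : ℂ) * ((volNull μ ν 1 3 - volNull μ ν 3 1) * a
        + (volNull μ ν 0 3 - volNull μ ν 3 0) * b) := by
    rw [hodge_apply]
    congr 1
    simp [Fin.sum_univ_four, Equiv.swap_apply_def]
    ring
  rw [h]
  simp only [volNull_eq, det_rows]
  fin_cases μ <;> fin_cases ν <;> simp <;> ring

/-! ### Normality, the self-dual splitting and the Baston–Mason commutator -/

namespace IsCartanCoframe

variable {N : Set (Fin 3 → ℝ)} {cr : CRStructure N} {P : Set (Fin 8 → ℝ)}
  {π : (Fin 8 → ℝ) → (Fin 3 → ℝ)} {F : CoframeData}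
  (hF : IsCartanCoframe cr P π F) {p : Fin 8 → ℝ} (hp : p ∈ P)
include hF hp

theorem comp_null (a b : ℂ) :
    F.comp p (a • wedge₁ (F.th1 p) (F.th3 p) + b • wedge₁ (F.th2 p) (F.th3 p)) =
      !![0, 0, a, 0; 0, 0, b, 0; -a, -b, 0, 0; 0, 0, 0, 0] := by
  have hd := hF.coframe_indep p hp
  ext μ ν
  fin_cases μ <;> fin_cases ν <;>
    simp [CoframeData.comp, CoframeData.tetradVec, evalC₂_add, evalC₂_smul, evalC₂_wedge₁,
      evalC_th1 hd, evalC_th2 hd, evalC_th3 hd, evalC_vec_smul, evalC_vec_sub]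

omit hF hp in
theorem ofComp_null (a b : ℂ) :
    F.ofComp p !![0, 0, a, 0; 0, 0, b, 0; -a, -b, 0, 0; 0, 0, 0, 0] =
      a • wedge₁ (F.th1 p) (F.th3 p) + b • wedge₁ (F.th2 p) (F.th3 p) := by
  ext v
  simp [CoframeData.ofComp, Fin.sum_univ_four, CoframeData.tetrad]
  ring

theorem starCurv_eq (A B : Fin 6) : F.starCurv A B p =
    (Complex.I * F.curv₁ p A B) • wedge₁ (F.th1 p) (F.th3 p)
      + (-(Complex.I * F.curv₂ p A B)) • wedge₁ (F.th2 p) (F.th3 p) := by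
  rw [CoframeData.starCurv, hF.confCurv_eq hp, hF.comp_null hp, hodge_null, ← ofComp_null]
  simp

set_option maxHeartbeats 1000000 in
omit hF hp in
/-- The matrix of forms `ω̃` is `𝔰𝔬(4,2)`-valued. -/
theorem so_valued (A B : Fin 6) :
    ∑ C, (formSO A C • F.confConn C B p + formSO B C • F.confConn C A p) = 0 := by
  ext u
  simp only [_root_.add_apply, _root_.smul_apply, smul_eq_mul,
    F.confConn_apply, Fin.sum_univ_six, formSO, _root_.zero_apply]
  generalize F.Om2 p u = a, F.Om2b p u = b, F.Om3 p u = c, F.Om3b p u = d, F.Om4 p u = e,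
    F.th1 p u = f, F.th2 p u = g, F.th3 p u = h, (1 / (3 * Complex.I)) = i, Complex.I / 2 = j,
    Complex.I / 12 = k
  fin_cases A <;> fin_cases B <;> simp

theorem comp_confCurv (A B : Fin 6) : F.comp p (F.confCurv A B p) =
    !![0, 0, F.curv₁ p A B, 0; 0, 0, F.curv₂ p A B, 0; -F.curv₁ p A B, -F.curv₂ p A B, 0, 0;
       0, 0, 0, 0] := by
  rw [hF.confCurv_eq hp, hF.comp_null hp]

omit hp in
theorem isNormalConformal : F.IsNormalConformal P F.confConn where
  so_valued p _ A B := so_valued A B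
  soldering p hp μ := by fin_cases μ <;> rfl
  soldering_last p hp := rfl
  horizontal p hp A B := by
    change F.confCurv A B p = F.ofComp p (F.comp p (F.confCurv A B p))
    rw [hF.comp_confCurv hp, ofComp_null, hF.confCurv_eq hp]
  torsion_free p hp A := by
    change F.confCurv A 0 p = 0
    rw [hF.confCurv_eq hp]
    ext v
    fin_cases A <;> simp [CoframeData.curv₁, CoframeData.curv₂, matN₁, matN₂, matM]
  trace_free p hp ν σ := by
    change ∑ μ, F.comp p (F.confCurv (tIdx μ) (tIdx ν) p) μ σ = 0
    simp only [hF.comp_confCurv hp]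
    fin_cases ν <;> fin_cases σ <;>
      simp [Fin.sum_univ_four, CoframeData.curv₁, CoframeData.curv₂, matN₁, matN₂, matM, tIdx]

theorem curvPlus_eq (μ ν : Fin 4) : F.curvPlus p μ ν =
    (![![0, 0, 1, 0], ![0, 0, 0, 0], ![-1, 0, 0, 0], ![0, 0, 0, 0]] : Fin 4 → Fin 4 → ℂ) μ ν •
      F.curv₁ p := by
  ext A B
  rw [CoframeData.curvPlus, Matrix.of_apply, hF.comp_confCurv hp, sdPart, hodge_null]
  fin_cases μ <;> fin_cases ν <;> simp [← mul_assoc] <;> ring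

theorem curvMinus_eq (μ ν : Fin 4) : F.curvMinus p μ ν =
    (![![0, 0, 0, 0], ![0, 0, 1, 0], ![0, -1, 0, 0], ![0, 0, 0, 0]] : Fin 4 → Fin 4 → ℂ) μ ν •
      F.curv₂ p := by
  ext A B
  rw [CoframeData.curvMinus, Matrix.of_apply, hF.comp_confCurv hp, asdPart, hodge_null]
  fin_cases μ <;> fin_cases ν <;> simp [← mul_assoc] <;> ring

-- Both products of `matM` with each of `matN₁`, `matN₂` vanish, as does its square, so `𝓢` drops
-- out and only `[N₂, N₁] = i M` contributes.
omit hF hp in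
theorem curv_commutator : ⁅F.curv₂ p, F.curv₁ p⁆ =
    (Complex.I * F.R p * starRingEnd ℂ (F.R p)) • matM := by
  rw [Ring.lie_def]
  ext A B
  fin_cases A <;> fin_cases B <;>
    simp [CoframeData.curv₁, CoframeData.curv₂, matN₁, matN₂, matM]
  all_goals ring

theorem commutator_curvMinus_curvPlus : ⁅F.curvMinus p 2 1, F.curvPlus p 2 0⁆ =
    (Complex.I * F.R p * starRingEnd ℂ (F.R p)) • matM := by
  rw [← curv_commutator, hF.curvMinus_eq hp, hF.curvPlus_eq hp]
  simp [Ring.lie_def]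

theorem bastonMason_iff : F.BastonMasonCommutator p ↔ F.R p = 0 := by
  constructor
  · intro h
    have h1 := h 2 0 2 1
    have h3 : ⁅F.curvMinus p 2 1, F.curvPlus p 2 0⁆ = 0 := by
      rw [Ring.lie_def] at h1 ⊢
      rw [← neg_sub, h1, neg_zero]
    rw [hF.commutator_curvMinus_curvPlus hp] at h3
    have h2 := congrFun (congrFun h3 0) 3
    simpa [matM] using h2
  · intro h μ ν ρ σ
    have h1 := curv_commutator (F := F) (p := p)
    rw [h, mul_zero, zero_mul, zero_smul, Ring.lie_def, sub_eq_zero] at h1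
    rw [hF.curvMinus_eq hp, hF.curvPlus_eq hp, Ring.lie_def, smul_mul_smul_comm,
      smul_mul_smul_comm, h1, mul_comm, sub_self]

/-- Apart from `𝓢₁ θ¹`, the differential `d𝓢` is a combination of `θ²`, `θ³`, `2Ω₂ + 3Ω̄₂` and
`Ω̄₃`, exactly the other factors of the product. Conversely, contraction with the vectors dual to
`θ¹, θ², θ³` recovers `𝓢₁` from the product. -/
theorem S1_eq_zero_iff : F.S1 p = 0 ↔
    wedge (fderiv ℝ F.S p) (wedge (F.th2 p) (wedge (F.th3 p)
      (wedge₁ ((2 : ℂ) • F.Om2 p + (3 : ℂ) • F.Om2b p) (F.Om3b p)))) = 0 := by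
  have hd := hF.coframe_indep p hp
  obtain ⟨S2, S3, h⟩ := hF.exists_fderiv_S hp
  set T := wedge₁ ((2 : ℂ) • F.Om2 p + (3 : ℂ) • F.Om2b p) (F.Om3b p) with hT
  have c0 : contr (F.dualVec p 0) T = 0 := by
    rw [hT, contr_wedge₁]
    ext v
    simp [evalC_add, evalC_smul, evalC_Om2 hd, evalC_Om2b hd, evalC_Om3b hd]
  have c1 : contr (F.dualVec p 1) T = 0 := by
    rw [hT, contr_wedge₁]
    ext v
    simp [evalC_add, evalC_smul, evalC_Om2 hd, evalC_Om2b hd, evalC_Om3b hd]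
  have c2 : contr (F.dualVec p 2) T = 0 := by
    rw [hT, contr_wedge₁]
    ext v
    simp [evalC_add, evalC_smul, evalC_Om2 hd, evalC_Om2b hd, evalC_Om3b hd]
  have hT0 : T ≠ 0 := by
    intro h0
    have h1 := evalC₂_wedge₁ ((2 : ℂ) • F.Om2 p + (3 : ℂ) • F.Om2b p) (F.Om3b p)
      (F.dualVec p 3) (F.dualVec p 6)
    rw [← hT, h0, evalC₂_zero] at h1
    simp [evalC_add, evalC_smul, evalC_Om2 hd, evalC_Om2b hd, evalC_Om3b hd] at h1
  have h3 : contr (F.dualVec p 2) (wedge (F.th3 p) T) = T := by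
    rw [contr_wedge, c2, wedge_zero_right, sub_zero, evalC_th3 hd, if_pos rfl, one_smul]
  have h2 : contr (F.dualVec p 1) (wedge (F.th2 p) (wedge (F.th3 p) T)) =
      wedge (F.th3 p) T := by
    rw [contr_wedge, contr_wedge, c1, wedge_zero_right, evalC_th2 hd, if_pos rfl, one_smul,
      evalC_th3 hd]
    simp [wedge_zero_right, alt_zero_smul]
  have h1 : contr (F.dualVec p 0) (wedge (fderiv ℝ F.S p)
      (wedge (F.th2 p) (wedge (F.th3 p) T))) =
      F.S1 p • wedge (F.th2 p) (wedge (F.th3 p) T) := by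
    rw [contr_wedge, contr_wedge, contr_wedge, c0, wedge_zero_right, evalC_th2 hd, evalC_th3 hd]
    simp [wedge_zero_right, alt_zero_smul, CoframeData.S1]
  constructor
  · intro h0
    have t2 : wedge (F.th2 p) (wedge (F.th2 p) (wedge (F.th3 p) T)) = 0 := wedge_self_wedge _ _
    have t3 : wedge (F.th3 p) (wedge (F.th2 p) (wedge (F.th3 p) T)) = 0 := by
      rw [wedge_left_comm, wedge_self_wedge, wedge_zero_right, neg_zero]
    have t4 : wedge ((2 : ℂ) • F.Om2 p + (3 : ℂ) • F.Om2b p)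
        (wedge (F.th2 p) (wedge (F.th3 p) T)) = 0 := by
      rw [wedge_left_comm, wedge_left_comm _ (F.th3 p), hT, wedge₁, wedge_self_wedge,
        wedge_zero_right, neg_zero, wedge_zero_right, neg_zero]
    have t5 : wedge (F.Om3b p) (wedge (F.th2 p) (wedge (F.th3 p) T)) = 0 := by
      have h5 : wedge (F.Om3b p) (toAlt (F.Om3b p)) = 0 := by
        ext v
        exact (wedge₁_apply _ _ v).trans (by simp; ring)
      rw [wedge_left_comm, wedge_left_comm _ (F.th3 p), hT, wedge₁, wedge_left_comm _ _ (toAlt _),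
        h5]
      simp [wedge_zero_right]
    have h6 : fderiv ℝ F.S p = S2 • F.th2 p + (S3 • F.th3 p
        + ((-F.S p) • ((2 : ℂ) • F.Om2 p + (3 : ℂ) • F.Om2b p)
        + (-(Complex.I * F.R p)) • F.Om3b p)) := by
      rw [h, h0]
      ext u
      simp
      ring
    rw [h6, wedge_add_left, wedge_add_left, wedge_add_left, wedge_smul_left, wedge_smul_left,
      wedge_smul_left, wedge_smul_left, t2, t3, t4, t5]
    ext v
    simp
  · intro h0
    rw [h0, contr_zero] at h1
    rcases alt_smul_eq_zero h1.symm with h4 | h4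
    · exact h4
    · rw [h4, contr_zero] at h2
      rw [← h2, contr_zero] at h3
      exact absurd h3.symm hT0

end IsCartanCoframe

/-! ### The Yang–Mills current -/

namespace IsCartanCoframe

variable {N : Set (Fin 3 → ℝ)} {cr : CRStructure N} {P : Set (Fin 8 → ℝ)}
  {π : (Fin 8 → ℝ) → (Fin 3 → ℝ)} {F : CoframeData}
  (hF : IsCartanCoframe cr P π F) {p : Fin 8 → ℝ} (hp : p ∈ P)
include hF hp

theorem differentiableAt_Rb : DifferentiableAt ℝ (fun q => starRingEnd ℂ (F.R q)) p :=
  (Complex.conjCLE : ℂ →L[ℝ] ℂ).differentiableAt.comp p (hF.differentiableAt_of hp hF.R_smooth)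

theorem differentiableAt_Sb : DifferentiableAt ℝ (fun q => starRingEnd ℂ (F.S q)) p :=
  (Complex.conjCLE : ℂ →L[ℝ] ℂ).differentiableAt.comp p (hF.differentiableAt_of hp hF.S_smooth)

theorem hasFDerivAt_curv₁ (A B : Fin 6) : HasFDerivAt (fun q => F.curv₁ q A B)
    (matN₁ A B • fderiv ℝ (fun q => starRingEnd ℂ (F.R q)) p
      - matM A B • fderiv ℝ (fun q => starRingEnd ℂ (F.S q)) p) p := by
  have h := ((hF.differentiableAt_Rb hp).hasFDerivAt.mul_const (matN₁ A B)).fun_sub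
    ((hF.differentiableAt_Sb hp).hasFDerivAt.mul_const (matM A B))
  simpa [CoframeData.curv₁] using h

theorem hasFDerivAt_curv₂ (A B : Fin 6) : HasFDerivAt (fun q => F.curv₂ q A B)
    (matN₂ A B • fderiv ℝ F.R p - matM A B • fderiv ℝ F.S p) p := by
  have h := ((hF.differentiableAt_of hp hF.R_smooth).hasFDerivAt.mul_const (matN₂ A B)).fun_sub
    ((hF.differentiableAt_of hp hF.S_smooth).hasFDerivAt.mul_const (matM A B))
  simpa [CoframeData.curv₂] using h

set_option maxHeartbeats 4000000 in
/-- The covariant derivative of the `θ¹ ∧ θ³` component of the curvature. -/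
theorem exists_covDeriv_curv₁ : ∃ Y Z : Matrix (Fin 6) (Fin 6) ℂ, ∀ A B u,
    fderiv ℝ (fun q => F.curv₁ q A B) p u +
      ∑ k, (F.confConn A k p u * F.curv₁ p k B - F.curv₁ p A k * F.confConn k B p u) =
    -(2 * F.Om2 p u + F.Om2b p u) * F.curv₁ p A B - F.S1 p * matM A B * F.th2 p u
      + Y A B * F.th1 p u + Z A B * F.th3 p u := by
  obtain ⟨R1, R3, hR⟩ := hF.exists_fderiv_Rb hp
  obtain ⟨T1, T3, hS⟩ := hF.exists_fderiv_Sb hp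
  set r := starRingEnd ℂ (F.R p) with hr
  set s := starRingEnd ℂ (F.S p) with hs
  -- These are the coefficients of `θ¹` and `θ³`. Their values are irrelevant later, since both
  -- terms vanish after multiplication by `θ¹∧θ³`.
  refine ⟨R1 • matN₁ - T1 • matM +
    !![-(Complex.I / 2) * r, 0, -(Complex.I / 2) * s, 0, r / 4, 0;
       0, Complex.I * r, 0, -s, 0, -(Complex.I / 2) * s;
       0, 0, -Complex.I * r, 0, 0, 0;
       0, 0, 0, Complex.I / 2 * r, 0, r / 4;
       -r, 0, s, 0, -(Complex.I / 2) * r, 0;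
       0, 0, 0, -r, 0, Complex.I / 2 * r],
    R3 • matN₁ - T3 • matM +
    !![s, 0, 0, 0, 0, 0;
       0, 0, 0, 0, 0, 0;
       r, 0, 0, 0, -(Complex.I / 2) * r, 0;
       0, Complex.I / 2 * r, 0, -s, 0, 0;
       0, 0, 0, 0, s, 0;
       0, r, 0, 0, 0, -s], fun A B u => ?_⟩
  rw [(hF.hasFDerivAt_curv₁ hp A B).fderiv, hR, hS]
  simp only [F.confConn_apply, Fin.sum_univ_six, CoframeData.curv₁, matN₁, matM, inv_three_I,
    ← hr, ← hs, Matrix.sub_apply, Matrix.add_apply, Matrix.smul_apply, _root_.add_apply,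
    _root_.sub_apply, _root_.smul_apply, smul_eq_mul]
  generalize F.Om2 p u = a, F.Om2b p u = b, F.Om3 p u = c, F.Om3b p u = d,
    F.Om4 p u = e, F.th1 p u = f, F.th2 p u = g, F.th3 p u = h
  clear_value r s
  fin_cases A <;> fin_cases B <;> simp <;>
    ring_nf <;> (try simp only [Complex.I_sq]) <;> (try ring_nf) <;> (try exact Or.inl trivial)

set_option maxHeartbeats 4000000 in
/-- The covariant derivative of the `θ² ∧ θ³` component of the curvature. -/
theorem exists_covDeriv_curv₂ : ∃ Y Z : Matrix (Fin 6) (Fin 6) ℂ, ∀ A B u,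
    fderiv ℝ (fun q => F.curv₂ q A B) p u +
      ∑ k, (F.confConn A k p u * F.curv₂ p k B - F.curv₂ p A k * F.confConn k B p u) =
    -(F.Om2 p u + 2 * F.Om2b p u) * F.curv₂ p A B - F.S1 p * matM A B * F.th1 p u
      + Y A B * F.th2 p u + Z A B * F.th3 p u := by
  obtain ⟨R2, R3, hR⟩ := hF.exists_fderiv_R hp
  obtain ⟨S2, S3, hS⟩ := hF.exists_fderiv_S hp
  set r := F.R p with hr
  set s := F.S p with hs
  -- Likewise, the coefficients of `θ²` and `θ³` are killed by `θ²∧θ³`.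
  refine ⟨R2 • matN₂ - S2 • matM +
    !![Complex.I / 2 * r, Complex.I / 2 * s, 0, 0, r / 4, 0;
       0, Complex.I * r, 0, 0, 0, 0;
       0, 0, -Complex.I * r, -s, 0, Complex.I / 2 * s;
       0, 0, 0, -(Complex.I / 2) * r, 0, r / 4;
       -r, s, 0, 0, Complex.I / 2 * r, 0;
       0, 0, 0, -r, 0, -(Complex.I / 2) * r],
    R3 • matN₂ - S3 • matM +
    !![s, 0, 0, 0, 0, 0;
       r, 0, 0, 0, Complex.I / 2 * r, 0;
       0, 0, 0, 0, 0, 0;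
       0, 0, -(Complex.I / 2) * r, -s, 0, 0;
       0, 0, 0, 0, s, 0;
       0, 0, r, 0, 0, -s], fun A B u => ?_⟩
  rw [(hF.hasFDerivAt_curv₂ hp A B).fderiv, hR, hS]
  simp only [F.confConn_apply, Fin.sum_univ_six, CoframeData.curv₂, matN₂, matM, inv_three_I,
    ← hr, ← hs, Matrix.sub_apply, Matrix.add_apply, Matrix.smul_apply, _root_.add_apply,
    _root_.sub_apply, _root_.smul_apply, smul_eq_mul]
  generalize F.Om2 p u = a, F.Om2b p u = b, F.Om3 p u = c, F.Om3b p u = d,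
    F.Om4 p u = e, F.th1 p u = f, F.th2 p u = g, F.th3 p u = h
  clear_value r s
  fin_cases A <;> fin_cases B <;> simp <;>
    ring_nf <;> (try simp only [Complex.I_sq]) <;> (try ring_nf) <;> (try exact Or.inl trivial)

/-- Since `d(θ¹∧θ³) = (2Ω₂ + Ω̄₂)∧θ¹∧θ³`, the weight terms of the covariant derivatives cancel, and
similarly for `θ²∧θ³`. The star multiplies the two summands by `i` and `-i`, so the contributions of
`𝓢₁`, which cancel in the Bianchi identity, add up to `2i 𝓢₁ M`. -/
theorem ymCurrent_eq (A B : Fin 6) : F.ymCurrent A B p =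
    (-(2 / Complex.I) * F.S1 p * matM A B) •
      wedge (F.th1 p) (wedge₁ (F.th2 p) (F.th3 p)) := by
  have d1 := hF.differentiableAt_of hp hF.th1_smooth
  have d2 := hF.differentiableAt_of hp hF.th2_smooth
  have d3 := hF.differentiableAt_of hp hF.cth3_smooth
  obtain ⟨Y, Z, h1⟩ := hF.exists_covDeriv_curv₁ hp
  obtain ⟨Y', Z', h2⟩ := hF.exists_covDeriv_curv₂ hp
  have hs : (fun q => F.starCurv A B q) =ᶠ[nhds p] fun q =>
      (Complex.I * F.curv₁ q A B) • wedge₁ (F.th1 q) (F.th3 q)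
      + (-(Complex.I * F.curv₂ q A B)) • wedge₁ (F.th2 q) (F.th3 q) :=
    Filter.eventuallyEq_of_mem (hF.isOpen.mem_nhds hp) (fun q hq => hF.starCurv_eq hq A B)
  have c1 := (hF.hasFDerivAt_curv₁ hp A B).differentiableAt.hasFDerivAt.const_mul Complex.I
  have c2 := ((hF.hasFDerivAt_curv₂ hp A B).differentiableAt.hasFDerivAt.const_mul
    Complex.I).fun_neg
  have i1 : (2 / Complex.I) = -2 * Complex.I := by
    field_simp; simp
  ext v
  have g1 := h1 A B (v 0)
  have g2 := h1 A B (v 1)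
  have g3 := h1 A B (v 2)
  have g1' := h2 A B (v 0)
  have g2' := h2 A B (v 1)
  have g3' := h2 A B (v 2)
  rw [← eq_sub_iff_add_eq] at g1 g2 g3 g1' g2' g3'
  rw [CoframeData.ymCurrent, covExtD, hs.extDeriv_eq,
    extDeriv_fun_add (c1.differentiableAt.fun_smul (differentiableAt_wedge₁ d1 d3))
    (c2.differentiableAt.fun_smul (differentiableAt_wedge₁ d2 d3)),
    extDeriv_smul_two c1.differentiableAt (differentiableAt_wedge₁ d1 d3),
    extDeriv_smul_two c2.differentiableAt (differentiableAt_wedge₁ d2 d3), c1.fderiv, c2.fderiv,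
    extDeriv_wedge₁ d1 d3, extDeriv_wedge₁ d2 d3, add_sub_assoc, ← Finset.sum_sub_distrib, i1]
  simp only [hF.starCurv_eq hp, ContinuousAlternatingMap.add_apply,
    ContinuousAlternatingMap.sub_apply,
    ContinuousAlternatingMap.smul_apply, wedge_two_apply, smul_eq_mul, _root_.smul_apply,
    _root_.neg_apply, g1, g2, g3, g1', g2', g3', hF.d_th1 p hp, hF.d_th3 p hp,
    hF.extD_th2_apply hp, wedge₁_apply, _root_.add_apply, Matrix.cons_val_zero,
    Matrix.cons_val_one, Fin.sum_univ_six]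
  ring

end IsCartanCoframe

/-! ### Matrix-valued functions and connections on open subsets of `ℝ⁴` -/

section MatrixCalculus

/-- The partial derivative of a complex-valued function. -/
def pdC (c : Fin 4) (f : (Fin 4 → ℝ) → ℂ) (x : Fin 4 → ℝ) : ℂ := fderiv ℝ f x (stdVec c)

/-- The entrywise partial derivative of a matrix-valued function. -/
def pdM {m n : Type*} (c : Fin 4) (H : (Fin 4 → ℝ) → Matrix m n ℂ) (x : Fin 4 → ℝ) :
    Matrix m n ℂ :=
  Matrix.of fun i j => pdC c (fun y => H y i j) x

/-- All entries are smooth on `U`. -/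
def SmoothM {m n : Type*} (U : Set (Fin 4 → ℝ)) (H : (Fin 4 → ℝ) → Matrix m n ℂ) : Prop :=
  ∀ i j, ContDiffOn ℝ ∞ (fun y => H y i j) U

variable {U : Set (Fin 4 → ℝ)} {x : Fin 4 → ℝ}

theorem differentiableAt_of_contDiffOn {E : Type*} [NormedAddCommGroup E] [NormedSpace ℝ E]
    {n : ℕ} {U : Set (Fin n → ℝ)} {x : Fin n → ℝ}
    {f : (Fin n → ℝ) → E} (hU : IsOpen U) (hx : x ∈ U) (hf : ContDiffOn ℝ ∞ f U) :
    DifferentiableAt ℝ f x :=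
  (hf.contDiffAt (hU.mem_nhds hx)).differentiableAt (by simp)

theorem contDiffOn_pdC (hU : IsOpen U) {f : (Fin 4 → ℝ) → ℂ} (hf : ContDiffOn ℝ ∞ f U)
    (c : Fin 4) : ContDiffOn ℝ ∞ (pdC c f) U :=
  (hf.fderiv_of_isOpen hU (by simp)).clm_apply contDiffOn_const

theorem pdC_congr (hU : IsOpen U) (hx : x ∈ U) {f g : (Fin 4 → ℝ) → ℂ}
    (h : ∀ y ∈ U, f y = g y) (c : Fin 4) : pdC c f x = pdC c g x := by
  have h1 : f =ᶠ[nhds x] g := Filter.eventuallyEq_of_mem (hU.mem_nhds hx) h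
  rw [pdC, pdC, h1.fderiv_eq]

theorem pdC_comm (hU : IsOpen U) (hx : x ∈ U) {f : (Fin 4 → ℝ) → ℂ} (hf : ContDiffOn ℝ ∞ f U)
    (c d : Fin 4) : pdC c (pdC d f) x = pdC d (pdC c f) x := by
  have h1 := differentiableAt_of_contDiffOn hU hx (hf.fderiv_of_isOpen (m := ∞) hU (by simp))
  have h2 : ∀ c d : Fin 4, pdC c (pdC d f) x = fderiv ℝ (fderiv ℝ f) x (stdVec c) (stdVec d) := by
    intro c d
    have h3 := h1.hasFDerivAt.clm_apply (hasFDerivAt_const (stdVec d : Fin 4 → ℝ) x)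
    have h4 : pdC d f = fun y => fderiv ℝ f y (stdVec d) := rfl
    rw [pdC, h4, h3.fderiv]
    simp
  rw [h2, h2]
  exact ((hf.contDiffAt (hU.mem_nhds hx)).isSymmSndFDerivAt
    (by rw [minSmoothness_of_isRCLikeNormedField]; exact two_le_infty)) _ _

/-- The metric and its curvature are real while the connection is complex. This transfers
derivatives between the two, and differentiability of the real function is deduced from that of the
complex one. -/
theorem cast_pd (hU : IsOpen U) (hx : x ∈ U) {f : (Fin 4 → ℝ) → ℝ} {f' : (Fin 4 → ℝ) → ℂ}
    (hf : ContDiffOn ℝ ∞ f' U) (h : ∀ y ∈ U, (f y : ℂ) = f' y) (c : Fin 4) :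
    ((pd c f x : ℝ) : ℂ) = pdC c f' x := by
  have h1 : f =ᶠ[nhds x] fun y => Complex.reCLM (f' y) :=
    Filter.eventuallyEq_of_mem (hU.mem_nhds hx) fun y hy => by simp [← h y hy]
  have h2 : DifferentiableAt ℝ f x :=
    (Complex.reCLM.differentiableAt.comp x
      (differentiableAt_of_contDiffOn hU hx hf)).congr_of_eventuallyEq h1
  have h3 : f' =ᶠ[nhds x] fun y => Complex.ofRealCLM (f y) :=
    Filter.eventuallyEq_of_mem (hU.mem_nhds hx) fun y hy => by simp [← h y hy]
  have h4 : HasFDerivAt (fun y => Complex.ofRealCLM (f y))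
      (Complex.ofRealCLM.comp (fderiv ℝ f x)) x :=
    Complex.ofRealCLM.hasFDerivAt.comp x h2.hasFDerivAt
  rw [pdC, h3.fderiv_eq, h4.fderiv]
  rfl

variable {l m n : Type*} [Fintype m]

theorem SmoothM.differentiableAt {H : (Fin 4 → ℝ) → Matrix l n ℂ} (hH : SmoothM U H)
    (hU : IsOpen U) (hx : x ∈ U) (i : l) (j : n) : DifferentiableAt ℝ (fun y => H y i j) x :=
  differentiableAt_of_contDiffOn hU hx (hH i j)

theorem SmoothM.pdM {H : (Fin 4 → ℝ) → Matrix l n ℂ} (hH : SmoothM U H)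
    (hU : IsOpen U) (c : Fin 4) : SmoothM U (CRFefferman.pdM c H) :=
  fun i j => contDiffOn_pdC hU (hH i j) c

theorem SmoothM.mul {H : (Fin 4 → ℝ) → Matrix l m ℂ} {K : (Fin 4 → ℝ) → Matrix m n ℂ}
    (hH : SmoothM U H) (hK : SmoothM U K) : SmoothM U (fun y => H y * K y) := fun i j => by
  simp only [Matrix.mul_apply]
  exact ContDiffOn.sum fun k _ => (hH i k).mul (hK k j)

theorem SmoothM.add {H K : (Fin 4 → ℝ) → Matrix l n ℂ}
    (hH : SmoothM U H) (hK : SmoothM U K) : SmoothM U (fun y => H y + K y) :=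
  fun i j => (hH i j).add (hK i j)

theorem SmoothM.sub {H K : (Fin 4 → ℝ) → Matrix l n ℂ}
    (hH : SmoothM U H) (hK : SmoothM U K) : SmoothM U (fun y => H y - K y) :=
  fun i j => (hH i j).sub (hK i j)

theorem SmoothM.transpose {H : (Fin 4 → ℝ) → Matrix l n ℂ}
    (hH : SmoothM U H) : SmoothM U (fun y => (H y).transpose) :=
  fun i j => hH j i

theorem pdM_congr (hU : IsOpen U) (hx : x ∈ U) {H K : (Fin 4 → ℝ) → Matrix l n ℂ}
    (h : ∀ y ∈ U, H y = K y) (c : Fin 4) : pdM c H x = pdM c K x := by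
  ext i j
  exact pdC_congr hU hx (fun y hy => by rw [h y hy]) c

theorem pdM_mul (hU : IsOpen U) (hx : x ∈ U) {H : (Fin 4 → ℝ) → Matrix l m ℂ}
    {K : (Fin 4 → ℝ) → Matrix m n ℂ} (hH : SmoothM U H) (hK : SmoothM U K) (c : Fin 4) :
    pdM c (fun y => H y * K y) x = pdM c H x * K x + H x * pdM c K x := by
  ext i j
  have h : HasFDerivAt (fun y => ∑ k, H y i k * K y k j)
      (∑ k, (H x i k • fderiv ℝ (fun y => K y k j) x + K x k j • fderiv ℝ (fun y => H y i k) x))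
      x :=
    HasFDerivAt.fun_sum fun k _ => (hH.differentiableAt hU hx i k).hasFDerivAt.fun_mul
      (hK.differentiableAt hU hx k j).hasFDerivAt
  simp only [pdM, pdC, Matrix.of_apply, Matrix.add_apply, Matrix.mul_apply]
  rw [h.fderiv, ← Finset.sum_add_distrib]
  simp only [_root_.sum_apply, _root_.add_apply, _root_.smul_apply, smul_eq_mul]
  exact Finset.sum_congr rfl fun k _ => by ring

theorem pdM_add (hU : IsOpen U) (hx : x ∈ U) {H K : (Fin 4 → ℝ) → Matrix l n ℂ}
    (hH : SmoothM U H) (hK : SmoothM U K) (c : Fin 4) :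
    pdM c (fun y => H y + K y) x = pdM c H x + pdM c K x := by
  ext i j
  have h := (hH.differentiableAt hU hx i j).hasFDerivAt.fun_add
    (hK.differentiableAt hU hx i j).hasFDerivAt
  simp only [pdM, pdC, Matrix.of_apply, Matrix.add_apply]
  rw [h.fderiv]
  rfl

theorem pdM_comm (hU : IsOpen U) (hx : x ∈ U) {H : (Fin 4 → ℝ) → Matrix l n ℂ}
    (hH : SmoothM U H) (c d : Fin 4) : pdM c (pdM d H) x = pdM d (pdM c H) x := by
  ext i j
  exact pdC_comm hU hx (hH i j) c d

theorem contDiffOn_det {ι : Type*} [Fintype ι] [DecidableEq ι] {H : (Fin 4 → ℝ) → Matrix ι ι ℂ}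
    (hH : SmoothM U H) : ContDiffOn ℝ ∞ (fun y => (H y).det) U := by
  simp only [Matrix.det_apply']
  exact ContDiffOn.sum fun s _ => contDiffOn_const.mul (contDiffOn_prod fun i _ => hH _ _)

theorem SmoothM.inv {ι : Type*} [Fintype ι] [DecidableEq ι] {H : (Fin 4 → ℝ) → Matrix ι ι ℂ}
    (hH : SmoothM U H) (h0 : ∀ y ∈ U, (H y).det ≠ 0) : SmoothM U (fun y => (H y)⁻¹) := by
  intro i j
  have h1 : ∀ y, (H y)⁻¹ i j = ((H y).det)⁻¹ * ((H y).updateRow j (Pi.single i 1)).det := by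
    intro y
    rw [Matrix.inv_def, Matrix.smul_apply, Matrix.adjugate_apply, Ring.inverse_eq_inv',
      smul_eq_mul]
  simp only [h1]
  refine ((contDiffOn_det hH).inv h0).mul (contDiffOn_det fun a b => ?_)
  by_cases hj : a = j
  · subst hj
    simp only [Matrix.updateRow_self]
    exact contDiffOn_const
  · simp only [Matrix.updateRow_ne hj]
    exact hH a b

end MatrixCalculus

/-! ### Gauge covariance of curvature and covariant derivatives -/

section Gauge

variable {ι : Type*} [Fintype ι] {U : Set (Fin 4 → ℝ)} {x : Fin 4 → ℝ}

/-- The curvature components of a connection. -/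
def curvM (w : Fin 4 → (Fin 4 → ℝ) → Matrix ι ι ℂ) (c d : Fin 4) (x : Fin 4 → ℝ) :
    Matrix ι ι ℂ :=
  pdM c (w d) x - pdM d (w c) x + w c x * w d x - w d x * w c x

/-- The covariant derivative of a matrix-valued function. -/
def covM (w : Fin 4 → (Fin 4 → ℝ) → Matrix ι ι ℂ) (c : Fin 4)
    (K : (Fin 4 → ℝ) → Matrix ι ι ℂ) (x : Fin 4 → ℝ) : Matrix ι ι ℂ :=
  pdM c K x + w c x * K x - K x * w c x

theorem SmoothM.curvM {w : Fin 4 → (Fin 4 → ℝ) → Matrix ι ι ℂ} (hU : IsOpen U)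
    (hw : ∀ c, SmoothM U (w c)) (c d : Fin 4) : SmoothM U (CRFefferman.curvM w c d) :=
  ((((hw d).pdM hU c).sub ((hw c).pdM hU d)).add ((hw c).mul (hw d))).sub ((hw d).mul (hw c))

/-- `W` is obtained from `w` by the gauge transformation `h`. -/
structure IsGauge (U : Set (Fin 4 → ℝ)) (h : (Fin 4 → ℝ) → Matrix ι ι ℂ)
    (w W : Fin 4 → (Fin 4 → ℝ) → Matrix ι ι ℂ) : Prop where
  isOpen : IsOpen U
  smooth_h : SmoothM U h
  smooth_w : ∀ c, SmoothM U (w c)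
  smooth_W : ∀ c, SmoothM U (W c)
  gauge : ∀ x ∈ U, ∀ c, h x * W c x = w c x * h x + pdM c h x

variable {h : (Fin 4 → ℝ) → Matrix ι ι ℂ} {w W : Fin 4 → (Fin 4 → ℝ) → Matrix ι ι ℂ}

/-- The gauge equation `h W = w h + dh` is differentiated and antisymmetrized. The second
derivatives of `h` cancel, and its first derivatives are eliminated by the gauge equation itself. -/
theorem IsGauge.curvM (hg : IsGauge U h w W) (hx : x ∈ U) (c d : Fin 4) :
    h x * curvM W c d x = curvM w c d x * h x := by
  have hU := hg.isOpen
  have key : ∀ c d, pdM c h x * W d x + h x * pdM c (W d) x =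
      pdM c (w d) x * h x + w d x * pdM c h x + pdM c (pdM d h) x := by
    intro c d
    rw [← pdM_mul hU hx hg.smooth_h (hg.smooth_W d), ← pdM_mul hU hx (hg.smooth_w d) hg.smooth_h,
      ← pdM_add hU hx ((hg.smooth_w d).mul hg.smooth_h) (hg.smooth_h.pdM hU d)]
    exact pdM_congr hU hx (fun y hy => hg.gauge y hy d) c
  have hh : ∀ c, pdM c h x = h x * W c x - w c x * h x := fun c => by
    rw [hg.gauge x hx c]; abel
  have h1 := key c d
  have h2 := key d c
  rw [pdM_comm hU hx hg.smooth_h] at h1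
  rw [hh c] at h1
  rw [hh d] at h2
  have h3 := congrArg₂ (· - ·) h1 h2
  simp only [CRFefferman.curvM] at h3 ⊢
  rw [← sub_eq_zero] at h3 ⊢
  rw [← h3]
  noncomm_ring

theorem IsGauge.covM (hg : IsGauge U h w W) (hx : x ∈ U) {K K' : (Fin 4 → ℝ) → Matrix ι ι ℂ}
    (hK : SmoothM U K) (hK' : SmoothM U K') (hKK : ∀ y ∈ U, h y * K' y = K y * h y) (c : Fin 4) :
    h x * covM W c K' x = covM w c K x * h x := by
  have hU := hg.isOpen
  have h1 : pdM c h x * K' x + h x * pdM c K' x = pdM c K x * h x + K x * pdM c h x := by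
    rw [← pdM_mul hU hx hg.smooth_h hK', ← pdM_mul hU hx hK hg.smooth_h]
    exact pdM_congr hU hx hKK c
  have hh : pdM c h x = h x * W c x - w c x * h x := by
    rw [hg.gauge x hx c]; abel
  have h2 := hKK x hx
  rw [hh] at h1
  simp only [CRFefferman.covM]
  have e1 : h x * (pdM c K' x + W c x * K' x - K' x * W c x) =
      ((h x * W c x - w c x * h x) * K' x + h x * pdM c K' x) + w c x * (h x * K' x)
        - (h x * K' x) * W c x := by noncomm_ring
  rw [e1, h1, h2]
  noncomm_ring

end Gauge

/-! ### Block decomposition `6 = 1 + 4 + 1` -/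

section Blocks

theorem sum_six {M : Type*} [AddCommMonoid M] (f : Fin 6 → M) :
    ∑ A, f A = f 0 + ∑ a : Fin 4, f (tIdx a) + f 5 := by
  rw [Fin.sum_univ_castSucc, Fin.sum_univ_succ]
  rfl

theorem forall_six {q : Fin 6 → Prop} (h0 : q 0) (h : ∀ a, q (tIdx a)) (h5 : q 5) : ∀ A, q A := by
  intro A
  refine Fin.lastCases h5 (fun i => ?_) A
  exact Fin.cases h0 h i

/-- The function on `{0, …, 5}` with the given values at `0`, at `1, …, 4` and at `5`. -/
def six {α : Type*} (x : α) (f : Fin 4 → α) (y : α) : Fin 6 → α :=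
  Fin.snoc (α := fun _ => α) (Fin.cons (α := fun _ => α) x f) y

@[simp] theorem six_zero {α : Type*} (x : α) (f : Fin 4 → α) (y : α) : six x f y 0 = x := rfl
@[simp] theorem six_tIdx {α : Type*} (x : α) (f : Fin 4 → α) (y : α) (a : Fin 4) :
    six x f y (tIdx a) = f a := by
  rw [six, tIdx, Fin.snoc_castSucc, Fin.cons_succ]
@[simp] theorem six_five {α : Type*} (x : α) (f : Fin 4 → α) (y : α) : six x f y 5 = y := by
  exact Fin.snoc_last (α := fun _ => α) (n := 5) y (Fin.cons (α := fun _ => α) x f)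

theorem tIdx_injective : Function.Injective tIdx := fun _ _ h =>
  Fin.succ_injective _ (Fin.castSucc_injective _ h)

@[simp] theorem tIdx_ne_zero (a : Fin 4) : tIdx a ≠ 0 := by
  fin_cases a <;> decide
@[simp] theorem zero_ne_tIdx (a : Fin 4) : 0 ≠ tIdx a := (tIdx_ne_zero a).symm
@[simp] theorem tIdx_ne_five (a : Fin 4) : tIdx a ≠ 5 := by
  fin_cases a <;> decide
@[simp] theorem five_ne_tIdx (a : Fin 4) : 5 ≠ tIdx a := (tIdx_ne_five a).symm
@[simp] theorem tIdx_inj {a b : Fin 4} : tIdx a = tIdx b ↔ a = b := tIdx_injective.eq_iff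

/-- The matrix of the form of signature `(4, 2)` in a frame adapted to the coordinates. -/
def formG (g : MetricField) (x : Fin 4 → ℝ) : Matrix (Fin 6) (Fin 6) ℂ :=
  Matrix.of (six (six 0 0 (-1)) (fun a => six 0 (fun b => (g x a b : ℂ)) 0) (six (-1) 0 0))

end Blocks

/-! ### Normal conformal connections in coordinates -/

/-- `W` is, in the coordinate frame, the normal conformal connection of the metric `g`
in the gauge determined by `g`. -/
structure IsConfGauge (U : Set (Fin 4 → ℝ)) (g : MetricField)
    (W : Fin 4 → (Fin 4 → ℝ) → Matrix (Fin 6) (Fin 6) ℂ) : Prop where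
  isOpen : IsOpen U
  smooth_g : ∀ a b, ContDiffOn ℝ ∞ (fun y => (g y a b : ℂ)) U
  smooth_W : ∀ c, SmoothM U (W c)
  symm : ∀ x ∈ U, ∀ a b, g x a b = g x b a
  det_ne : ∀ x ∈ U, (g x).det ≠ 0
  col : ∀ x ∈ U, ∀ c A, W c x A 0 = if A = tIdx c then 1 else 0
  metric : ∀ x ∈ U, ∀ c, pdM c (formG g) x = (W c x).transpose * formG g x + formG g x * W c x
  torsion : ∀ x ∈ U, ∀ c d A, curvM W c d x A 0 = 0
  trace : ∀ x ∈ U, ∀ d b, ∑ a, curvM W a d x (tIdx a) (tIdx b) = 0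

namespace IsConfGauge

variable {U : Set (Fin 4 → ℝ)} {g : MetricField}
  {W : Fin 4 → (Fin 4 → ℝ) → Matrix (Fin 6) (Fin 6) ℂ}
  (hW : IsConfGauge U g W) {x : Fin 4 → ℝ} (hx : x ∈ U)

include hW hx

theorem csymm (a b : Fin 4) : (g x a b : ℂ) = (g x b a : ℂ) := by rw [hW.symm x hx]

theorem inv_mul (a b : Fin 4) :
    ∑ e, (((g x)⁻¹ a e : ℝ) : ℂ) * (g x e b : ℂ) = if a = b then 1 else 0 := by
  have h := congrFun (congrFun (Matrix.nonsing_inv_mul (g x) (hW.det_ne x hx).isUnit) a) b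
  rw [Matrix.mul_apply, Matrix.one_apply] at h
  have h1 := congrArg (fun t : ℝ => (t : ℂ)) h
  simpa [apply_ite] using h1

theorem inv_symm (a b : Fin 4) : (g x)⁻¹ a b = (g x)⁻¹ b a := by
  have h : (g x).transpose = g x := by ext i j; exact hW.symm x hx j i
  have h1 : ((g x)⁻¹).transpose = (g x)⁻¹ := by rw [Matrix.transpose_nonsing_inv, h]
  exact congrFun (congrFun h1 b) a

theorem inv_mul' (a b : Fin 4) :
    ∑ e, (((g x)⁻¹ e a : ℝ) : ℂ) * (g x e b : ℂ) = if a = b then 1 else 0 := by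
  rw [← hW.inv_mul hx]
  exact Finset.sum_congr rfl fun e _ => by rw [hW.inv_symm hx]

theorem W_zero_zero (c : Fin 4) : W c x 0 0 = 0 := by
  rw [hW.col x hx, if_neg (zero_ne_tIdx c)]

theorem W_five_zero (c : Fin 4) : W c x 5 0 = 0 := by
  rw [hW.col x hx, if_neg (five_ne_tIdx c)]

theorem W_tIdx_zero (c a : Fin 4) : W c x (tIdx a) 0 = if a = c then 1 else 0 := by
  rw [hW.col x hx]
  simp

/-- The entries of `formG` in its first and last rows and columns are constant. The corresponding
entries of this equation determine the last row of the connection, kill its corner entries, and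
lower the last column to the top row. -/
theorem metric_entry (c : Fin 4) (A B : Fin 6) : pdC c (fun y => formG g y A B) x =
    ∑ C, (W c x C A * formG g x C B + formG g x A C * W c x C B) := by
  have h := congrFun (congrFun (hW.metric x hx c) A) B
  simpa [pdM, Matrix.mul_apply, Finset.sum_add_distrib] using h

theorem W_five_tIdx (c a : Fin 4) : W c x 5 (tIdx a) = g x c a := by
  have h := hW.metric_entry hx c 0 (tIdx a)
  simp [sum_six, formG, hW.W_zero_zero hx, hW.W_five_zero hx, hW.W_tIdx_zero hx, pdC] at h
  linear_combination h

theorem W_five_five (c : Fin 4) : W c x 5 5 = 0 := by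
  have h := hW.metric_entry hx c 0 5
  simp [sum_six, formG, hW.W_zero_zero hx, hW.W_five_zero hx, pdC] at h
  exact h

theorem W_zero_five (c : Fin 4) : W c x 0 5 = 0 := by
  have h := hW.metric_entry hx c 5 5
  simp [sum_six, formG, pdC] at h
  linear_combination (1 / 2 : ℂ) * h

theorem W_zero_tIdx (c a : Fin 4) :
    W c x 0 (tIdx a) = ∑ e, (g x a e : ℂ) * W c x (tIdx e) 5 := by
  have h := hW.metric_entry hx c (tIdx a) 5
  simp [sum_six, formG, pdC, hW.W_five_five hx] at h
  linear_combination h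

theorem pdC_metric (c a b : Fin 4) : pdC c (fun y => (g y a b : ℂ)) x =
    ∑ e, (W c x (tIdx e) (tIdx a) * (g x e b : ℂ) + (g x a e : ℂ) * W c x (tIdx e) (tIdx b)) := by
  have h := hW.metric_entry hx c (tIdx a) (tIdx b)
  simpa [sum_six, formG, Finset.sum_add_distrib] using h

theorem pdC_col (c d : Fin 4) (A : Fin 6) : pdC c (fun y => W d y A 0) x = 0 := by
  rw [pdC_congr hW.isOpen hx (g := fun _ => if A = tIdx d then 1 else 0)
    (fun y hy => hW.col y hy d A)]
  simp [pdC]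

omit hW hx in
theorem curv_entry (c d : Fin 4) (A B : Fin 6) : curvM W c d x A B =
    pdC c (fun y => W d y A B) x - pdC d (fun y => W c y A B) x
      + (W c x A 0 * W d x 0 B - W d x A 0 * W c x 0 B)
      + ∑ e, (W c x A (tIdx e) * W d x (tIdx e) B - W d x A (tIdx e) * W c x (tIdx e) B)
      + (W c x A 5 * W d x 5 B - W d x A 5 * W c x 5 B) := by
  simp only [curvM, pdM, Matrix.add_apply, Matrix.sub_apply, Matrix.mul_apply, Matrix.of_apply,
    sum_six, Finset.sum_sub_distrib]
  ring

/-- The first column is constant, so the absence of torsion is an algebraic symmetry. -/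
theorem W_symm (c d a : Fin 4) : W c x (tIdx a) (tIdx d) = W d x (tIdx a) (tIdx c) := by
  have h := hW.torsion x hx c d (tIdx a)
  rw [curv_entry] at h
  simp [hW.pdC_col hx, hW.W_zero_zero hx, hW.W_five_zero hx, hW.W_tIdx_zero hx] at h
  exact sub_eq_zero.1 h

theorem W_zero_symm (c d : Fin 4) : W c x 0 (tIdx d) = W d x 0 (tIdx c) := by
  have h := hW.torsion x hx c d 0
  rw [curv_entry] at h
  simp [hW.pdC_col hx, hW.W_zero_zero hx, hW.W_five_zero hx, hW.W_tIdx_zero hx] at h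
  exact sub_eq_zero.1 h

theorem cast_pd_metric (c a b : Fin 4) : ((pd c (fun y => g y a b) x : ℝ) : ℂ) =
    pdC c (fun y => (g y a b : ℂ)) x :=
  cast_pd hW.isOpen hx (hW.smooth_g a b) (fun _ _ => rfl) c

/-- The middle block of the connection is the Levi-Civita connection. -/
theorem cast_Γ (a b c : Fin 4) :
    ((MetricField.Γ g a b c x : ℝ) : ℂ) = W b x (tIdx a) (tIdx c) := by
  -- The Koszul formula: compatibility with the metric expands each derivative, and symmetry in the
  -- lower indices cancels all but one pair of terms.
  have key : ∀ d, ((pd b (fun y => g y d c) x + pd c (fun y => g y d b) x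
      - pd d (fun y => g y b c) x : ℝ) : ℂ) = 2 * ∑ e, (g x d e : ℂ) * W b x (tIdx e) (tIdx c) := by
    intro d
    push_cast
    rw [hW.cast_pd_metric hx, hW.cast_pd_metric hx, hW.cast_pd_metric hx, hW.pdC_metric hx,
      hW.pdC_metric hx, hW.pdC_metric hx, ← Finset.sum_add_distrib, ← Finset.sum_sub_distrib,
      Finset.mul_sum]
    refine Finset.sum_congr rfl fun e _ => ?_
    rw [hW.W_symm hx c b e, hW.W_symm hx d b e, hW.W_symm hx d c e, hW.csymm hx e c,
      hW.csymm hx e b]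
    ring
  rw [MetricField.Γ]
  push_cast
  have h1 : ∀ d, (((g x)⁻¹ a d : ℝ) : ℂ) * (((pd b (fun y => g y d c) x : ℝ) : ℂ)
      + ((pd c (fun y => g y d b) x : ℝ) : ℂ) - ((pd d (fun y => g y b c) x : ℝ) : ℂ)) =
      2 * ∑ e, (((g x)⁻¹ a d : ℝ) : ℂ) * (g x d e : ℂ) * W b x (tIdx e) (tIdx c) := by
    intro d
    have h2 := key d
    push_cast at h2
    rw [h2]
    simp only [Finset.mul_sum]
    exact Finset.sum_congr rfl fun e _ => by ring
  rw [Finset.sum_congr rfl fun d _ => h1 d, ← Finset.mul_sum, Finset.sum_comm]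
  simp only [← Finset.sum_mul, hW.inv_mul hx]
  simp

theorem cast_riem (a b c d : Fin 4) : ((MetricField.riem g a b c d x : ℝ) : ℂ) =
    pdC c (fun y => W d y (tIdx a) (tIdx b)) x - pdC d (fun y => W c y (tIdx a) (tIdx b)) x
      + ∑ e, (W c x (tIdx a) (tIdx e) * W d x (tIdx e) (tIdx b)
        - W d x (tIdx a) (tIdx e) * W c x (tIdx e) (tIdx b)) := by
  rw [MetricField.riem]
  push_cast
  rw [cast_pd hW.isOpen hx (hW.smooth_W d (tIdx a) (tIdx b)) (fun y hy => hW.cast_Γ hy a d b),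
    cast_pd hW.isOpen hx (hW.smooth_W c (tIdx a) (tIdx b)) (fun y hy => hW.cast_Γ hy a c b)]
  simp only [hW.cast_Γ hx]

theorem curv_mid (a b c d : Fin 4) : curvM W c d x (tIdx a) (tIdx b) =
    ((MetricField.riem g a b c d x : ℝ) : ℂ)
      + (if a = c then W d x 0 (tIdx b) else 0) - (if a = d then W c x 0 (tIdx b) else 0)
      + W c x (tIdx a) 5 * g x d b - W d x (tIdx a) 5 * g x c b := by
  rw [curv_entry, hW.cast_riem hx]
  simp only [hW.W_tIdx_zero hx, hW.W_five_tIdx hx]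
  split_ifs <;> ring

/-- In the trace of `curv_mid` the top row occurs with coefficient `4 - 1 - 1 = 2`, one of the
subtracted terms coming from the last column with its index lowered. -/
theorem cast_ric (b d : Fin 4) : ((MetricField.ric g b d x : ℝ) : ℂ) =
    -2 * W d x 0 (tIdx b) - (∑ e, W e x (tIdx e) 5) * g x d b := by
  have h := hW.trace x hx d b
  simp only [hW.curv_mid hx] at h
  rw [Finset.sum_sub_distrib, Finset.sum_add_distrib, Finset.sum_sub_distrib,
    Finset.sum_add_distrib] at h
  have h1 : ∑ a, W d x (tIdx a) 5 * (g x a b : ℂ) = W d x 0 (tIdx b) := by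
    rw [hW.W_zero_tIdx hx]
    exact Finset.sum_congr rfl fun a _ => by rw [hW.csymm hx a b, mul_comm]
  rw [h1] at h
  simp [← Finset.sum_mul] at h
  rw [MetricField.ric]
  push_cast
  linear_combination h

theorem inv_trace : ∑ b, ∑ d, (((g x)⁻¹ b d : ℝ) : ℂ) * W d x 0 (tIdx b) =
    ∑ e, W e x (tIdx e) 5 := by
  simp only [hW.W_zero_tIdx hx, Finset.mul_sum]
  rw [Finset.sum_comm]
  refine Finset.sum_congr rfl fun d _ => ?_
  rw [Finset.sum_comm]
  have : ∀ e, ∑ b, (((g x)⁻¹ b d : ℝ) : ℂ) * ((g x b e : ℂ) * W d x (tIdx e) 5) =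
      (if d = e then 1 else 0) * W d x (tIdx e) 5 := by
    intro e
    rw [← hW.inv_mul' hx, Finset.sum_mul]
    exact Finset.sum_congr rfl fun b _ => by ring
  simp [this]

theorem cast_scal : ((MetricField.scal g x : ℝ) : ℂ) = -6 * ∑ e, W e x (tIdx e) 5 := by
  rw [MetricField.scal]
  push_cast
  simp only [hW.cast_ric hx]
  have h1 : ∑ b, ∑ d, (((g x)⁻¹ b d : ℝ) : ℂ) * (g x d b : ℂ) = 4 := by
    simp only [hW.inv_mul hx]
    simp
  have h2 := hW.inv_trace hx
  have h3 : ∑ b, ∑ d, (((g x)⁻¹ b d : ℝ) : ℂ) * (-2 * W d x 0 (tIdx b)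
      - (∑ e, W e x (tIdx e) 5) * g x d b) =
      -2 * (∑ b, ∑ d, (((g x)⁻¹ b d : ℝ) : ℂ) * W d x 0 (tIdx b)) -
        (∑ e, W e x (tIdx e) 5) * ∑ b, ∑ d, (((g x)⁻¹ b d : ℝ) : ℂ) * (g x d b : ℂ) := by
    generalize (∑ e, W e x (tIdx e) 5) = t
    simp only [Finset.mul_sum, ← Finset.sum_sub_distrib]
    exact Finset.sum_congr rfl fun b _ => Finset.sum_congr rfl fun d _ => by ring
  rw [h3, h1, h2]
  ring

/-- The top row of the connection is minus the Schouten tensor. -/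
theorem cast_schouten (a b : Fin 4) :
    ((MetricField.schouten g a b x : ℝ) : ℂ) = -W a x 0 (tIdx b) := by
  rw [MetricField.schouten]
  push_cast
  rw [hW.cast_ric hx, hW.cast_scal hx, hW.W_zero_symm hx b a, hW.csymm hx b a]
  ring

theorem cast_weyl (a b c d : Fin 4) : ((MetricField.weyl g a b c d x : ℝ) : ℂ) =
    ∑ e, (g x a e : ℂ) * curvM W c d x (tIdx e) (tIdx b) := by
  rw [MetricField.weyl]
  push_cast
  simp only [hW.cast_schouten hx, hW.curv_mid hx, mul_sub, mul_add, Finset.sum_sub_distrib,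
    Finset.sum_add_distrib]
  have h1 : ∀ c d : Fin 4, ∑ e, (g x a e : ℂ) * (W c x (tIdx e) 5 * (g x d b : ℂ)) =
      W c x 0 (tIdx a) * g x d b := by
    intro c d
    rw [hW.W_zero_tIdx hx, Finset.sum_mul]
    exact Finset.sum_congr rfl fun e _ => by ring
  rw [h1, h1]
  simp
  rw [hW.W_zero_symm hx d b, hW.W_zero_symm hx c b, hW.W_zero_symm hx d a, hW.W_zero_symm hx c a,
    hW.csymm hx d b, hW.csymm hx c b]
  ring

/-- The top row of the curvature is the Cotton tensor. -/
theorem cast_cotton (a b c : Fin 4) : ((MetricField.cotton g a b c x : ℝ) : ℂ) =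
    curvM W b c x 0 (tIdx a) := by
  rw [MetricField.cotton, MetricField.covSchouten, MetricField.covSchouten]
  push_cast
  have e : ∀ a b c : Fin 4, ((pd c (MetricField.schouten g a b) x : ℝ) : ℂ) =
      - pdC c (fun y => W b y 0 (tIdx a)) x := by
    intro a b c
    rw [cast_pd hW.isOpen hx (f' := fun y => -W b y 0 (tIdx a))
      ((hW.smooth_W b 0 (tIdx a)).neg) (fun y hy => by
        rw [hW.cast_schouten hy, hW.W_zero_symm hy])]
    simp [pdC, fderiv_fun_neg]
  rw [e, e, curv_entry, hW.W_zero_zero hx, hW.W_zero_zero hx, hW.W_zero_five hx,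
    hW.W_zero_five hx]
  simp only [hW.cast_Γ hx, hW.cast_schouten hx]
  rw [sub_sub_sub_comm, ← Finset.sum_sub_distrib]
  have : ∀ e, W c x (tIdx e) (tIdx a) * -W e x 0 (tIdx b) + W c x (tIdx e) (tIdx b) *
      -W a x 0 (tIdx e) - (W b x (tIdx e) (tIdx a) * -W e x 0 (tIdx c)
      + W b x (tIdx e) (tIdx c) * -W a x 0 (tIdx e)) =
      -(W b x 0 (tIdx e) * W c x (tIdx e) (tIdx a) - W c x 0 (tIdx e) * W b x (tIdx e) (tIdx a)) := by
    intro e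
    rw [hW.W_symm hx c b e, hW.W_zero_symm hx e b, hW.W_zero_symm hx e c]
    ring
  rw [Finset.sum_congr rfl fun e _ => this e, Finset.sum_neg_distrib]
  ring

/-- The only remaining terms pair two last columns by the metric, which is symmetric. -/
theorem curv_zero_five (b c : Fin 4) : curvM W b c x 0 5 = 0 := by
  rw [curv_entry]
  have h1 : ∀ b c : Fin 4, pdC b (fun y => W c y 0 5) x = 0 := by
    intro b c
    rw [pdC_congr hW.isOpen hx (g := fun _ => 0) (fun y hy => hW.W_zero_five hy c)]
    simp [pdC]
  rw [h1, h1, hW.W_zero_zero hx, hW.W_zero_zero hx, hW.W_zero_five hx, hW.W_zero_five hx]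
  simp only [hW.W_zero_tIdx hx, Finset.sum_mul, Finset.sum_sub_distrib]
  have h2 : ∀ b c : Fin 4, ∑ e, ∑ f, (g x e f : ℂ) * W b x (tIdx f) 5 * W c x (tIdx e) 5 =
      ∑ e, ∑ f, (g x e f : ℂ) * W c x (tIdx f) 5 * W b x (tIdx e) 5 := by
    intro b c
    rw [Finset.sum_comm]
    exact Finset.sum_congr rfl fun e _ => Finset.sum_congr rfl fun f _ => by
      rw [hW.csymm hx f e]; ring
  rw [h2 b c]
  ring

end IsConfGauge

/-- The divergence of a matrix-valued `2`-form with respect to the connection `w` and the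
Levi-Civita connection of `g`. -/
def divM (g : MetricField) (w : Fin 4 → (Fin 4 → ℝ) → Matrix (Fin 6) (Fin 6) ℂ)
    (K : Fin 4 → Fin 4 → (Fin 4 → ℝ) → Matrix (Fin 6) (Fin 6) ℂ) (b : Fin 4) (x : Fin 4 → ℝ) :
    Matrix (Fin 6) (Fin 6) ℂ :=
  ∑ c, ∑ d, (((g x)⁻¹ c d : ℝ) : ℂ) • (covM w d (K b c) x
    - ∑ e, (((MetricField.Γ g e d b x : ℝ) : ℂ) • K e c x
      + ((MetricField.Γ g e d c x : ℝ) : ℂ) • K b e x))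

theorem divM_apply (g : MetricField) (w : Fin 4 → (Fin 4 → ℝ) → Matrix (Fin 6) (Fin 6) ℂ)
    (K : Fin 4 → Fin 4 → (Fin 4 → ℝ) → Matrix (Fin 6) (Fin 6) ℂ) (b : Fin 4) (x : Fin 4 → ℝ)
    (A B : Fin 6) : divM g w K b x A B =
      ∑ c, ∑ d, (((g x)⁻¹ c d : ℝ) : ℂ) * (covM w d (K b c) x
        - ∑ e, (((MetricField.Γ g e d b x : ℝ) : ℂ) • K e c x
        + ((MetricField.Γ g e d c x : ℝ) : ℂ) • K b e x)) A B := by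
  rw [divM, Matrix.sum_apply]
  refine Finset.sum_congr rfl fun c _ => ?_
  rw [Matrix.sum_apply]
  rfl

/-- The Bach tensor is the top row of the divergence of the curvature. -/
theorem IsConfGauge.cast_bach {U : Set (Fin 4 → ℝ)} {g : MetricField}
    {W : Fin 4 → (Fin 4 → ℝ) → Matrix (Fin 6) (Fin 6) ℂ}
    (hW : IsConfGauge U g W) {x : Fin 4 → ℝ} (hx : x ∈ U) (a b : Fin 4) :
    ((MetricField.bach g x a b : ℝ) : ℂ) = divM g W (curvM W) b x 0 (tIdx a) := by
  have hcot : ∀ a b c d : Fin 4, ((pd d (MetricField.cotton g a b c) x : ℝ) : ℂ) =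
      pdC d (fun y => curvM W b c y 0 (tIdx a)) x := fun a b c d =>
    cast_pd hW.isOpen hx (SmoothM.curvM hW.isOpen hW.smooth_W b c 0 (tIdx a))
      (fun y hy => hW.cast_cotton hy a b c) d
  -- In the top row, the Christoffel part of the divergence together with the middle block of the
  -- connection forms the Levi-Civita derivative of the Cotton tensor. The top row of the connection
  -- contributes an additional contraction with the Weyl block.
  have hcov : ∀ c d : Fin 4, (covM W d (curvM W b c) x
      - ∑ e, (((MetricField.Γ g e d b x : ℝ) : ℂ) • curvM W e c x
      + ((MetricField.Γ g e d c x : ℝ) : ℂ) • curvM W b e x)) 0 (tIdx a) =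
      ((MetricField.covCotton g d a b c x : ℝ) : ℂ)
        + ∑ e, W d x 0 (tIdx e) * curvM W b c x (tIdx e) (tIdx a) := by
    intro c d
    rw [MetricField.covCotton]
    push_cast
    rw [hcot]
    simp only [covM, pdM, Matrix.add_apply, Matrix.sub_apply, Matrix.of_apply, Matrix.mul_apply,
      sum_six, hW.W_zero_zero hx, hW.W_zero_five hx, hW.torsion x hx, hW.curv_zero_five hx,
      Matrix.sum_apply, Matrix.smul_apply, smul_eq_mul, hW.cast_Γ hx, hW.cast_cotton hx,
      Finset.sum_add_distrib]
    have : ∑ e, curvM W b c x 0 (tIdx e) * W d x (tIdx e) (tIdx a) =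
        ∑ e, W d x (tIdx e) (tIdx a) * curvM W b c x 0 (tIdx e) :=
      Finset.sum_congr rfl fun e _ => mul_comm _ _
    rw [this]
    ring
  have hbach : ((MetricField.bach g x a b : ℝ) : ℂ) =
      (∑ c, ∑ d, (((g x)⁻¹ c d : ℝ) : ℂ) * ((MetricField.covCotton g d a b c x : ℝ) : ℂ))
      - ∑ c, ∑ d, (∑ e, ∑ f, (((g x)⁻¹ c e : ℝ) : ℂ) * (((g x)⁻¹ d f : ℝ) : ℂ)
        * (-W e x 0 (tIdx f))) * ∑ h, (g x c h : ℂ) * curvM W b d x (tIdx h) (tIdx a) := by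
    rw [MetricField.bach, Matrix.of_apply]
    push_cast
    simp only [hW.cast_schouten hx, hW.cast_weyl hx]
  -- The contraction of Schouten with Weyl in the Bach tensor is that additional term: the inverse
  -- metric undoes the lowering of the first Weyl index, and the sign comes from the top row being
  -- minus Schouten.
  have hw : ∀ d, ∑ c, (∑ e, ∑ f, (((g x)⁻¹ c e : ℝ) : ℂ) * (((g x)⁻¹ d f : ℝ) : ℂ)
        * (-W e x 0 (tIdx f))) * ∑ h, (g x c h : ℂ) * curvM W b d x (tIdx h) (tIdx a) =
      -∑ f, (((g x)⁻¹ d f : ℝ) : ℂ) * ∑ e, W f x 0 (tIdx e) * curvM W b d x (tIdx e) (tIdx a) := by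
    intro d
    have h1 : ∀ e f h : Fin 4, ∑ c, (((g x)⁻¹ c e : ℝ) : ℂ) * (((g x)⁻¹ d f : ℝ) : ℂ)
        * (-W e x 0 (tIdx f)) * ((g x c h : ℂ) * curvM W b d x (tIdx h) (tIdx a)) =
        (if e = h then 1 else 0) * ((((g x)⁻¹ d f : ℝ) : ℂ)
        * (-W e x 0 (tIdx f)) * curvM W b d x (tIdx h) (tIdx a)) := by
      intro e f h
      rw [← hW.inv_mul' hx, Finset.sum_mul]
      exact Finset.sum_congr rfl fun c _ => by ring
    calc _ = ∑ c, ∑ e, ∑ f, ∑ h, (((g x)⁻¹ c e : ℝ) : ℂ) * (((g x)⁻¹ d f : ℝ) : ℂ)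
        * (-W e x 0 (tIdx f)) * ((g x c h : ℂ) * curvM W b d x (tIdx h) (tIdx a)) := by
          refine Finset.sum_congr rfl fun c _ => ?_
          rw [Finset.sum_mul]
          refine Finset.sum_congr rfl fun e _ => ?_
          rw [Finset.sum_mul]
          exact Finset.sum_congr rfl fun f _ => Finset.mul_sum _ _ _
      _ = ∑ e, ∑ f, ∑ h, ∑ c, (((g x)⁻¹ c e : ℝ) : ℂ) * (((g x)⁻¹ d f : ℝ) : ℂ)
        * (-W e x 0 (tIdx f)) * ((g x c h : ℂ) * curvM W b d x (tIdx h) (tIdx a)) := by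
          rw [Finset.sum_comm]
          refine Finset.sum_congr rfl fun e _ => ?_
          rw [Finset.sum_comm]
          exact Finset.sum_congr rfl fun f _ => Finset.sum_comm
      _ = ∑ e, ∑ f, (((g x)⁻¹ d f : ℝ) : ℂ)
        * (-W e x 0 (tIdx f)) * curvM W b d x (tIdx e) (tIdx a) := by
          simp only [h1]
          simp
      _ = _ := by
          rw [Finset.sum_comm, ← Finset.sum_neg_distrib]
          refine Finset.sum_congr rfl fun f _ => ?_
          rw [Finset.mul_sum, ← Finset.sum_neg_distrib]
          exact Finset.sum_congr rfl fun e _ => by rw [hW.W_zero_symm hx e f]; ring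
  rw [hbach, divM_apply]
  simp only [hcov]
  simp only [mul_add, Finset.sum_add_distrib]
  rw [sub_eq_add_neg]
  congr 1
  rw [Finset.sum_comm, Finset.sum_congr rfl fun d _ => hw d, Finset.sum_neg_distrib, neg_neg]

/-- Gauge covariance of the divergence. -/
theorem IsGauge.divM {U : Set (Fin 4 → ℝ)} (g : MetricField)
    {h : (Fin 4 → ℝ) → Matrix (Fin 6) (Fin 6) ℂ}
    {w W : Fin 4 → (Fin 4 → ℝ) → Matrix (Fin 6) (Fin 6) ℂ} (hg : IsGauge U h w W)
    {x : Fin 4 → ℝ} (hx : x ∈ U) (b : Fin 4) :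
    h x * CRFefferman.divM g W (CRFefferman.curvM W) b x =
      CRFefferman.divM g w (CRFefferman.curvM w) b x * h x := by
  -- The inverse metric and the Christoffel symbols enter as scalars and commute with `h`, so
  -- covariance of the curvature and of its covariant derivatives suffices.
  simp only [CRFefferman.divM, Finset.mul_sum, Finset.sum_mul, Matrix.mul_smul, Matrix.smul_mul,
    mul_sub, sub_mul, mul_add, add_mul, hg.curvM hx,
    hg.covM hx (SmoothM.curvM hg.isOpen hg.smooth_w _ _)
      (SmoothM.curvM hg.isOpen hg.smooth_W _ _) (fun y hy => hg.curvM hy _ _)]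

/-! ### The conformal connection along a section -/

/-- The components of the tetrad along `s`. -/
def CoframeData.tetradS (F : CoframeData) (s : (Fin 4 → ℝ) → Fin 8 → ℝ) (μ c : Fin 4)
    (y : Fin 4 → ℝ) : ℂ := pull s (F.tetrad μ) y (stdVec c)

/-- The connection `s^*ω̃`. -/
def CoframeData.connS (F : CoframeData) (s : (Fin 4 → ℝ) → Fin 8 → ℝ) (c : Fin 4)
    (y : Fin 4 → ℝ) : Matrix (Fin 6) (Fin 6) ℂ :=
  Matrix.of fun A B => pull s (F.confConn A B) y (stdVec c)

/-- `g = φ s^*G` is a Fefferman metric for the Cartan coframe `F`. -/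
structure IsFefferman {N : Set (Fin 3 → ℝ)} (cr : CRStructure N) (P : Set (Fin 8 → ℝ))
    (π : (Fin 8 → ℝ) → (Fin 3 → ℝ)) (F : CoframeData) (U : Set (Fin 4 → ℝ))
    (s : (Fin 4 → ℝ) → (Fin 8 → ℝ)) (φ : (Fin 4 → ℝ) → ℝ) (g : MetricField) : Prop where
  coframe : IsCartanCoframe cr P π F
  sect : IsLeafSection F P U s
  smooth : ContDiffOn ℝ ∞ φ U
  pos : ∀ x ∈ U, 0 < φ x
  metric : ∀ x ∈ U, ∀ a b : Fin 4, g x a b = φ x *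
      (F.G (s x) (fderiv ℝ s x (stdVec a)) (fderiv ℝ s x (stdVec b))).re

theorem CoframeData.G_eq (F : CoframeData) (p u v : Fin 8 → ℝ) :
    F.G p u v = ∑ μ, ∑ ν, gNull μ ν * F.tetrad μ p u * F.tetrad ν p v := by
  have e4' : F.th4 p = (1 / (3 * Complex.I)) • (F.Om2 p - F.Om2b p) := rfl
  simp [CoframeData.G, Fin.sum_univ_four, gNull, CoframeData.tetrad, e4']
  ring

theorem CoframeData.G_im (F : CoframeData) (p u v : Fin 8 → ℝ) : (F.G p u v).im = 0 := by
  rw [← Complex.conj_eq_iff_im]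
  simp [CoframeData.G, CoframeData.th2, CoframeData.th3, CoframeData.Om2b, Complex.conj_ofNat]
  ring

namespace IsCartanCoframe

variable {N : Set (Fin 3 → ℝ)} {cr : CRStructure N} {P : Set (Fin 8 → ℝ)}
  {π : (Fin 8 → ℝ) → (Fin 3 → ℝ)} {F : CoframeData} (hF : IsCartanCoframe cr P π F)
include hF

theorem th4_smooth : ContDiffOn ℝ ∞ F.th4 P :=
  (hF.Om2_smooth.sub hF.Om2b_smooth).const_smul (1 / (3 * Complex.I))

theorem tetrad_smooth (μ : Fin 4) : ContDiffOn ℝ ∞ (F.tetrad μ) P := by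
  fin_cases μ
  exacts [hF.th1_smooth, hF.th2_smooth, hF.cth3_smooth, hF.th4_smooth]

theorem confConn_smooth (A B : Fin 6) : ContDiffOn ℝ ∞ (F.confConn A B) P := by
  have h1 := hF.th1_smooth
  have h2 := hF.th2_smooth
  have h3 := hF.cth3_smooth
  have h4 := hF.th4_smooth
  have h5 := hF.Om2_smooth
  have h6 := hF.Om2b_smooth
  have h7 := hF.Om3_smooth
  have h8 := hF.Om3b_smooth
  have h9 := hF.cOm4_smooth
  have ha := (h5.add h6).const_smul (1 / 2 : ℂ)
  have hb := (h5.sub h6).const_smul (1 / 3 : ℂ)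
  have hd := (h5.sub h6).const_smul (Complex.I / 12)
  have k1 := h1.const_smul (Complex.I / 2)
  have k2 := h2.const_smul (Complex.I / 2)
  have k7 := h7.const_smul (Complex.I / 2)
  have k8 := h8.const_smul (Complex.I / 2)
  have h0 : ContDiffOn ℝ ∞ (0 : OneForm 8) P := contDiffOn_const
  fin_cases A <;> fin_cases B
  exacts [ha, k8, k7.neg, h9.neg, hd, h0, h1, hb.neg, h0, h7.neg, k1, k7.neg, h2, h0, hb, h8.neg,
    k2.neg, k8, h3, k2, k1.neg, ha.neg, h0, hd, h4, h8, h7, h0, ha, h9.neg, h0, h2, h1, h4, h3,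
    ha.neg]

end IsCartanCoframe

namespace IsFefferman

variable {N : Set (Fin 3 → ℝ)} {cr : CRStructure N} {P : Set (Fin 8 → ℝ)}
  {π : (Fin 8 → ℝ) → (Fin 3 → ℝ)} {F : CoframeData} {U : Set (Fin 4 → ℝ)}
  {s : (Fin 4 → ℝ) → (Fin 8 → ℝ)} {φ : (Fin 4 → ℝ) → ℝ} {g : MetricField}
  (H : IsFefferman cr P π F U s φ g)
include H

theorem isOpen : IsOpen U := H.sect.isOpen

theorem smooth_tetradS (μ c : Fin 4) : ContDiffOn ℝ ∞ (F.tetradS s μ c) U :=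
  (contDiffOn_pull H.isOpen H.sect.smooth (H.coframe.tetrad_smooth μ)
    H.sect.mapsTo).clm_apply contDiffOn_const

theorem smooth_connS (c : Fin 4) : SmoothM U (F.connS s c) := fun A B =>
  (contDiffOn_pull H.isOpen H.sect.smooth (H.coframe.confConn_smooth A B)
    H.sect.mapsTo).clm_apply contDiffOn_const

variable {x : Fin 4 → ℝ} (hx : x ∈ U)
include hx

/-- Pullback commutes with exterior derivatives and products, so the curvature of `s^*ω̃` is the
pullback of that of `ω̃`. -/
theorem curvM_connS (c d : Fin 4) (A B : Fin 6) : curvM (F.connS s) c d x A B =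
    F.confCurv A B (s x) ![fderiv ℝ s x (stdVec c), fderiv ℝ s x (stdVec d)] := by
  have hsx := H.sect.mapsTo hx
  have hsm : ContDiffAt ℝ ∞ s x := H.sect.smooth.contDiffAt (H.isOpen.mem_nhds hx)
  have hw := H.coframe.confConn_smooth A B
  have hw1 := H.coframe.differentiableAt_of hsx hw
  have hp := contDiffOn_pull H.isOpen H.sect.smooth hw H.sect.mapsTo
  have hp1 := differentiableAt_of_contDiffOn H.isOpen hx hp
  have e1 : ∀ c d : Fin 4, pdC c (fun y => F.connS s d y A B) x =
      fderiv ℝ (pull s (F.confConn A B)) x (stdVec c) (stdVec d) := by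
    intro c d
    have h := hp1.hasFDerivAt.clm_apply (hasFDerivAt_const (stdVec d : Fin 4 → ℝ) x)
    change fderiv ℝ (fun y => pull s (F.confConn A B) y (stdVec d)) x (stdVec c) = _
    rw [h.fderiv]
    simp
  have e2 := extD_apply hp1 ![stdVec c, stdVec d]
  have e3 : extD (pull s (F.confConn A B)) x ![stdVec c, stdVec d] =
      extD (F.confConn A B) (s x) ![fderiv ℝ s x (stdVec c), fderiv ℝ s x (stdVec d)] := by
    rw [extD_pull hw1 hsm]
    rw [ContinuousAlternatingMap.compContinuousLinearMap_apply]
    congr 1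
    ext i : 1
    fin_cases i <;> rfl
  rw [e3] at e2
  simp only [curvM, pdM, Matrix.add_apply, Matrix.sub_apply, Matrix.of_apply, Matrix.mul_apply,
    e1]
  rw [CoframeData.confCurv, curvature, ContinuousAlternatingMap.add_apply, e2,
    ContinuousAlternatingMap.sum_apply, add_sub_assoc, ← Finset.sum_sub_distrib]
  congr 1
  refine Finset.sum_congr rfl fun k _ => ?_
  rw [wedge₁_apply]
  rfl

theorem curvM_connS_eq (c d : Fin 4) : curvM (F.connS s) c d x =
    (F.tetradS s 0 c x * F.tetradS s 2 d x - F.tetradS s 2 c x * F.tetradS s 0 d x) • F.curv₁ (s x)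
    + (F.tetradS s 1 c x * F.tetradS s 2 d x - F.tetradS s 2 c x * F.tetradS s 1 d x)
      • F.curv₂ (s x) := by
  ext A B
  rw [H.curvM_connS hx, H.coframe.confCurv_eq (H.sect.mapsTo hx)]
  simp only [ContinuousAlternatingMap.add_apply, ContinuousAlternatingMap.smul_apply,
    wedge₁_apply, Matrix.add_apply, Matrix.smul_apply, smul_eq_mul]
  simp only [CoframeData.tetradS, pull, CoframeData.tetrad]
  simp
  ring

theorem cast_metric (a b : Fin 4) : (g x a b : ℂ) =
    (φ x : ℂ) * ∑ μ, ∑ ν, gNull μ ν * F.tetradS s μ a x * F.tetradS s ν b x := by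
  rw [H.metric x hx, Complex.ofReal_mul]
  congr 1
  have h := F.G_eq (s x) (fderiv ℝ s x (stdVec a)) (fderiv ℝ s x (stdVec b))
  have h1 := F.G_im (s x) (fderiv ℝ s x (stdVec a)) (fderiv ℝ s x (stdVec b))
  rw [show (((F.G (s x) (fderiv ℝ s x (stdVec a)) (fderiv ℝ s x (stdVec b))).re : ℝ) : ℂ) =
    F.G (s x) (fderiv ℝ s x (stdVec a)) (fderiv ℝ s x (stdVec b)) from
    Complex.ext (by simp) (by simp [h1]), h]
  rfl

end IsFefferman

/-! ### The gauge transformation adapted to the metric -/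

section FeffermanGauge

variable (F : CoframeData) (s : (Fin 4 → ℝ) → (Fin 8 → ℝ)) (φ : (Fin 4 → ℝ) → ℝ) (g : MetricField)

/-- The square root of the conformal factor. -/
def gaugeM (y : Fin 4 → ℝ) : ℂ := (Real.sqrt (φ y) : ℂ)

/-- The `1`-form part of the gauge transformation to the coordinate gauge. -/
def gaugeV (c : Fin 4) (y : Fin 4 → ℝ) : ℂ :=
  gaugeM φ y * F.connS s c y 0 0 + pdC c (gaugeM φ) y

/-- The vector part of the gauge transformation to the coordinate gauge. -/
def gaugeK (μ : Fin 4) (y : Fin 4 → ℝ) : ℂ :=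
  ∑ c, ∑ d, (((g y)⁻¹ c d : ℝ) : ℂ) * F.tetradS s μ c y * gaugeV F s φ d y

/-- The gauge transformation to the coordinate gauge. -/
def gaugeH (y : Fin 4 → ℝ) : Matrix (Fin 6) (Fin 6) ℂ :=
  Matrix.of (six (six (gaugeM φ y) (fun b => gaugeV F s φ b y)
      (gaugeM φ y * (1 / 2 * ∑ μ, ∑ ν, gNull μ ν * gaugeK F s φ g μ y * gaugeK F s φ g ν y)))
    (fun μ => six 0 (fun b => gaugeM φ y * F.tetradS s μ b y) (gaugeK F s φ g μ y))
    (six 0 0 (gaugeM φ y)⁻¹))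

/-- The conformal connection in the coordinate gauge. -/
def gaugeW (c : Fin 4) (y : Fin 4 → ℝ) : Matrix (Fin 6) (Fin 6) ℂ :=
  (gaugeH F s φ g y)⁻¹ *
    (F.connS s c y * gaugeH F s φ g y + pdM c (gaugeH F s φ g) y)

end FeffermanGauge

namespace IsFefferman

variable {N : Set (Fin 3 → ℝ)} {cr : CRStructure N} {P : Set (Fin 8 → ℝ)}
  {π : (Fin 8 → ℝ) → (Fin 3 → ℝ)} {F : CoframeData} {U : Set (Fin 4 → ℝ)}
  {s : (Fin 4 → ℝ) → (Fin 8 → ℝ)} {φ : (Fin 4 → ℝ) → ℝ} {g : MetricField}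
  (H : IsFefferman cr P π F U s φ g)
include H

theorem smooth_gaugeM : ContDiffOn ℝ ∞ (gaugeM φ) U :=
  Complex.ofRealCLM.contDiff.comp_contDiffOn (H.smooth.sqrt fun x hx => (H.pos x hx).ne')

theorem smooth_gaugeV (c : Fin 4) : ContDiffOn ℝ ∞ (gaugeV F s φ c) U :=
  (H.smooth_gaugeM.mul (H.smooth_connS c 0 0)).add (contDiffOn_pdC H.isOpen H.smooth_gaugeM c)

variable {x : Fin 4 → ℝ} (hx : x ∈ U)

include hx in
theorem gaugeM_ne : gaugeM φ x ≠ 0 :=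
  Complex.ofReal_ne_zero.2 (Real.sqrt_ne_zero'.2 (H.pos x hx))

include hx in
theorem gaugeM_sq : gaugeM φ x ^ 2 = (φ x : ℂ) := by
  rw [gaugeM, ← Complex.ofReal_pow, Real.sq_sqrt (H.pos x hx).le]

include hx in
theorem tetradS_det_ne : (Matrix.of fun μ k => F.tetradS s μ k x).det ≠ 0 :=
  H.sect.transversal x hx

include hx in
theorem metric_symm (a b : Fin 4) : g x a b = g x b a := by
  rw [H.metric x hx, H.metric x hx]
  congr 2
  simp only [CoframeData.G]
  ring

include hx in
theorem cast_metric_matrix : (g x).map (fun t : ℝ => (t : ℂ)) =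
    (φ x : ℂ) • ((Matrix.of fun μ k => F.tetradS s μ k x).transpose * gNull *
      (Matrix.of fun μ k => F.tetradS s μ k x)) := by
  ext a b
  rw [Matrix.map_apply, H.cast_metric hx, Matrix.smul_apply, smul_eq_mul]
  congr 1
  simp only [Matrix.mul_apply, Finset.sum_mul, Matrix.transpose_apply, Matrix.of_apply]
  rw [Finset.sum_comm]
  exact Finset.sum_congr rfl fun μ _ => Finset.sum_congr rfl fun ν _ => by ring

include hx in
theorem metric_det_ne : (g x).det ≠ 0 := by
  intro h0
  have h1 := congrArg (fun t : ℝ => (t : ℂ)) h0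
  have h2 := RingHom.map_det Complex.ofRealHom (g x)
  have h3 : Complex.ofRealHom.mapMatrix (g x) = (g x).map (fun t : ℝ => (t : ℂ)) := rfl
  rw [h3, H.cast_metric_matrix hx, Matrix.det_smul, Matrix.det_mul, Matrix.det_mul,
    Matrix.det_transpose] at h2
  have h4 : gNull.det = 1 := by
    simp [gNull, Matrix.det_succ_row_zero, Fin.sum_univ_succ, Fin.succAbove]
  rw [h4, h0, map_zero] at h2
  have h5 := H.tetradS_det_ne hx
  have h6 := (H.pos x hx).ne'
  have h7 : (φ x : ℂ) ≠ 0 := Complex.ofReal_ne_zero.2 h6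
  have h8 := mul_ne_zero (pow_ne_zero (Fintype.card (Fin 4)) h7)
    (mul_ne_zero (mul_ne_zero h5 one_ne_zero) h5)
  exact h8 h2.symm

theorem smooth_metric (a b : Fin 4) : ContDiffOn ℝ ∞ (fun y => (g y a b : ℂ)) U := by
  refine ContDiffOn.congr ?_ fun y hy => H.cast_metric hy a b
  exact (Complex.ofRealCLM.contDiff.comp_contDiffOn H.smooth).mul
    (ContDiffOn.sum fun μ _ => ContDiffOn.sum fun ν _ =>
      (contDiffOn_const.mul (H.smooth_tetradS μ a)).mul (H.smooth_tetradS ν b))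

theorem smooth_metric_inv (a b : Fin 4) :
    ContDiffOn ℝ ∞ (fun y => (((g y)⁻¹ a b : ℝ) : ℂ)) U := by
  have h1 : SmoothM U (fun y => (g y).map (fun t : ℝ => (t : ℂ))) := H.smooth_metric
  have hd : ∀ y, ((g y).map (fun t : ℝ => (t : ℂ))).det = ((g y).det : ℂ) := fun y =>
    (RingHom.map_det Complex.ofRealHom (g y)).symm
  refine (h1.inv (fun y hy => ?_) a b).congr fun y hy => ?_
  · rw [hd]
    exact Complex.ofReal_ne_zero.2 (H.metric_det_ne hy)
  · have h2 : (g y).map (fun t : ℝ => (t : ℂ)) * ((g y)⁻¹).map (fun t : ℝ => (t : ℂ)) = 1 := by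
      have h3 := Matrix.mul_nonsing_inv (g y) (H.metric_det_ne hy).isUnit
      have h4 := congrArg (Complex.ofRealHom.mapMatrix) h3
      rw [map_mul, map_one] at h4
      exact h4
    change _ = ((g y).map (fun t : ℝ => (t : ℂ)))⁻¹ a b
    rw [Matrix.inv_eq_right_inv h2]
    rfl

theorem smooth_gaugeK (μ : Fin 4) : ContDiffOn ℝ ∞ (gaugeK F s φ g μ) U :=
  ContDiffOn.sum fun c _ => ContDiffOn.sum fun d _ =>
    ((H.smooth_metric_inv c d).mul (H.smooth_tetradS μ c)).mul (H.smooth_gaugeV d)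

theorem smooth_gaugeH : SmoothM U (gaugeH F s φ g) := by
  have h0 : ContDiffOn ℝ ∞ (fun _ : Fin 4 → ℝ => (0 : ℂ)) U := contDiffOn_const
  have hk := H.smooth_gaugeK
  intro A B
  revert B
  revert A
  refine forall_six (forall_six ?_ (fun b => ?_) ?_)
    (fun μ => forall_six ?_ (fun b => ?_) ?_) (forall_six ?_ (fun b => ?_) ?_) <;>
    simp only [gaugeH, Matrix.of_apply, six_zero, six_tIdx, six_five, Pi.zero_apply]
  · exact H.smooth_gaugeM
  · exact H.smooth_gaugeV b
  · exact H.smooth_gaugeM.mul (contDiffOn_const.mul (ContDiffOn.sum fun μ _ =>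
      ContDiffOn.sum fun ν _ => (contDiffOn_const.mul (hk μ)).mul (hk ν)))
  · exact h0
  · exact H.smooth_gaugeM.mul (H.smooth_tetradS μ b)
  · exact hk μ
  · exact h0
  · exact h0
  · exact H.smooth_gaugeM.inv fun y hy => H.gaugeM_ne hy

-- The matrix is block upper triangular with diagonal blocks `m`, `m θ^μ_b` and `m⁻¹`, so a kernel
-- vector is eliminated from the last entry upwards.
include hx in
theorem gaugeH_mulVec_injective (u : Fin 6 → ℂ) (hu : (gaugeH F s φ g x).mulVec u = 0) : u = 0 := by
  have hm := H.gaugeM_ne hx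
  have h5 : u 5 = 0 := by
    have h := congrFun hu 5
    simp [Matrix.mulVec, dotProduct, gaugeH, sum_six] at h
    exact h.resolve_left hm
  have ht : (Matrix.of fun μ k => F.tetradS s μ k x).mulVec (fun b => u (tIdx b)) = 0 := by
    ext μ
    have h := congrFun hu (tIdx μ)
    simp [Matrix.mulVec, dotProduct, gaugeH, sum_six, h5, mul_assoc, ← Finset.mul_sum] at h
    simpa [Matrix.mulVec, dotProduct] using h.resolve_left hm
  have ht' := Matrix.eq_zero_of_mulVec_eq_zero (H.tetradS_det_ne hx) ht
  have h4 : ∀ b, u (tIdx b) = 0 := fun b => congrFun ht' b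
  have h0 : u 0 = 0 := by
    have h := congrFun hu 0
    simp [Matrix.mulVec, dotProduct, gaugeH, sum_six, h5, h4] at h
    exact h.resolve_left hm
  funext A
  exact forall_six (q := fun A => u A = 0) h0 h4 h5 A

include hx in
theorem gaugeH_det_ne : (gaugeH F s φ g x).det ≠ 0 := by
  intro h
  obtain ⟨u, hu, hu'⟩ := Matrix.exists_mulVec_eq_zero_iff.2 h
  exact hu (H.gaugeH_mulVec_injective hx u hu')

theorem isGauge : IsGauge U (gaugeH F s φ g) (F.connS s) (gaugeW F s φ g) where
  isOpen := H.isOpen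
  smooth_h := H.smooth_gaugeH
  smooth_w := H.smooth_connS
  smooth_W c := (H.smooth_gaugeH.inv fun y hy => H.gaugeH_det_ne hy).mul
    (((H.smooth_connS c).mul H.smooth_gaugeH).add (H.smooth_gaugeH.pdM H.isOpen c))
  gauge y hy c := Matrix.mul_nonsing_inv_cancel_left _ _ (H.gaugeH_det_ne hy).isUnit

include hx

theorem inv_metric_mul (a b : Fin 4) :
    ∑ e, (((g x)⁻¹ a e : ℝ) : ℂ) * (g x e b : ℂ) = if a = b then 1 else 0 := by
  have h := congrFun (congrFun (Matrix.nonsing_inv_mul (g x) (H.metric_det_ne hx).isUnit) a) b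
  rw [Matrix.mul_apply, Matrix.one_apply] at h
  have h1 := congrArg (fun t : ℝ => (t : ℂ)) h
  simpa [apply_ite] using h1

theorem metric_mul_inv (a b : Fin 4) :
    ∑ e, (g x a e : ℂ) * (((g x)⁻¹ e b : ℝ) : ℂ) = if a = b then 1 else 0 := by
  have h := congrFun (congrFun (Matrix.mul_nonsing_inv (g x) (H.metric_det_ne hx).isUnit) a) b
  rw [Matrix.mul_apply, Matrix.one_apply] at h
  have h1 := congrArg (fun t : ℝ => (t : ℂ)) h
  simpa [apply_ite] using h1

/-- This is the orthogonality of the middle columns of `gaugeH` to its last column, and it is the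
equation that dictates `gaugeK`. -/
theorem tetrad_gaugeK (a : Fin 4) : ∑ μ, ∑ ν, gNull μ ν * (gaugeM φ x * F.tetradS s μ a x) *
    gaugeK F s φ g ν x = (gaugeM φ x)⁻¹ * gaugeV F s φ a x := by
  have hm := H.gaugeM_ne hx
  have e1 : ∀ c, ∑ μ, ∑ ν, gNull μ ν * F.tetradS s μ a x * F.tetradS s ν c x =
      (gaugeM φ x)⁻¹ ^ 2 * (g x a c : ℂ) := by
    intro c
    rw [H.cast_metric hx, ← H.gaugeM_sq hx]
    field_simp
  have e2 : ∑ μ, ∑ ν, gNull μ ν * (gaugeM φ x * F.tetradS s μ a x) *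
    gaugeK F s φ g ν x = gaugeM φ x * ∑ c, ∑ d,
      (∑ μ, ∑ ν, gNull μ ν * F.tetradS s μ a x * F.tetradS s ν c x) *
        ((((g x)⁻¹ c d : ℝ) : ℂ) * gaugeV F s φ d x) := by
    simp only [gaugeK, Fin.sum_univ_four]
    ring
  have e3 : ∑ c, ∑ d, (gaugeM φ x)⁻¹ ^ 2 * (g x a c : ℂ) *
      ((((g x)⁻¹ c d : ℝ) : ℂ) * gaugeV F s φ d x) =
      (gaugeM φ x)⁻¹ ^ 2 * gaugeV F s φ a x := by
    rw [Finset.sum_comm]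
    have e4 : ∀ d, ∑ c, (gaugeM φ x)⁻¹ ^ 2 * (g x a c : ℂ) *
      ((((g x)⁻¹ c d : ℝ) : ℂ) * gaugeV F s φ d x) =
      (if a = d then 1 else 0) * ((gaugeM φ x)⁻¹ ^ 2 * gaugeV F s φ d x) := by
      intro d
      rw [← H.metric_mul_inv hx, Finset.sum_mul]
      exact Finset.sum_congr rfl fun c _ => by ring
    rw [Finset.sum_congr rfl fun d _ => e4 d]
    simp
  rw [e2]
  simp only [e1]
  rw [e3]
  field_simp

/-- The columns of `gaugeH` form a frame with Gram matrix `formG`. The middle block gives `g`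
because `m² = φ`, the vector `k` makes the last column orthogonal to the middle ones, and the corner
entry `½ m |k|²` makes the last column null. -/
theorem gaugeH_form : (gaugeH F s φ g x).transpose * formSO * gaugeH F s φ g x = formG g x := by
  have hm := H.gaugeM_ne hx
  -- The invariant form is put in the block shape `1 + 4 + 1`, with the null tetrad metric in the
  -- middle.
  have hJ : formSO = Matrix.of (six (six 0 0 (-1)) (fun a => six 0 (fun b => gNull a b) 0)
      (six (-1) 0 0)) := by
    ext A B
    revert B
    revert A
    refine forall_six (forall_six ?_ (fun b => ?_) ?_)
      (fun μ => forall_six ?_ (fun b => ?_) ?_) (forall_six ?_ (fun b => ?_) ?_) <;>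
    simp only [Matrix.of_apply, six_zero, six_tIdx, six_five, Pi.zero_apply]
    · rfl
    · fin_cases b <;> rfl
    · rfl
    · fin_cases μ <;> rfl
    · fin_cases μ <;> fin_cases b <;> rfl
    · fin_cases μ <;> rfl
    · rfl
    · fin_cases b <;> rfl
    · rfl
  have key : ∀ A B, ((gaugeH F s φ g x).transpose * formSO * gaugeH F s φ g x) A B =
      (∑ μ, ∑ ν, gNull μ ν * gaugeH F s φ g x (tIdx μ) A * gaugeH F s φ g x (tIdx ν) B)
      - gaugeH F s φ g x 0 A * gaugeH F s φ g x 5 B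
      - gaugeH F s φ g x 5 A * gaugeH F s φ g x 0 B := by
    intro A B
    rw [hJ]
    simp only [Matrix.mul_apply, sum_six, Matrix.transpose_apply, Matrix.of_apply, six_zero,
      six_tIdx, six_five, Pi.zero_apply, mul_zero, zero_add, add_zero, Finset.sum_const_zero,
      Finset.sum_mul]
    rw [Finset.sum_comm]
    have : ∀ μ ν : Fin 4, gaugeH F s φ g x (tIdx μ) A * gNull μ ν * gaugeH F s φ g x (tIdx ν) B =
      gNull μ ν * gaugeH F s φ g x (tIdx μ) A * gaugeH F s φ g x (tIdx ν) B := fun μ ν => by ring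
    simp only [this]
    ring
  have hsym : ∀ μ ν, gNull μ ν = gNull ν μ := by
    intro μ ν
    fin_cases μ <;> fin_cases ν <;> rfl
  have hk := H.tetrad_gaugeK hx
  have hk' : ∀ b, ∑ μ, ∑ ν, gNull μ ν * gaugeK F s φ g μ x * (gaugeM φ x * F.tetradS s ν b x) =
      (gaugeM φ x)⁻¹ * gaugeV F s φ b x := by
    intro b
    rw [← hk b, Finset.sum_comm]
    refine Finset.sum_congr rfl fun μ _ => Finset.sum_congr rfl fun ν _ => ?_
    rw [hsym ν μ]
    ring
  ext A B
  rw [key]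
  revert B
  revert A
  refine forall_six (forall_six ?_ (fun b => ?_) ?_)
    (fun μ => forall_six ?_ (fun b => ?_) ?_) (forall_six ?_ (fun b => ?_) ?_) <;>
    simp only [gaugeH, formG, Matrix.of_apply, six_zero, six_tIdx, six_five, Pi.zero_apply,
      mul_zero, zero_mul, Finset.sum_const_zero, sub_zero, zero_sub, hk, hk']
  · field_simp
  · rw [H.cast_metric hx, ← H.gaugeM_sq hx, Finset.mul_sum]
    refine Finset.sum_congr rfl fun μ _ => ?_
    rw [Finset.mul_sum]
    exact Finset.sum_congr rfl fun ν _ => by ring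
  · ring
  · field_simp
  · ring
  · field_simp
    ring

end IsFefferman

/-! ### The transformed connection as the normal conformal connection of the metric -/

namespace IsFefferman

variable {N : Set (Fin 3 → ℝ)} {cr : CRStructure N} {P : Set (Fin 8 → ℝ)}
  {π : (Fin 8 → ℝ) → (Fin 3 → ℝ)} {F : CoframeData} {U : Set (Fin 4 → ℝ)}
  {s : (Fin 4 → ℝ) → (Fin 8 → ℝ)} {φ : (Fin 4 → ℝ) → ℝ} {g : MetricField}
  (H : IsFefferman cr P π F U s φ g) {x : Fin 4 → ℝ} (hx : x ∈ U)

theorem connS_tIdx_zero (c μ : Fin 4) : F.connS s c x (tIdx μ) 0 = F.tetradS s μ c x := by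
  fin_cases μ <;> rfl

theorem connS_five_zero (c : Fin 4) : F.connS s c x 5 0 = 0 := rfl

theorem connS_so (c : Fin 4) :
    (F.connS s c x).transpose * formSO + formSO * F.connS s c x = 0 := by
  ext A B
  have h := congrArg (fun α : Cov 8 => α (fderiv ℝ s x (stdVec c)))
    (IsCartanCoframe.so_valued (F := F) (p := s x) A B)
  have hsym : ∀ C D : Fin 6, formSO C D = formSO D C := by
    intro C D
    fin_cases C <;> fin_cases D <;> rfl
  rw [Matrix.add_apply, Matrix.mul_apply, Matrix.mul_apply, ← Finset.sum_add_distrib,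
    Matrix.zero_apply]
  rw [_root_.sum_apply] at h
  refine Eq.trans (Finset.sum_congr rfl fun C _ => ?_) h
  rw [hsym C B, Matrix.transpose_apply, add_comm, mul_comm (F.connS s c x C A)]
  rfl

include H hx

theorem gaugeH_mul_cancel {l : Type*} {K L : Matrix (Fin 6) l ℂ}
    (h : gaugeH F s φ g x * K = gaugeH F s φ g x * L) : K = L := by
  rw [← Matrix.nonsing_inv_mul_cancel_left _ K (H.gaugeH_det_ne hx).isUnit, h,
    Matrix.nonsing_inv_mul_cancel_left _ L (H.gaugeH_det_ne hx).isUnit]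

/-- The first column of `h` is `m` times the first basis vector, so the first column of `w h + dh`
is `(m w₀₀ + dm, m θ^μ, 0)`. By the choice of `gaugeV` this is the column of `h` with index `tIdx
c`, and `h` is injective. -/
theorem gaugeW_col (c : Fin 4) (A : Fin 6) :
    gaugeW F s φ g c x A 0 = if A = tIdx c then 1 else 0 := by
  have h := H.isGauge.gauge x hx c
  have key : gaugeH F s φ g x * (Matrix.of fun A (_ : Fin 1) => gaugeW F s φ g c x A 0) =
      gaugeH F s φ g x * (Matrix.of fun A (_ : Fin 1) => if A = tIdx c then (1 : ℂ) else 0) := by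
    ext A j
    have h1 := congrFun (congrFun h A) 0
    rw [Matrix.mul_apply] at h1 ⊢
    rw [Matrix.mul_apply]
    simp only [Matrix.of_apply]
    rw [h1]
    have e0 : ∀ y B, gaugeH F s φ g y B 0 = if B = 0 then gaugeM φ y else 0 := by
      intro y B
      refine forall_six (q := fun B => gaugeH F s φ g y B 0 = if B = 0 then gaugeM φ y else 0)
        ?_ ?_ ?_ B <;> simp [gaugeH]
    simp only [Matrix.add_apply, Matrix.mul_apply, pdM, Matrix.of_apply, e0]
    refine forall_six (q := fun A => ∑ k, F.connS s c x A k * (if k = 0 then gaugeM φ x else 0)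
      + pdC c (fun y => if A = 0 then gaugeM φ y else 0) x =
      ∑ k, gaugeH F s φ g x A k * (if k = tIdx c then 1 else 0)) ?_ (fun μ => ?_) ?_ A
    · simp [gaugeH, gaugeV]
      ring
    · simp [gaugeH, connS_tIdx_zero, pdC]
      ring
    · simp [gaugeH, connS_five_zero, pdC]
  have h2 := H.gaugeH_mul_cancel hx key
  exact congrFun (congrFun h2 A) 0

/-- The identity `hᵀ J h = formG` is differentiated with `dh = h W - w h`. The terms with `w` cancel
because `w` takes values in the Lie algebra of `J`. -/
theorem gaugeW_metric (c : Fin 4) : pdM c (formG g) x =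
    (gaugeW F s φ g c x).transpose * formG g x + formG g x * gaugeW F s φ g c x := by
  have hU := H.isOpen
  have hh := H.smooth_gaugeH
  have hJ : SmoothM U (fun _ : Fin 4 → ℝ => formSO) := fun _ _ => contDiffOn_const
  have hJ0 : pdM c (fun _ : Fin 4 → ℝ => formSO) x = 0 := by
    ext i j
    simp [pdM, pdC]
  have ht : pdM c (fun y => (gaugeH F s φ g y).transpose) x =
      (pdM c (gaugeH F s φ g) x).transpose := rfl
  rw [pdM_congr hU hx (K := fun y => (gaugeH F s φ g y).transpose * formSO * gaugeH F s φ g y)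
    (fun y hy => (H.gaugeH_form hy).symm), pdM_mul hU hx (hh.transpose.mul hJ) hh,
    pdM_mul hU hx hh.transpose hJ, hJ0, ht, ← H.gaugeH_form hx]
  have hd : pdM c (gaugeH F s φ g) x = gaugeH F s φ g x * gaugeW F s φ g c x
      - F.connS s c x * gaugeH F s φ g x := by
    rw [H.isGauge.gauge x hx c]
    abel
  rw [hd, Matrix.transpose_sub, Matrix.transpose_mul, Matrix.transpose_mul]
  have h0 := connS_so (F := F) (s := s) (x := x) c
  have h1 : formSO * F.connS s c x = -((F.connS s c x).transpose * formSO) :=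
    eq_neg_of_add_eq_zero_right h0
  have e1 : (gaugeH F s φ g x).transpose * formSO * (gaugeH F s φ g x * gaugeW F s φ g c x
      - F.connS s c x * gaugeH F s φ g x) = (gaugeH F s φ g x).transpose * formSO *
      gaugeH F s φ g x * gaugeW F s φ g c x - (gaugeH F s φ g x).transpose *
      (formSO * F.connS s c x) * gaugeH F s φ g x := by noncomm_ring
  rw [e1, h1]
  noncomm_ring

theorem curv_gauge (c d : Fin 4) : gaugeH F s φ g x * curvM (gaugeW F s φ g) c d x =
    curvM (F.connS s) c d x * gaugeH F s φ g x := H.isGauge.curvM hx c d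

omit H hx in
theorem curv₁_zero (A : Fin 6) : F.curv₁ (s x) A 0 = 0 := by
  fin_cases A <;> simp [CoframeData.curv₁, matN₁, matM]

omit H hx in
theorem curv₂_zero (A : Fin 6) : F.curv₂ (s x) A 0 = 0 := by
  fin_cases A <;> simp [CoframeData.curv₂, matN₂, matM]

omit H hx in
theorem curv₁_five (A : Fin 6) : F.curv₁ (s x) 5 A = 0 := by
  fin_cases A <;> simp [CoframeData.curv₁, matN₁, matM]

omit H hx in
theorem curv₂_five (A : Fin 6) : F.curv₂ (s x) 5 A = 0 := by
  fin_cases A <;> simp [CoframeData.curv₂, matN₂, matM]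

theorem curvM_connS_zero (c d : Fin 4) (A : Fin 6) : curvM (F.connS s) c d x A 0 = 0 := by
  rw [H.curvM_connS_eq hx]
  simp [curv₁_zero, curv₂_zero]

theorem curvM_connS_five (c d : Fin 4) (A : Fin 6) : curvM (F.connS s) c d x 5 A = 0 := by
  rw [H.curvM_connS_eq hx]
  simp [curv₁_five, curv₂_five]

theorem gaugeW_torsion (c d : Fin 4) (A : Fin 6) : curvM (gaugeW F s φ g) c d x A 0 = 0 := by
  have key : gaugeH F s φ g x * (Matrix.of fun A (_ : Fin 1) =>
      curvM (gaugeW F s φ g) c d x A 0) = gaugeH F s φ g x *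
      (0 : Matrix (Fin 6) (Fin 1) ℂ) := by
    ext A j
    have h1 := congrFun (congrFun (H.curv_gauge hx c d) A) 0
    rw [Matrix.mul_apply, Matrix.mul_apply] at h1
    rw [Matrix.mul_apply]
    simp only [Matrix.of_apply]
    rw [h1, sum_six, H.curvM_connS_zero hx, Matrix.mul_zero]
    simp [gaugeH]
  exact congrFun (congrFun (H.gaugeH_mul_cancel hx key) A) 0

theorem curv_five (c d : Fin 4) (A : Fin 6) : curvM (gaugeW F s φ g) c d x 5 A = 0 := by
  have h1 := congrFun (congrFun (H.curv_gauge hx c d) 5) A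
  rw [Matrix.mul_apply, Matrix.mul_apply] at h1
  simp only [H.curvM_connS_five hx] at h1
  simp [gaugeH, sum_six] at h1
  exact h1.resolve_left (H.gaugeM_ne hx)

theorem curv_mid (c d μ b : Fin 4) :
    ∑ a, F.tetradS s μ a x * curvM (gaugeW F s φ g) c d x (tIdx a) (tIdx b) =
    ∑ ν, curvM (F.connS s) c d x (tIdx μ) (tIdx ν) * F.tetradS s ν b x := by
  have h1 := congrFun (congrFun (H.curv_gauge hx c d) (tIdx μ)) (tIdx b)
  rw [Matrix.mul_apply, Matrix.mul_apply, sum_six, sum_six, H.curvM_connS_zero hx,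
    H.curv_five hx] at h1
  simp [gaugeH] at h1
  refine mul_left_cancel₀ (H.gaugeM_ne hx) ?_
  rw [Finset.mul_sum, Finset.mul_sum]
  convert h1 using 1
  · exact Finset.sum_congr rfl fun _ _ => by ring
  · exact Finset.sum_congr rfl fun _ _ => by ring

/-- By `curv_mid` the middle block of the curvature is conjugated by the tetrad matrix. The trace
over a form index and an endomorphism index can thus be taken in the tetrad, where the explicit
coefficient matrices make it vanish. -/
theorem gaugeW_trace (d b : Fin 4) :
    ∑ a, curvM (gaugeW F s φ g) a d x (tIdx a) (tIdx b) = 0 := by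
  set T : Matrix (Fin 4) (Fin 4) ℂ := Matrix.of fun μ k => F.tetradS s μ k x with hT
  have hTd : IsUnit T.det := (H.tetradS_det_ne hx).isUnit
  have h1 : ∀ c a, curvM (gaugeW F s φ g) c d x (tIdx a) (tIdx b) =
      ∑ μ, T⁻¹ a μ * ∑ ν, curvM (F.connS s) c d x (tIdx μ) (tIdx ν) * F.tetradS s ν b x := by
    intro c a
    have h2 : T.mulVec (fun a => curvM (gaugeW F s φ g) c d x (tIdx a) (tIdx b)) =
        fun μ => ∑ ν, curvM (F.connS s) c d x (tIdx μ) (tIdx ν) * F.tetradS s ν b x := by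
      ext μ
      exact H.curv_mid hx c d μ b
    have h3 := congrArg (fun v => T⁻¹.mulVec v) h2
    simp only [Matrix.mulVec_mulVec, Matrix.nonsing_inv_mul T hTd, Matrix.one_mulVec] at h3
    exact congrFun h3 a
  have hE : ∀ μ ν, ∑ a, T⁻¹ a μ * F.tetradS s ν a x = if ν = μ then 1 else 0 := by
    intro μ ν
    have h2 := congrFun (congrFun (Matrix.mul_nonsing_inv T hTd) ν) μ
    rw [Matrix.mul_apply, Matrix.one_apply] at h2
    rw [← h2]
    exact Finset.sum_congr rfl fun a _ => mul_comm _ _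
  have h4 : ∀ a μ ν, T⁻¹ a μ * (curvM (F.connS s) a d x (tIdx μ) (tIdx ν) * F.tetradS s ν b x) =
      (T⁻¹ a μ * F.tetradS s 0 a x) * (F.tetradS s 2 d x * F.curv₁ (s x) (tIdx μ) (tIdx ν)
        * F.tetradS s ν b x) +
      (T⁻¹ a μ * F.tetradS s 1 a x) * (F.tetradS s 2 d x * F.curv₂ (s x) (tIdx μ) (tIdx ν)
        * F.tetradS s ν b x) -
      (T⁻¹ a μ * F.tetradS s 2 a x) * ((F.tetradS s 0 d x * F.curv₁ (s x) (tIdx μ) (tIdx ν)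
        + F.tetradS s 1 d x * F.curv₂ (s x) (tIdx μ) (tIdx ν)) * F.tetradS s ν b x) := by
    intro a μ ν
    rw [H.curvM_connS_eq hx]
    simp only [Matrix.add_apply, Matrix.smul_apply, smul_eq_mul]
    ring
  simp only [h1, Finset.mul_sum, h4]
  rw [Finset.sum_comm]
  have h5 : ∀ μ, ∑ a, ∑ ν, ((T⁻¹ a μ * F.tetradS s 0 a x) * (F.tetradS s 2 d x *
        F.curv₁ (s x) (tIdx μ) (tIdx ν) * F.tetradS s ν b x) +
      (T⁻¹ a μ * F.tetradS s 1 a x) * (F.tetradS s 2 d x * F.curv₂ (s x) (tIdx μ) (tIdx ν)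
        * F.tetradS s ν b x) -
      (T⁻¹ a μ * F.tetradS s 2 a x) * ((F.tetradS s 0 d x * F.curv₁ (s x) (tIdx μ) (tIdx ν)
        + F.tetradS s 1 d x * F.curv₂ (s x) (tIdx μ) (tIdx ν)) * F.tetradS s ν b x)) =
      ∑ ν, ((if 0 = μ then 1 else 0) * (F.tetradS s 2 d x *
        F.curv₁ (s x) (tIdx μ) (tIdx ν) * F.tetradS s ν b x) +
      (if 1 = μ then 1 else 0) * (F.tetradS s 2 d x * F.curv₂ (s x) (tIdx μ) (tIdx ν)
        * F.tetradS s ν b x) -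
      (if 2 = μ then 1 else 0) * ((F.tetradS s 0 d x * F.curv₁ (s x) (tIdx μ) (tIdx ν)
        + F.tetradS s 1 d x * F.curv₂ (s x) (tIdx μ) (tIdx ν)) * F.tetradS s ν b x)) := by
    intro μ
    rw [Finset.sum_comm]
    refine Finset.sum_congr rfl fun ν _ => ?_
    rw [Finset.sum_sub_distrib, Finset.sum_add_distrib, ← Finset.sum_mul, ← Finset.sum_mul,
      ← Finset.sum_mul, hE, hE, hE]
  rw [Finset.sum_congr rfl fun μ _ => h5 μ]
  simp [Fin.sum_univ_four, CoframeData.curv₁, CoframeData.curv₂, matN₁, matN₂, matM, tIdx]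

omit hx in
theorem isConfGauge : IsConfGauge U g (gaugeW F s φ g) where
  isOpen := H.isOpen
  smooth_g := H.smooth_metric
  smooth_W := H.isGauge.smooth_W
  symm y hy := H.metric_symm hy
  det_ne y hy := H.metric_det_ne hy
  col y hy := H.gaugeW_col hy
  metric y hy := H.gaugeW_metric hy
  torsion y hy := H.gaugeW_torsion hy
  trace y hy := H.gaugeW_trace hy

end IsFefferman

/-! ### The divergence of the curvature along a section -/

namespace IsFefferman

variable {N : Set (Fin 3 → ℝ)} {cr : CRStructure N} {P : Set (Fin 8 → ℝ)}
  {π : (Fin 8 → ℝ) → (Fin 3 → ℝ)} {F : CoframeData} {U : Set (Fin 4 → ℝ)}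
  {s : (Fin 4 → ℝ) → (Fin 8 → ℝ)} {φ : (Fin 4 → ℝ) → ℝ} {g : MetricField}
  (H : IsFefferman cr P π F U s φ g) {x : Fin 4 → ℝ} (hx : x ∈ U)
include H hx

theorem inv_metric_tetrad (σ ρ : Fin 4) :
    ∑ c, ∑ d, (((g x)⁻¹ c d : ℝ) : ℂ) * (F.tetradS s σ c x * F.tetradS s ρ d x) =
      gNull σ ρ * (φ x : ℂ)⁻¹ := by
  set T : Matrix (Fin 4) (Fin 4) ℂ := Matrix.of fun μ k => F.tetradS s μ k x with hT
  set K : Matrix (Fin 4) (Fin 4) ℂ := ((g x)⁻¹).map (fun t : ℝ => (t : ℂ)) with hK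
  have hφ : (φ x : ℂ) ≠ 0 := Complex.ofReal_ne_zero.2 (H.pos x hx).ne'
  have h1 : K * (g x).map (fun t : ℝ => (t : ℂ)) = 1 := by
    have h3 := Matrix.nonsing_inv_mul (g x) (H.metric_det_ne hx).isUnit
    have h4 := congrArg (Complex.ofRealHom.mapMatrix) h3
    rw [map_mul, map_one] at h4
    exact h4
  have hN : gNull * gNull = 1 := by
    ext i j
    fin_cases i <;> fin_cases j <;> simp [gNull, Matrix.mul_apply, Fin.sum_univ_four]
  rw [H.cast_metric_matrix hx, Matrix.mul_smul, ← Matrix.smul_mul, ← Matrix.mul_assoc,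
    mul_eq_one_comm] at h1
  have h2 := congrArg (fun L => L * gNull) h1
  simp only [Matrix.one_mul, Matrix.mul_assoc, hN, Matrix.mul_one, Matrix.smul_mul,
    Matrix.mul_smul] at h2
  have h3 := congrFun (congrFun h2 σ) ρ
  rw [Matrix.smul_apply, smul_eq_mul] at h3
  rw [← h3, mul_comm, ← mul_assoc, inv_mul_cancel₀ hφ, one_mul]
  simp only [Matrix.mul_apply, Matrix.transpose_apply, hK, Matrix.of_apply, Matrix.map_apply,
    Finset.mul_sum]
  exact Finset.sum_congr rfl fun c _ => Finset.sum_congr rfl fun d _ => by ring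

/-- The trace of a bilinear form given by its components in the tetrad. -/
theorem trace_tetrad (C : Fin 4 → Fin 4 → ℂ) :
    ∑ c, ∑ d, (((g x)⁻¹ c d : ℝ) : ℂ) *
      ∑ σ, ∑ ρ, C σ ρ * (F.tetradS s σ c x * F.tetradS s ρ d x) =
      (C 0 1 + C 1 0 + C 2 3 + C 3 2) * (φ x : ℂ)⁻¹ := by
  have h1 : ∑ c, ∑ d, (((g x)⁻¹ c d : ℝ) : ℂ) *
      ∑ σ, ∑ ρ, C σ ρ * (F.tetradS s σ c x * F.tetradS s ρ d x) =
      ∑ σ, ∑ ρ, C σ ρ * ∑ c, ∑ d, (((g x)⁻¹ c d : ℝ) : ℂ) *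
        (F.tetradS s σ c x * F.tetradS s ρ d x) := by
    simp only [Fin.sum_univ_four]
    ring
  rw [h1]
  simp only [H.inv_metric_tetrad hx]
  simp [Fin.sum_univ_four, gNull]
  ring

theorem exists_expansion (f : Fin 4 → ℂ) : ∃ V : Fin 4 → ℂ,
    ∀ b, f b = ∑ ρ, V ρ * F.tetradS s ρ b x := by
  set T : Matrix (Fin 4) (Fin 4) ℂ := Matrix.of fun μ k => F.tetradS s μ k x with hT
  have hTd : IsUnit T.det := (H.tetradS_det_ne hx).isUnit
  refine ⟨Matrix.vecMul f T⁻¹, fun b => ?_⟩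
  have h : Matrix.vecMul (Matrix.vecMul f T⁻¹) T = f := by
    rw [Matrix.vecMul_vecMul, Matrix.nonsing_inv_mul T hTd, Matrix.vecMul_one]
  exact (congrFun h b).symm

/-- The Levi-Civita derivative of the tetrad. -/
theorem covDeriv_tetradS (μ b d : Fin 4) :
    pdC d (F.tetradS s μ b) x
      - ∑ e, ((MetricField.Γ g e d b x : ℝ) : ℂ) * F.tetradS s μ e x =
    (gaugeM φ x)⁻¹ * gaugeK F s φ g μ x * (g x d b : ℂ)
      - (gaugeM φ x)⁻¹ * F.tetradS s μ d x * gaugeV F s φ b x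
      - ∑ ν, F.connS s d x (tIdx μ) (tIdx ν) * F.tetradS s ν b x
      - ((gaugeM φ x)⁻¹ * gaugeV F s φ d x - F.connS s d x 0 0) * F.tetradS s μ b x := by
  have hm := H.gaugeM_ne hx
  have hW := H.isConfGauge
  -- The middle block of the gauge equation relates the derivative of `m θ^μ_b` to the middle blocks
  -- of both connections, and that of the transformed one consists of Christoffel symbols.
  have h := congrFun (congrFun (H.isGauge.gauge x hx d) (tIdx μ)) (tIdx b)
  rw [Matrix.add_apply, Matrix.mul_apply, Matrix.mul_apply, sum_six, sum_six,
    hW.W_five_tIdx hx] at h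
  have hp : pdM d (gaugeH F s φ g) x (tIdx μ) (tIdx b) =
      gaugeM φ x * pdC d (F.tetradS s μ b) x + F.tetradS s μ b x * pdC d (gaugeM φ) x := by
    have h1 := (differentiableAt_of_contDiffOn H.isOpen hx H.smooth_gaugeM).hasFDerivAt.fun_mul
      (differentiableAt_of_contDiffOn H.isOpen hx (H.smooth_tetradS μ b)).hasFDerivAt
    have h2 : (fun y => gaugeH F s φ g y (tIdx μ) (tIdx b)) =
        fun y => gaugeM φ y * F.tetradS s μ b y := by
      ext y
      simp [gaugeH]
    simp only [pdM, Matrix.of_apply, pdC, h2]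
    rw [h1.fderiv]
    rfl
  rw [hp] at h
  simp only [← hW.cast_Γ hx] at h
  simp [gaugeH, connS_tIdx_zero] at h
  have hv : pdC d (gaugeM φ) x = gaugeV F s φ d x - gaugeM φ x * F.connS s d x 0 0 := by
    rw [gaugeV]; ring
  rw [hv] at h
  have e1 : ∑ e, gaugeM φ x * F.tetradS s μ e x * ((MetricField.Γ g e d b x : ℝ) : ℂ) =
      gaugeM φ x * ∑ e, ((MetricField.Γ g e d b x : ℝ) : ℂ) * F.tetradS s μ e x := by
    rw [Finset.mul_sum]
    exact Finset.sum_congr rfl fun _ _ => by ring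
  have e2 : ∑ ν, F.connS s d x (tIdx μ) (tIdx ν) * (gaugeM φ x * F.tetradS s ν b x) =
      gaugeM φ x * ∑ ν, F.connS s d x (tIdx μ) (tIdx ν) * F.tetradS s ν b x := by
    rw [Finset.mul_sum]
    exact Finset.sum_congr rfl fun _ _ => by ring
  rw [e1, e2] at h
  generalize (∑ e, ((MetricField.Γ g e d b x : ℝ) : ℂ) * F.tetradS s μ e x) = G1 at *
  generalize (∑ ν, F.connS s d x (tIdx μ) (tIdx ν) * F.tetradS s ν b x) = G2 at *
  field_simp
  linear_combination -h

/-- The covariant derivative of the curvature, corrected by the Levi-Civita connection. -/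
theorem covM_curvM_connS (b c d : Fin 4) (A B : Fin 6) {D₁ D₂ : ℂ}
    {T : Fin 4 → Fin 4 → Fin 4 → ℂ}
    (h₁ : fderiv ℝ (fun q => F.curv₁ q A B) (s x) (fderiv ℝ s x (stdVec d)) +
      ∑ k, (F.connS s d x A k * F.curv₁ (s x) k B - F.curv₁ (s x) A k * F.connS s d x k B) = D₁)
    (h₂ : fderiv ℝ (fun q => F.curv₂ q A B) (s x) (fderiv ℝ s x (stdVec d)) +
      ∑ k, (F.connS s d x A k * F.curv₂ (s x) k B - F.curv₂ (s x) A k * F.connS s d x k B) = D₂)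
    (hT : ∀ μ b d, pdC d (F.tetradS s μ b) x
      - ∑ e, ((MetricField.Γ g e d b x : ℝ) : ℂ) * F.tetradS s μ e x = T μ b d) :
    (covM (F.connS s) d (curvM (F.connS s) b c) x
      - ∑ e, (((MetricField.Γ g e d b x : ℝ) : ℂ) • curvM (F.connS s) e c x
      + ((MetricField.Γ g e d c x : ℝ) : ℂ) • curvM (F.connS s) b e x)) A B =
    (T 0 b d * F.tetradS s 2 c x + F.tetradS s 0 b x * T 2 c d
      - T 2 b d * F.tetradS s 0 c x - F.tetradS s 2 b x * T 0 c d) * F.curv₁ (s x) A B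
    + (T 1 b d * F.tetradS s 2 c x + F.tetradS s 1 b x * T 2 c d
      - T 2 b d * F.tetradS s 1 c x - F.tetradS s 2 b x * T 1 c d) * F.curv₂ (s x) A B
    + (F.tetradS s 0 b x * F.tetradS s 2 c x - F.tetradS s 2 b x * F.tetradS s 0 c x) * D₁
    + (F.tetradS s 1 b x * F.tetradS s 2 c x - F.tetradS s 2 b x * F.tetradS s 1 c x) * D₂ := by
  have hsx := H.sect.mapsTo hx
  have hsd := differentiableAt_of_contDiffOn H.isOpen hx H.sect.smooth
  have dt : ∀ μ b, HasFDerivAt (F.tetradS s μ b) (fderiv ℝ (F.tetradS s μ b) x) x := fun μ b =>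
    (differentiableAt_of_contDiffOn H.isOpen hx (H.smooth_tetradS μ b)).hasFDerivAt
  have c1 : HasFDerivAt (fun y => F.curv₁ (s y) A B)
      ((fderiv ℝ (fun q => F.curv₁ q A B) (s x)).comp (fderiv ℝ s x)) x :=
    (H.coframe.hasFDerivAt_curv₁ hsx A B).differentiableAt.hasFDerivAt.comp x hsd.hasFDerivAt
  have c2 : HasFDerivAt (fun y => F.curv₂ (s y) A B)
      ((fderiv ℝ (fun q => F.curv₂ q A B) (s x)).comp (fderiv ℝ s x)) x :=
    (H.coframe.hasFDerivAt_curv₂ hsx A B).differentiableAt.hasFDerivAt.comp x hsd.hasFDerivAt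
  have hpd : pdM d (curvM (F.connS s) b c) x A B =
      (pdC d (F.tetradS s 0 b) x * F.tetradS s 2 c x + F.tetradS s 0 b x * pdC d (F.tetradS s 2 c) x
      - pdC d (F.tetradS s 2 b) x * F.tetradS s 0 c x
      - F.tetradS s 2 b x * pdC d (F.tetradS s 0 c) x) * F.curv₁ (s x) A B
      + (pdC d (F.tetradS s 1 b) x * F.tetradS s 2 c x
      + F.tetradS s 1 b x * pdC d (F.tetradS s 2 c) x
      - pdC d (F.tetradS s 2 b) x * F.tetradS s 1 c x
      - F.tetradS s 2 b x * pdC d (F.tetradS s 1 c) x) * F.curv₂ (s x) A B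
      + (F.tetradS s 0 b x * F.tetradS s 2 c x - F.tetradS s 2 b x * F.tetradS s 0 c x) *
        fderiv ℝ (fun q => F.curv₁ q A B) (s x) (fderiv ℝ s x (stdVec d))
      + (F.tetradS s 1 b x * F.tetradS s 2 c x - F.tetradS s 2 b x * F.tetradS s 1 c x) *
        fderiv ℝ (fun q => F.curv₂ q A B) (s x) (fderiv ℝ s x (stdVec d)) := by
    have e := pdC_congr H.isOpen hx (f := fun y => curvM (F.connS s) b c y A B)
      (g := fun y => (F.tetradS s 0 b y * F.tetradS s 2 c y
        - F.tetradS s 2 b y * F.tetradS s 0 c y) * F.curv₁ (s y) A B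
        + (F.tetradS s 1 b y * F.tetradS s 2 c y - F.tetradS s 2 b y * F.tetradS s 1 c y)
        * F.curv₂ (s y) A B) (fun y hy => by rw [H.curvM_connS_eq hy]; rfl) d
    have h := ((((dt 0 b).fun_mul (dt 2 c)).fun_sub ((dt 2 b).fun_mul (dt 0 c))).fun_mul c1).fun_add
      ((((dt 1 b).fun_mul (dt 2 c)).fun_sub ((dt 2 b).fun_mul (dt 1 c))).fun_mul c2)
    rw [pdM, Matrix.of_apply, e, pdC, h.fderiv]
    simp only [_root_.add_apply, _root_.sub_apply, _root_.smul_apply, smul_eq_mul, pdC,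
      ContinuousLinearMap.comp_apply]
    ring
  rw [Matrix.sub_apply, Matrix.sum_apply, covM, Matrix.sub_apply, Matrix.add_apply, hpd,
    Matrix.mul_apply, Matrix.mul_apply, ← h₁, ← h₂]
  simp only [Matrix.add_apply, Matrix.smul_apply, smul_eq_mul, H.curvM_connS_eq hx, ← hT,
    Fin.sum_univ_four, Fin.sum_univ_six]
  ring

/-- The divergence of the curvature along a section. -/
theorem divM_connS (b : Fin 4) : divM g (F.connS s) (curvM (F.connS s)) b x =
    (2 * F.S1 (s x) * (φ x : ℂ)⁻¹ * F.tetradS s 2 b x) • matM := by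
  have hsx := H.sect.mapsTo hx
  have hm := H.gaugeM_ne hx
  obtain ⟨Y, Z, h1⟩ := H.coframe.exists_covDeriv_curv₁ hsx
  obtain ⟨Y', Z', h2⟩ := H.coframe.exists_covDeriv_curv₂ hsx
  -- The pullbacks of the remaining connection forms to the four-dimensional base are combinations
  -- of the tetrad with unknown coefficients. Those of `m⁻¹ gaugeV`, `½(Ω₂ + Ω̄₂)`, `Ω₃` and `Ω̄₃`
  -- are named here.
  obtain ⟨u, hu⟩ := H.exists_expansion hx (fun b => (gaugeM φ x)⁻¹ * gaugeV F s φ b x)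
  obtain ⟨a, ha⟩ := H.exists_expansion hx (fun b => F.connS s b x 0 0)
  obtain ⟨f, hf⟩ := H.exists_expansion hx
    (fun b => F.Om3 (s x) (fderiv ℝ s x (stdVec b)))
  obtain ⟨f', hf'⟩ := H.exists_expansion hx
    (fun b => F.Om3b (s x) (fderiv ℝ s x (stdVec b)))
  set t := fun μ c => F.tetradS s μ c x with ht
  have i1 : (1 / (3 * Complex.I)) = -(1 / 3) * Complex.I := by
    field_simp; simp
  have hk : ∀ μ, (gaugeM φ x)⁻¹ * gaugeK F s φ g μ x = (φ x : ℂ)⁻¹ * ∑ ρ, gNull μ ρ * u ρ := by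
    intro μ
    have e := H.trace_tetrad hx (fun σ ρ => if σ = μ then u ρ else 0)
    have e1 : (gaugeM φ x)⁻¹ * gaugeK F s φ g μ x = ∑ c, ∑ d, (((g x)⁻¹ c d : ℝ) : ℂ) *
        ∑ σ, ∑ ρ, (if σ = μ then u ρ else 0) * (F.tetradS s σ c x * F.tetradS s ρ d x) := by
      rw [gaugeK, Finset.mul_sum]
      refine Finset.sum_congr rfl fun c _ => ?_
      rw [Finset.mul_sum]
      refine Finset.sum_congr rfl fun d _ => ?_
      have e2 : ∑ σ, ∑ ρ, (if σ = μ then u ρ else 0) * (F.tetradS s σ c x * F.tetradS s ρ d x) =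
          F.tetradS s μ c x * ((gaugeM φ x)⁻¹ * gaugeV F s φ d x) := by
        rw [hu d]
        simp only [ite_mul, zero_mul]
        rw [Finset.sum_comm, Finset.mul_sum]
        refine Finset.sum_congr rfl fun ρ _ => ?_
        rw [Finset.sum_ite_eq' Finset.univ μ]
        simp
        ring
      rw [e2]
      ring
    rw [e1, e]
    fin_cases μ <;> simp [Fin.sum_univ_four, gNull, mul_comm]
  let δ : Fin 4 → Fin 4 → ℂ := fun i j => if i = j then 1 else 0
  -- Tetrad components of the middle block of `ω̃`, where `Ω₂ - Ω̄₂ = 3i θ⁴`.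
  let Wm : Fin 4 → Fin 4 → Fin 4 → ℂ := fun μ τ ρ => (![
    ![-(Complex.I * δ 3 ρ), 0, -f ρ, Complex.I / 2 * δ 0 ρ],
    ![0, Complex.I * δ 3 ρ, -f' ρ, -(Complex.I / 2 * δ 1 ρ)],
    ![Complex.I / 2 * δ 1 ρ, -(Complex.I / 2 * δ 0 ρ), -a ρ, 0],
    ![f' ρ, f ρ, 0, a ρ]] : Fin 4 → Fin 4 → ℂ) μ τ
  -- Tetrad components of the Levi-Civita derivative of `θ^μ`: `τ` is the form index and `ρ` the
  -- direction of differentiation.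
  let T : Fin 4 → Fin 4 → Fin 4 → ℂ := fun μ τ ρ =>
    (∑ ν, gNull μ ν * u ν) * gNull ρ τ - δ μ ρ * u τ - Wm μ τ ρ - (u ρ - a ρ) * δ μ τ
  have h3i : ∀ d, F.Om2 (s x) (fderiv ℝ s x (stdVec d)) = ∑ ρ, (a ρ + 3 * Complex.I / 2 * δ 3 ρ)
      * t ρ d ∧ F.Om2b (s x) (fderiv ℝ s x (stdVec d)) =
      ∑ ρ, (a ρ - 3 * Complex.I / 2 * δ 3 ρ) * t ρ d := by
    intro d
    have e1 : t 3 d = (1 / (3 * Complex.I)) * (F.Om2 (s x) (fderiv ℝ s x (stdVec d))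
      - F.Om2b (s x) (fderiv ℝ s x (stdVec d))) := rfl
    have e2 : (1 / 2 : ℂ) * (F.Om2 (s x) (fderiv ℝ s x (stdVec d))
      + F.Om2b (s x) (fderiv ℝ s x (stdVec d))) = ∑ ρ, a ρ * t ρ d := ha d
    rw [i1] at e1
    simp only [add_mul, sub_mul, Finset.sum_add_distrib, Finset.sum_sub_distrib, ← e2]
    simp [δ, e1]
    constructor <;> ring_nf <;> simp only [Complex.I_sq] <;> ring
  have hWm : ∀ μ τ d, F.connS s d x (tIdx μ) (tIdx τ) = ∑ ρ, Wm μ τ ρ * t ρ d := by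
    intro μ τ d
    obtain ⟨ho, ho'⟩ := h3i d
    have hfd := hf d
    have hfd' := hf' d
    simp only [Fin.sum_univ_four, δ] at ho ho' hfd hfd'
    fin_cases μ <;> fin_cases τ <;>
    simp [CoframeData.connS, tIdx, CoframeData.confConn, pull, Wm, Fin.sum_univ_four, δ, ho, ho',
      hfd, hfd', t, CoframeData.tetradS, CoframeData.tetrad] <;> ring
  have hT : ∀ μ b d, pdC d (F.tetradS s μ b) x
      - ∑ e, ((MetricField.Γ g e d b x : ℝ) : ℂ) * F.tetradS s μ e x =
      ∑ τ, ∑ ρ, T μ τ ρ * t τ b * t ρ d := by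
    intro μ b d
    have e0 : (gaugeM φ x)⁻¹ * F.tetradS s μ d x * gaugeV F s φ b x =
        t μ d * ∑ ρ, u ρ * t ρ b := by
      rw [← hu b]; ring
    have e1 : (φ x : ℂ)⁻¹ * (∑ ρ, gNull μ ρ * u ρ) * (g x d b : ℂ) =
        (∑ ρ, gNull μ ρ * u ρ) * ∑ ρ, ∑ τ, gNull ρ τ * t ρ d * t τ b := by
      rw [H.cast_metric hx, ← mul_assoc, mul_right_comm _ _ (φ x : ℂ),
        inv_mul_cancel₀ (Complex.ofReal_ne_zero.2 (H.pos x hx).ne'), one_mul]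
    rw [H.covDeriv_tetradS hx, hk, e1, e0, ha d, hu d]
    simp only [hWm, Fin.sum_univ_four, T]
    fin_cases μ <;> simp [δ, gNull, ht] <;> ring
  ext A B
  let X := F.curv₁ (s x) A B
  let X' := F.curv₂ (s x) A B
  let E : Fin 4 → ℂ := fun ρ => -(3 * a ρ + 3 * Complex.I / 2 * δ 3 ρ) * X
    - F.S1 (s x) * matM A B * δ 1 ρ + Y A B * δ 0 ρ + Z A B * δ 2 ρ
  let E' : Fin 4 → ℂ := fun ρ => -(3 * a ρ - 3 * Complex.I / 2 * δ 3 ρ) * X'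
    - F.S1 (s x) * matM A B * δ 0 ρ + Y' A B * δ 1 ρ + Z' A B * δ 2 ρ
  let Nb : Fin 4 → Fin 4 → ℂ := fun μ ρ => ∑ τ, T μ τ ρ * t τ b
  -- With the index `b` fixed, the covariant derivative of the curvature is a bilinear form in the
  -- two indices to be traced; these are its tetrad components.
  let C : Fin 4 → Fin 4 → ℂ := fun σ ρ =>
    (Nb 0 ρ * δ 2 σ + t 0 b * T 2 σ ρ - Nb 2 ρ * δ 0 σ - t 2 b * T 0 σ ρ) * X
    + (Nb 1 ρ * δ 2 σ + t 1 b * T 2 σ ρ - Nb 2 ρ * δ 1 σ - t 2 b * T 1 σ ρ) * X'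
    + (t 0 b * δ 2 σ - t 2 b * δ 0 σ) * E ρ + (t 1 b * δ 2 σ - t 2 b * δ 1 σ) * E' ρ
  have hE : ∀ d, -(2 * F.Om2 (s x) (fderiv ℝ s x (stdVec d))
      + F.Om2b (s x) (fderiv ℝ s x (stdVec d))) * X - F.S1 (s x) * matM A B * t 1 d
      + Y A B * t 0 d + Z A B * t 2 d = ∑ ρ, E ρ * t ρ d := by
    intro d
    obtain ⟨ho, ho'⟩ := h3i d
    rw [ho, ho']
    simp [Fin.sum_univ_four, E, δ]
    ring
  have hE' : ∀ d, -(F.Om2 (s x) (fderiv ℝ s x (stdVec d))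
      + 2 * F.Om2b (s x) (fderiv ℝ s x (stdVec d))) * X' - F.S1 (s x) * matM A B * t 0 d
      + Y' A B * t 1 d + Z' A B * t 2 d = ∑ ρ, E' ρ * t ρ d := by
    intro d
    obtain ⟨ho, ho'⟩ := h3i d
    rw [ho, ho']
    simp [Fin.sum_univ_four, E', δ]
    ring
  have hN : ∀ μ d, ∑ τ, ∑ ρ, T μ τ ρ * t τ b * t ρ d = ∑ ρ, Nb μ ρ * t ρ d := by
    intro μ d
    rw [Finset.sum_comm]
    exact Finset.sum_congr rfl fun ρ _ => by rw [Finset.sum_mul]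
  have key : ∀ c d, (covM (F.connS s) d (curvM (F.connS s) b c) x
      - ∑ e, (((MetricField.Γ g e d b x : ℝ) : ℂ) • curvM (F.connS s) e c x
      + ((MetricField.Γ g e d c x : ℝ) : ℂ) • curvM (F.connS s) b e x)) A B =
      ∑ σ, ∑ ρ, C σ ρ * (F.tetradS s σ c x * F.tetradS s ρ d x) := by
    intro c d
    rw [H.covM_curvM_connS hx b c d A B ((h1 A B _).trans (hE d)) ((h2 A B _).trans (hE' d)) hT]
    simp only [hN]
    have hC : ∀ σ ρ, C σ ρ * (F.tetradS s σ c x * F.tetradS s ρ d x) =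
        (Nb 0 ρ * t ρ d * (δ 2 σ * t σ c) + t 0 b * (T 2 σ ρ * t σ c * t ρ d)
          - Nb 2 ρ * t ρ d * (δ 0 σ * t σ c) - t 2 b * (T 0 σ ρ * t σ c * t ρ d)) * X
        + (Nb 1 ρ * t ρ d * (δ 2 σ * t σ c) + t 1 b * (T 2 σ ρ * t σ c * t ρ d)
          - Nb 2 ρ * t ρ d * (δ 1 σ * t σ c) - t 2 b * (T 1 σ ρ * t σ c * t ρ d)) * X'
        + (t 0 b * (δ 2 σ * t σ c) - t 2 b * (δ 0 σ * t σ c)) * (E ρ * t ρ d)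
        + (t 1 b * (δ 2 σ * t σ c) - t 2 b * (δ 1 σ * t σ c)) * (E' ρ * t ρ d) := by
      intro σ ρ
      simp only [C, ht]
      ring
    have hδ : ∀ i, ∑ σ, δ i σ * t σ c = t i c := by
      intro i
      simp [δ]
    simp only [hC, Finset.sum_add_distrib, Finset.sum_sub_distrib, ← Finset.sum_mul,
      ← Finset.mul_sum, hδ]
    rfl
  rw [divM_apply]
  simp only [key]
  rw [H.trace_tetrad hx, Matrix.smul_apply, smul_eq_mul]
  -- In the trace over the pairs of the null tetrad all unknown coefficients cancel, including `Y`,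
  -- `Z`, `Y'`, `Z'`. The two curvature terms contribute `𝓢₁ M θ³_b` each.
  have hC : C 0 1 + C 1 0 + C 2 3 + C 3 2 = 2 * F.S1 (s x) * matM A B * t 2 b := by
    simp [C, Nb, T, Wm, E, E', δ, Fin.sum_univ_four, gNull]
    ring
  rw [hC]
  ring

end IsFefferman

/-! ### The Bach tensor and Einstein representatives -/

namespace IsFefferman

variable {N : Set (Fin 3 → ℝ)} {cr : CRStructure N} {P : Set (Fin 8 → ℝ)}
  {π : (Fin 8 → ℝ) → (Fin 3 → ℝ)} {F : CoframeData} {U : Set (Fin 4 → ℝ)}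
  {s : (Fin 4 → ℝ) → (Fin 8 → ℝ)} {φ : (Fin 4 → ℝ) → ℝ} {g : MetricField}
  (H : IsFefferman cr P π F U s φ g) {x : Fin 4 → ℝ} (hx : x ∈ U)
include H hx

/-- The Bach tensor of a Fefferman metric. -/
theorem cast_bach (a b : Fin 4) : ((g.bach x a b : ℝ) : ℂ) =
    2 * F.S1 (s x) * (φ x : ℂ)⁻¹ * F.tetradS s 2 b x * F.tetradS s 2 a x := by
  have hm := H.gaugeM_ne hx
  rw [H.isConfGauge.cast_bach hx]
  have hD := H.isGauge.divM g hx b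
  rw [H.divM_connS hx] at hD
  set D := divM g (gaugeW F s φ g) (curvM (gaugeW F s φ g)) b x with hDdef
  have e : ∀ A, ∑ B, gaugeH F s φ g x A B * D B (tIdx a) =
      2 * F.S1 (s x) * (φ x : ℂ)⁻¹ * F.tetradS s 2 b x *
        ∑ B, matM A B * gaugeH F s φ g x B (tIdx a) := by
    intro A
    have h := congrFun (congrFun hD A) (tIdx a)
    rw [Matrix.mul_apply, Matrix.smul_mul, Matrix.smul_apply, Matrix.mul_apply, smul_eq_mul] at h
    exact h
  -- The entry of `matM` at `(4,5)` meets the last row of `h`, which is zero in the middle columns,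
  -- so only the top row contributes.
  have hM : ∀ A, A ≠ 0 → ∑ B, matM A B * gaugeH F s φ g x B (tIdx a) = 0 := by
    intro A hA
    have h5 : gaugeH F s φ g x 5 (tIdx a) = 0 := by simp [gaugeH]
    fin_cases A <;> simp [matM, Fin.sum_univ_six, h5] at hA ⊢
  have h5 : D 5 (tIdx a) = 0 := by
    have h := e 5
    rw [hM 5 (by decide)] at h
    simp [gaugeH, sum_six] at h
    exact h.resolve_left hm
  have ht : (Matrix.of fun μ k => F.tetradS s μ k x).mulVec (fun c => D (tIdx c) (tIdx a)) = 0 := by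
    ext μ
    have h := e (tIdx μ)
    rw [hM (tIdx μ) (tIdx_ne_zero μ)] at h
    simp [gaugeH, sum_six, h5, mul_assoc, ← Finset.mul_sum] at h
    simpa [Matrix.mulVec, dotProduct] using h.resolve_left hm
  have h4 : ∀ c, D (tIdx c) (tIdx a) = 0 := fun c =>
    congrFun (Matrix.eq_zero_of_mulVec_eq_zero (H.tetradS_det_ne hx) ht) c
  have h0 := e 0
  have hM0 : ∑ B, matM 0 B * gaugeH F s φ g x B (tIdx a) = gaugeM φ x * F.tetradS s 2 a x := by
    have h3 : gaugeH F s φ g x (tIdx 2) (tIdx a) = gaugeM φ x * F.tetradS s 2 a x := by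
      simp [gaugeH]
    rw [← h3]
    simp [matM, Fin.sum_univ_six, tIdx]
  rw [hM0, sum_six, h5] at h0
  simp only [h4] at h0
  have h00 : gaugeH F s φ g x 0 0 = gaugeM φ x := rfl
  rw [h00] at h0
  refine mul_left_cancel₀ hm ?_
  rw [mul_zero, add_zero] at h0
  simp only [mul_zero, Finset.sum_const_zero, add_zero] at h0
  rw [h0]
  ring

/-- By transversality of the section some component `θ³_a` is nonzero, so the diagonal component
`B_{aa}` detects `𝓢₁`. -/
theorem bach_eq_zero_iff : g.bach x = 0 ↔ F.S1 (s x) = 0 := by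
  constructor
  · intro h
    by_contra hS
    refine H.tetradS_det_ne hx (Matrix.det_eq_zero_of_row_eq_zero 2 fun a => ?_)
    have h1 := H.cast_bach hx a a
    rw [h] at h1
    have hφ : (φ x : ℂ) ≠ 0 := Complex.ofReal_ne_zero.2 (H.pos x hx).ne'
    simpa [hS, hφ] using h1
  · intro h
    ext a b
    have h1 := H.cast_bach hx a b
    rw [h] at h1
    simpa using h1

/-- The curvature in the coordinate gauge of a Fefferman–Einstein metric. -/
theorem einstein_column {Λ : (Fin 4 → ℝ) → ℝ}
    (hE : ∀ y ∈ U, ∀ a b, g.ric a b y = Λ y * g y a b) (c e : Fin 4) :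
    gaugeW F s φ g c x (tIdx e) 5 = if e = c then -((Λ x / 6 : ℝ) : ℂ) else 0 := by
  have hW := H.isConfGauge
  have hsc : g.scal x = 4 * Λ x := by
    have h1 : ∑ b, ∑ d, (g x)⁻¹ b d * g x d b = 4 := by
      have h2 := Matrix.nonsing_inv_mul (g x) (H.metric_det_ne hx).isUnit
      have h3 : ∀ b, ∑ d, (g x)⁻¹ b d * g x d b = 1 := fun b => by
        have h4 := congrFun (congrFun h2 b) b
        rwa [Matrix.mul_apply, Matrix.one_apply_eq] at h4
      simp [h3]
    rw [MetricField.scal, ← h1, Finset.sum_mul]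
    refine Finset.sum_congr rfl fun b _ => ?_
    rw [Finset.sum_mul]
    refine Finset.sum_congr rfl fun d _ => ?_
    rw [hE x hx, H.metric_symm hx b d]
    ring
  have hP : ∀ a, gaugeW F s φ g c x 0 (tIdx a) = -((Λ x / 6 : ℝ) : ℂ) * (g x a c : ℂ) := by
    intro a
    have h := hW.cast_schouten hx c a
    rw [MetricField.schouten, hE x hx, hsc, H.metric_symm hx c a] at h
    push_cast at h ⊢
    linear_combination h
  have h1 : gaugeW F s φ g c x (tIdx e) 5 =
      ∑ a, (((g x)⁻¹ e a : ℝ) : ℂ) * gaugeW F s φ g c x 0 (tIdx a) := by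
    simp only [hW.W_zero_tIdx hx, Finset.mul_sum]
    rw [Finset.sum_comm]
    have h2 : ∀ f, ∑ a, (((g x)⁻¹ e a : ℝ) : ℂ) * ((g x a f : ℂ) *
        gaugeW F s φ g c x (tIdx f) 5) = (if e = f then 1 else 0) *
        gaugeW F s φ g c x (tIdx f) 5 := by
      intro f
      rw [← H.inv_metric_mul hx, Finset.sum_mul]
      exact Finset.sum_congr rfl fun a _ => by ring
    simp [h2]
  have h3 : ∀ a, (((g x)⁻¹ e a : ℝ) : ℂ) * (-((Λ x / 6 : ℝ) : ℂ) * (g x a c : ℂ)) =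
      -((Λ x / 6 : ℝ) : ℂ) * ((((g x)⁻¹ e a : ℝ) : ℂ) * (g x a c : ℂ)) := fun a => by ring
  rw [h1]
  simp only [hP, h3]
  rw [← Finset.mul_sum, H.inv_metric_mul hx]
  simp

/-- The last column of the connection is a scalar function times the identity. Its quadratic
contribution to the curvature cancels by the symmetry of the Christoffel symbols, leaving the
differential of that scalar. -/
theorem einstein_curv {Λ : (Fin 4 → ℝ) → ℝ}
    (hE : ∀ y ∈ U, ∀ a b, g.ric a b y = Λ y * g y a b) (b c a : Fin 4) :
    curvM (gaugeW F s φ g) b c x (tIdx a) 5 =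
      (if a = c then pdC b (fun y => gaugeW F s φ g 0 y (tIdx 0) 5) x else 0)
      - (if a = b then pdC c (fun y => gaugeW F s φ g 0 y (tIdx 0) 5) x else 0) := by
  have hW := H.isConfGauge
  have hc : ∀ y ∈ U, ∀ c e, gaugeW F s φ g c y (tIdx e) 5 =
      if e = c then gaugeW F s φ g 0 y (tIdx 0) 5 else 0 := by
    intro y hy c e
    rw [H.einstein_column hy hE, H.einstein_column hy hE, if_pos rfl]
  have hp : ∀ b c, pdC b (fun y => gaugeW F s φ g c y (tIdx a) 5) x =
      if a = c then pdC b (fun y => gaugeW F s φ g 0 y (tIdx 0) 5) x else 0 := by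
    intro b c
    rw [pdC_congr H.isOpen hx (fun y hy => hc y hy c a)]
    split_ifs
    · rfl
    · simp [pdC]
  rw [IsConfGauge.curv_entry, hp, hp, hW.W_zero_five hx, hW.W_zero_five hx, hW.W_five_five hx,
    hW.W_five_five hx]
  obtain ⟨v, hv⟩ : ∃ v : ℂ, ∀ c e, gaugeW F s φ g c x (tIdx e) 5 = if e = c then v else 0 :=
    ⟨_, hc x hx⟩
  simp only [hv]
  simp
  rw [hW.W_symm hx b c]
  ring

/-- The last column of `h F_W = F_w h` equates terms in the differential of the scalar with the
explicit curvature applied to `(k, m⁻¹)`. Suitable tetrad components give zero differential in the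
required directions. The remaining equations ask that `k` satisfy two incompatible conditions unless
`𝓡 = 0`, and then `𝓢 = 0`. That the scalar is constant is not presupposed. -/
theorem einstein_flat {Λ : (Fin 4 → ℝ) → ℝ}
    (hE : ∀ y ∈ U, ∀ a b, g.ric a b y = Λ y * g y a b) : F.R (s x) = 0 ∧ F.S (s x) = 0 := by
  have hm := H.gaugeM_ne hx
  set m := gaugeM φ x with hmdef
  set k := fun μ => gaugeK F s φ g μ x with hk
  set dL := fun b => pdC b (fun y => gaugeW F s φ g 0 y (tIdx 0) 5) x with hdL
  set t := fun μ b => F.tetradS s μ b x with ht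
  set T : Matrix (Fin 4) (Fin 4) ℂ := Matrix.of fun μ k => F.tetradS s μ k x with hT
  have hTd : IsUnit T.det := (H.tetradS_det_ne hx).isUnit
  have key : ∀ μ b c, m * (t μ c * dL b - t μ b * dL c) =
      (t 0 b * t 2 c - t 2 b * t 0 c) * (∑ ν, F.curv₁ (s x) (tIdx μ) (tIdx ν) * k ν
        + F.curv₁ (s x) (tIdx μ) 5 * m⁻¹)
      + (t 1 b * t 2 c - t 2 b * t 1 c) * (∑ ν, F.curv₂ (s x) (tIdx μ) (tIdx ν) * k ν
        + F.curv₂ (s x) (tIdx μ) 5 * m⁻¹) := by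
    intro μ b c
    have h1 := congrFun (congrFun (H.curv_gauge hx b c) (tIdx μ)) 5
    rw [Matrix.mul_apply, Matrix.mul_apply, sum_six, sum_six, H.curvM_connS_zero hx,
      H.curv_five hx] at h1
    simp only [H.einstein_curv hx hE, H.curvM_connS_eq hx] at h1
    simp [gaugeH, mul_sub, Finset.sum_sub_distrib, add_mul, Finset.sum_add_distrib, mul_assoc,
      ← Finset.mul_sum] at h1
    linear_combination h1
  set l := fun σ => ∑ b, T⁻¹ b σ * dL b with hl
  have hE : ∀ μ σ, ∑ b, T⁻¹ b σ * t μ b = if μ = σ then 1 else 0 := by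
    intro μ σ
    have h2 := congrFun (congrFun (Matrix.mul_nonsing_inv T hTd) μ) σ
    rw [Matrix.mul_apply, Matrix.one_apply] at h2
    rw [← h2]
    exact Finset.sum_congr rfl fun a _ => mul_comm _ _
  have hev : ∀ (p q : Fin 4 → ℂ) σ τ, ∑ b, ∑ c, T⁻¹ b σ * T⁻¹ c τ * (p b * q c) =
      (∑ b, T⁻¹ b σ * p b) * ∑ c, T⁻¹ c τ * q c := by
    intro p q σ τ
    rw [Finset.sum_mul_sum]
    exact Finset.sum_congr rfl fun _ _ => Finset.sum_congr rfl fun _ _ => by ring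
  let δ : Fin 4 → Fin 4 → ℂ := fun i j => if i = j then 1 else 0
  -- The two form indices are converted to tetrad indices by the inverse tetrad matrix.
  have key2 : ∀ μ σ τ, m * (δ μ τ * l σ - δ μ σ * l τ) =
      (δ 0 σ * δ 2 τ - δ 2 σ * δ 0 τ) * (∑ ν, F.curv₁ (s x) (tIdx μ) (tIdx ν) * k ν
        + F.curv₁ (s x) (tIdx μ) 5 * m⁻¹)
      + (δ 1 σ * δ 2 τ - δ 2 σ * δ 1 τ) * (∑ ν, F.curv₂ (s x) (tIdx μ) (tIdx ν) * k ν
        + F.curv₂ (s x) (tIdx μ) 5 * m⁻¹) := by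
    intro μ σ τ
    have hE' : ∀ μ σ, δ μ σ = ∑ b, T⁻¹ b σ * t μ b := fun μ σ => (hE μ σ).symm
    have e1 : m * (δ μ τ * l σ - δ μ σ * l τ) =
        ∑ b, ∑ c, T⁻¹ b σ * T⁻¹ c τ * (m * (t μ c * dL b - t μ b * dL c)) := by
      rw [hE', hE', mul_comm (∑ b, T⁻¹ b τ * t μ b), ← hev, ← hev, ← Finset.sum_sub_distrib,
        Finset.mul_sum]
      refine Finset.sum_congr rfl fun b _ => ?_
      rw [← Finset.sum_sub_distrib, Finset.mul_sum]
      exact Finset.sum_congr rfl fun c _ => by ring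
    rw [e1]
    simp only [key]
    generalize (∑ ν, F.curv₁ (s x) (tIdx μ) (tIdx ν) * k ν
        + F.curv₁ (s x) (tIdx μ) 5 * m⁻¹) = Z1
    generalize (∑ ν, F.curv₂ (s x) (tIdx μ) (tIdx ν) * k ν
        + F.curv₂ (s x) (tIdx μ) 5 * m⁻¹) = Z2
    simp only [hE', ← hev]
    rw [← Finset.sum_sub_distrib, ← Finset.sum_sub_distrib, Finset.sum_mul, Finset.sum_mul,
      ← Finset.sum_add_distrib]
    refine Finset.sum_congr rfl fun b _ => ?_
    rw [← Finset.sum_sub_distrib, ← Finset.sum_sub_distrib, Finset.sum_mul, Finset.sum_mul,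
      ← Finset.sum_add_distrib]
    exact Finset.sum_congr rfl fun c _ => by ring
  -- The index choice makes the right-hand side zero: the bivectors carrying the curvature do not
  -- involve `θ⁴`.
  have l2 : l 2 = 0 := by
    have h := key2 3 3 2
    simp [δ] at h
    exact h.resolve_left hm
  -- Here the right-hand side vanishes because the curvature has no entries in the row of `θ³`.
  have l0 : l 0 = 0 := by
    have h := key2 2 2 0
    simp [δ, CoframeData.curv₁, CoframeData.curv₂, matN₁, matN₂, matM, tIdx] at h
    exact h.resolve_left hm
  have l1 : l 1 = 0 := by
    have h := key2 2 2 1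
    simp [δ, CoframeData.curv₁, CoframeData.curv₂, matN₁, matN₂, matM, tIdx] at h
    exact h.resolve_left hm
  have hn : m⁻¹ ≠ 0 := inv_ne_zero hm
  -- The rows of `θ¹` and `θ²` would require `k³ = -(i/2) m⁻¹` and `k³ = (i/2) m⁻¹` simultaneously,
  -- where `k³` is the entry `k 2`.
  have hR : F.R (s x) = 0 := by
    by_contra hR
    have h1 := key2 0 1 2
    have h2 := key2 1 0 2
    simp [δ, CoframeData.curv₁, CoframeData.curv₂, matN₁, matN₂, matM, tIdx,
      Fin.sum_univ_four, l0, l1, l2] at h1 h2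
    have hRb : starRingEnd ℂ (F.R (s x)) ≠ 0 := by simpa using hR
    have h1' : F.R (s x) * (k 2 + Complex.I / 2 * m⁻¹) = 0 := by linear_combination h1
    have h2' : starRingEnd ℂ (F.R (s x)) * (k 2 - Complex.I / 2 * m⁻¹) = 0 := by
      linear_combination h2
    have h3 := (mul_eq_zero.1 h1').resolve_left hR
    have h4 := (mul_eq_zero.1 h2').resolve_left hRb
    have h5 : Complex.I * m⁻¹ = 0 := by linear_combination h3 - h4
    exact (mul_ne_zero Complex.I_ne_zero hn) h5
  refine ⟨hR, ?_⟩
  -- The row of `θ⁴` pairs `𝓢` with the nonzero entry `m⁻¹`.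
  have h := key2 3 1 2
  simp [δ, CoframeData.curv₁, CoframeData.curv₂, matN₁, matN₂, matM, tIdx,
      Fin.sum_univ_four, l1, l2, hR] at h
  exact h.resolve_right hm

end IsFefferman

/-! ### Vanishing of the `𝔰𝔲(2,1)` curvature -/

namespace IsCartanCoframe

variable {N : Set (Fin 3 → ℝ)} {cr : CRStructure N} {P : Set (Fin 8 → ℝ)}
  {π : (Fin 8 → ℝ) → (Fin 3 → ℝ)} {F : CoframeData}
  (hF : IsCartanCoframe cr P π F) {p : Fin 8 → ℝ} (hp : p ∈ P)
include hF hp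

/-- The Cartan curvature vanishes where `R` and `S` do. -/
theorem curvature_suConn_eq_zero (hR : F.R p = 0) (hS : F.S p = 0) (i j : Fin 3) :
    curvature F.suConn i j p = 0 := by
  have d1 := hF.differentiableAt_of hp hF.th1_smooth
  have d2 := hF.differentiableAt_of hp hF.th2_smooth
  have d3 := hF.differentiableAt_of hp hF.cth3_smooth
  have dO2 := hF.differentiableAt_of hp hF.Om2_smooth
  have dO2b := hF.differentiableAt_of hp hF.Om2b_smooth
  have dO3 := hF.differentiableAt_of hp hF.Om3_smooth
  have dO3b := hF.differentiableAt_of hp hF.Om3b_smooth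
  have dO4 := hF.differentiableAt_of hp hF.cOm4_smooth
  have cs : ∀ (c : ℂ) (α : OneForm 8), DifferentiableAt ℝ α p →
      DifferentiableAt ℝ (fun q => c • α q) p := fun c α h => h.fun_const_smul c
  have e3 := dO2b.fun_sub dO2
  have e4 := cs 3⁻¹ _ (cs 2 _ dO2)
  have e5 := cs (-1 / 3) _ (cs 2 _ dO2b)
  rw [curvature]
  ext v
  fin_cases i <;> fin_cases j <;>
  simp [CoframeData.suConn, Fin.sum_univ_three, extD_const_smul, extD_add, extD_sub,
    d2, d3, dO2, dO2b, dO3, dO3b, dO4, cs, e3, e4, e5, hF.d_th1 p hp, hF.d_th3 p hp,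
    hF.d_Om2 p hp, hF.d_Om3 p hp, hF.d_Om4 p hp, hF.extD_th2_apply hp, hF.extD_Om2b_apply hp,
    hF.extD_Om3b_apply hp, hR, hS] <;>
  ring_nf

end IsCartanCoframe

/-! ### Coframes on open subsets of `ℝ³` -/

section Congr

variable {n : ℕ} {V : Set (Fin n → ℝ)} {x : Fin n → ℝ}

theorem extD_congr (hV : IsOpen V) (hx : x ∈ V) {α β : OneForm n} (h : ∀ y ∈ V, α y = β y) :
    extD α x = extD β x :=
  Filter.EventuallyEq.extDeriv_eq (Filter.eventuallyEq_of_mem (hV.mem_nhds hx) fun y hy => by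
    rw [h y hy])

theorem star_extD_of_real (hV : IsOpen V) (hx : x ∈ V) {α : OneForm n}
    (hα : DifferentiableAt ℝ α x) (h : ∀ y ∈ V, conj α y = α y) (v : Fin 2 → Fin n → ℝ) :
    starRingEnd ℂ (extD α x v) = extD α x v := by
  rw [← extD_conj_apply hα, extD_congr hV hx h]

theorem star_extD_of_imag (hV : IsOpen V) (hx : x ∈ V) {α : OneForm n}
    (hα : DifferentiableAt ℝ α x) (h : ∀ y ∈ V, conj α y = -α y) (v : Fin 2 → Fin n → ℝ) :
    starRingEnd ℂ (extD α x v) = -extD α x v := by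
  rw [← extD_conj_apply hα, extD_congr hV hx h, extD_neg hα]
  rfl

theorem contDiffOn_extD (hV : IsOpen V) {α : OneForm n} (hα : ContDiffOn ℝ ∞ α V)
    (v : Fin 2 → Fin n → ℝ) : ContDiffOn ℝ ∞ (fun y => extD α y v) V := by
  have h1 : ContDiffOn ℝ ∞ (fderiv ℝ α) V := hα.fderiv_of_isOpen hV (by simp)
  refine ContDiffOn.congr (((h1.clm_apply contDiffOn_const).clm_apply contDiffOn_const).sub
    ((h1.clm_apply contDiffOn_const).clm_apply contDiffOn_const)) fun y hy =>
      extD_apply (differentiableAt_of_contDiffOn hV hy hα) v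

theorem contDiffOn_wedge₁ {α β : OneForm n} (hα : ContDiffOn ℝ ∞ α V) (hβ : ContDiffOn ℝ ∞ β V)
    (v : Fin 2 → Fin n → ℝ) : ContDiffOn ℝ ∞ (fun y => wedge₁ (α y) (β y) v) V := by
  simp only [wedge₁_apply]
  exact ((hα.clm_apply contDiffOn_const).mul (hβ.clm_apply contDiffOn_const)).sub
    ((hα.clm_apply contDiffOn_const).mul (hβ.clm_apply contDiffOn_const))

/-- The equation `d(dα) = 0`, when `dα` is a combination of products of `1`-forms. -/
theorem sum_wedge_extD_eq_zero (hV : IsOpen V) (hx : x ∈ V) {α : OneForm n}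
    (hα : ContDiffOn ℝ ∞ α V) {m : ℕ} {a b : Fin m → OneForm n} {k : Fin m → ℂ}
    (ha : ∀ i, ContDiffOn ℝ ∞ (a i) V) (hb : ∀ i, ContDiffOn ℝ ∞ (b i) V)
    (h : ∀ y ∈ V, extD α y = ∑ i, k i • wedge₁ (a i y) (b i y)) (v : Fin 3 → Fin n → ℝ) :
    ∑ i, k i * (wedge (b i x) (extD (a i) x) v - wedge (a i x) (extD (b i) x) v) = 0 := by
  have da := fun i => differentiableAt_of_contDiffOn hV hx (ha i)
  have db := fun i => differentiableAt_of_contDiffOn hV hx (hb i)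
  have h0 := extDeriv_extD hV hα hx
  have h1 : (fun q => extD α q) =ᶠ[nhds x] fun q => ∑ i, k i • wedge₁ (a i q) (b i q) :=
    Filter.eventuallyEq_of_mem (hV.mem_nhds hx) h
  have h2 : fderiv ℝ (fun q => ∑ i, k i • wedge₁ (a i q) (b i q)) x =
      ∑ i, k i • fderiv ℝ (fun q => wedge₁ (a i q) (b i q)) x := by
    rw [fderiv_fun_sum fun i _ => (differentiableAt_wedge₁ (da i) (db i)).fun_const_smul (k i)]
    exact Finset.sum_congr rfl fun i _ =>
      fderiv_fun_const_smul (differentiableAt_wedge₁ (da i) (db i)) (k i)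
  have h3 := congrArg (fun T => T v) (h1.extDeriv_eq.symm.trans h0)
  simp only [extDeriv_two_apply, h2, _root_.sum_apply, ContinuousAlternatingMap.sum_apply,
    ← Finset.sum_sub_distrib, ← Finset.sum_add_distrib] at h3
  refine Eq.trans (Finset.sum_congr rfl fun i _ => ?_) h3
  simp [fderiv_wedge₁ (da i) (db i), extD_apply (da i), extD_apply (db i)]
  ring

end Congr

/-- The standard basis of `ℝ³`. -/
def stdBasis₃ : Fin 3 → Fin 3 → ℝ := fun i => stdVec i

theorem alt_three_ext {T T' : Alt 3 3} (h : T stdBasis₃ = T' stdBasis₃) : T = T' := by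
  have h1 : T.toAlternatingMap = T'.toAlternatingMap := by
    refine Module.Basis.ext_alternating (Pi.basisFun ℝ (Fin 3)) fun v hv => ?_
    have hb : (fun i => Pi.basisFun ℝ (Fin 3) (v i)) =
        stdBasis₃ ∘ (Equiv.ofBijective v (Finite.injective_iff_bijective.1 hv)) := by
      funext i
      simp [stdBasis₃, stdVec]
    rw [hb, AlternatingMap.map_perm, AlternatingMap.map_perm]
    exact congrArg _ h
  exact ContinuousAlternatingMap.toAlternatingMap_injective h1

theorem alt_two_ext {T T' : Alt 3 2} (h : ∀ i j : Fin 3, T ![stdVec i, stdVec j] =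
    T' ![stdVec i, stdVec j]) : T = T' := by
  have h1 : T.toAlternatingMap = T'.toAlternatingMap := by
    refine Module.Basis.ext_alternating (Pi.basisFun ℝ (Fin 3)) fun v hv => ?_
    have hb : (fun i => Pi.basisFun ℝ (Fin 3) (v i)) = ![stdVec (v 0), stdVec (v 1)] := by
      funext i
      fin_cases i <;> simp [stdVec]
    rw [hb]
    exact h _ _
  exact ContinuousAlternatingMap.toAlternatingMap_injective h1

/-- The forms `t, t̄, r`, with `r` real, are a coframe on `V ⊆ ℝ³`. -/
structure IsFrame₃ (V : Set (Fin 3 → ℝ)) (t r : OneForm 3) : Prop where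
  isOpen : IsOpen V
  smooth_t : ContDiffOn ℝ ∞ t V
  smooth_r : ContDiffOn ℝ ∞ r V
  real : ∀ x ∈ V, conj r x = r x
  vol_ne : ∀ x ∈ V, wedge (r x) (wedge₁ (t x) (conj t x)) stdBasis₃ ≠ 0

namespace IsFrame₃

variable {V : Set (Fin 3 → ℝ)} {t r : OneForm 3} (hf : IsFrame₃ V t r)
include hf

theorem smooth_tb : ContDiffOn ℝ ∞ (conj t) V := contDiffOn_conj hf.smooth_t

/-- The coefficients of a smooth `2`-form are smooth. -/
theorem exists_coeff {T : (Fin 3 → ℝ) → Alt 3 2} (hT : ∀ v, ContDiffOn ℝ ∞ (fun y => T y v) V) :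
    ∃ A B C : (Fin 3 → ℝ) → ℂ,
    ContDiffOn ℝ ∞ A V ∧ ContDiffOn ℝ ∞ B V ∧ ContDiffOn ℝ ∞ C V ∧ ∀ x ∈ V, T x =
      A x • wedge₁ (t x) (conj t x) + B x • wedge₁ (t x) (r x) + C x • wedge₁ (conj t x) (r x) := by
  have hcl : ∀ {β : OneForm 3} (_ : ContDiffOn ℝ ∞ β V) (i : Fin 3),
      ContDiffOn ℝ ∞ (fun y => β y (stdBasis₃ i)) V := fun h i => h.clm_apply contDiffOn_const
  have hs : ∀ {β : OneForm 3} (_ : ContDiffOn ℝ ∞ β V),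
      ContDiffOn ℝ ∞ (fun y => wedge (β y) (T y) stdBasis₃) V := by
    intro β hβ
    simp only [wedge_two_apply]
    exact (((hcl hβ 0).mul (hT _)).sub ((hcl hβ 1).mul (hT _))).add ((hcl hβ 2).mul (hT _))
  have hw : ∀ i j : Fin 3, ContDiffOn ℝ ∞ (fun y => t y (stdBasis₃ i) * conj t y (stdBasis₃ j)
      - t y (stdBasis₃ j) * conj t y (stdBasis₃ i)) V := fun i j =>
    ((hcl hf.smooth_t i).mul (hcl hf.smooth_tb j)).sub
      ((hcl hf.smooth_t j).mul (hcl hf.smooth_tb i))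
  have hv : ContDiffOn ℝ ∞ (fun y => wedge (r y) (wedge₁ (t y) (conj t y)) stdBasis₃) V := by
    simp only [wedge_two_apply, wedge₁_apply]
    exact (((hcl hf.smooth_r 0).mul (hw 1 2)).sub ((hcl hf.smooth_r 1).mul (hw 0 2))).add
      ((hcl hf.smooth_r 2).mul (hw 0 1))
  -- Cramer's rule: each coefficient is the product of `T` with the complementary form, divided by
  -- the volume `r∧t∧t̄`; smoothness is visible from the quotient.
  refine ⟨fun y => wedge (r y) (T y) stdBasis₃ *
      (wedge (r y) (wedge₁ (t y) (conj t y)) stdBasis₃)⁻¹,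
    fun y => -wedge (conj t y) (T y) stdBasis₃ *
      (wedge (r y) (wedge₁ (t y) (conj t y)) stdBasis₃)⁻¹,
    fun y => wedge (t y) (T y) stdBasis₃ *
      (wedge (r y) (wedge₁ (t y) (conj t y)) stdBasis₃)⁻¹,
    (hs hf.smooth_r).mul (hv.inv hf.vol_ne), (hs hf.smooth_tb).neg.mul (hv.inv hf.vol_ne),
    (hs hf.smooth_t).mul (hv.inv hf.vol_ne), fun x hx => ?_⟩
  have h0 := hf.vol_ne x hx
  have e : ∀ u w, T x ![u, w] = -T x ![w, u] := fun u w => by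
    rw [← ContinuousAlternatingMap.coe_toAlternatingMap, ← AlternatingMap.map_swap _ _ zero_ne_one]
    congr 1
    ext i
    fin_cases i <;> rfl
  have e0 : ∀ u, T x ![u, u] = 0 := fun u =>
    (T x).map_eq_zero_of_eq ![u, u] (i := 0) (j := 1) rfl (by decide)
  have e1 := e (stdVec 1) (stdVec 0)
  have e2 := e (stdVec 2) (stdVec 0)
  have e3 := e (stdVec 2) (stdVec 1)
  refine alt_two_ext fun i j => ?_
  simp only [ContinuousAlternatingMap.add_apply, ContinuousAlternatingMap.smul_apply, smul_eq_mul,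
    ← div_eq_mul_inv, div_mul_eq_mul_div, ← add_div]
  rw [eq_div_iff h0]
  simp only [wedge_two_apply, wedge₁_apply, stdBasis₃, Matrix.cons_val_zero,
    Matrix.cons_val_one]
  generalize conj t x = tb
  fin_cases i <;> fin_cases j <;> simp [e0, e1, e2, e3] <;> ring

variable {x : Fin 3 → ℝ} (hx : x ∈ V)
include hx

theorem coeff_eq {A B C A' B' C' : ℂ}
    (h : ∀ v, (A • wedge₁ (t x) (conj t x) + B • wedge₁ (t x) (r x)
      + C • wedge₁ (conj t x) (r x)) v =
      (A' • wedge₁ (t x) (conj t x) + B' • wedge₁ (t x) (r x)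
      + C' • wedge₁ (conj t x) (r x)) v) : A = A' ∧ B = B' ∧ C = C' := by
  have h0 := hf.vol_ne x hx
  have h1 : ∀ β : Cov 3, ∀ v : Fin 3 → Fin 3 → ℝ,
      wedge β (A • wedge₁ (t x) (conj t x) + B • wedge₁ (t x) (r x)
        + C • wedge₁ (conj t x) (r x)) v =
      wedge β (A' • wedge₁ (t x) (conj t x) + B' • wedge₁ (t x) (r x)
        + C' • wedge₁ (conj t x) (r x)) v := by
    intro β v
    rw [wedge_two_apply, wedge_two_apply, h, h, h]
  have ha := h1 (r x) stdBasis₃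
  have hb := h1 (conj t x) stdBasis₃
  have hc := h1 (t x) stdBasis₃
  simp only [wedge_two_apply, wedge₁_apply, ContinuousAlternatingMap.add_apply,
    ContinuousAlternatingMap.smul_apply, smul_eq_mul, Matrix.cons_val_zero,
    Matrix.cons_val_one] at h0 ha hb hc
  generalize conj t x = tb at *
  refine ⟨mul_right_cancel₀ h0 ?_, mul_right_cancel₀ h0 ?_, mul_right_cancel₀ h0 ?_⟩
  · linear_combination ha
  · linear_combination -hb
  · linear_combination hc

/-- The coefficients of a `2`-form that is real (`ε = 1`) or imaginary (`ε = -1`). -/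
theorem coeff_conj {A B C ε : ℂ} {T : Alt 3 2}
    (hT : T = A • wedge₁ (t x) (conj t x) + B • wedge₁ (t x) (r x) + C • wedge₁ (conj t x) (r x))
    (h : ∀ v, starRingEnd ℂ (T v) = ε * T v) :
    -starRingEnd ℂ A = ε * A ∧ starRingEnd ℂ C = ε * B ∧ starRingEnd ℂ B = ε * C := by
  refine hf.coeff_eq hx fun v => ?_
  have h1 := h v
  have hr : ∀ u, starRingEnd ℂ (r x u) = r x u := fun u =>
    (conj_apply r x u).symm.trans (by rw [hf.real x hx])
  rw [hT] at h1
  simp [hr] at h1 ⊢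
  linear_combination h1

end IsFrame₃

/-! ### Exterior derivatives of combinations of forms -/

section HasExtD

variable {n : ℕ} {x : Fin n → ℝ}

/-- The form `α` is differentiable at `x` and `(dα)(x)` is `T`. -/
structure HasExtD (α : OneForm n) (x : Fin n → ℝ) (T : (Fin 2 → Fin n → ℝ) → ℂ) : Prop where
  diff : DifferentiableAt ℝ α x
  eq : ∀ v, extD α x v = T v

variable {α β : OneForm n} {T T' : (Fin 2 → Fin n → ℝ) → ℂ}

theorem HasExtD.add (h : HasExtD α x T) (h' : HasExtD β x T') :
    HasExtD (fun y => α y + β y) x (fun v => T v + T' v) :=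
  ⟨h.diff.fun_add h'.diff, fun v => by
    rw [extD_add h.diff h'.diff, ContinuousAlternatingMap.add_apply, h.eq, h'.eq]⟩

theorem HasExtD.smul {f : (Fin n → ℝ) → ℂ} {f' : Cov n} (hf : HasFDerivAt f f' x)
    (h : HasExtD α x T) : HasExtD (fun y => f y • α y) x
      (fun v => f' (v 0) * α x (v 1) - f' (v 1) * α x (v 0) + f x * T v) :=
  ⟨hf.differentiableAt.fun_smul h.diff, fun v => by
    rw [extD_smul_apply hf.differentiableAt h.diff, ContinuousAlternatingMap.add_apply,
      wedge₁_apply, ContinuousAlternatingMap.smul_apply, smul_eq_mul, h.eq, hf.fderiv]⟩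

theorem HasExtD.conj (h : HasExtD α x T) :
    HasExtD (CRFefferman.conj α) x (fun v => starRingEnd ℂ (T v)) :=
  ⟨differentiableAt_conj h.diff, fun v => by rw [extD_conj_apply h.diff, h.eq]⟩

theorem hasExtD_of_contDiffOn {V : Set (Fin n → ℝ)} (hV : IsOpen V) (hx : x ∈ V)
    (h : ContDiffOn ℝ ∞ α V) : HasExtD α x (fun v => extD α x v) :=
  ⟨differentiableAt_of_contDiffOn hV hx h, fun _ => rfl⟩

theorem hasExtD_fderiv {V : Set (Fin n → ℝ)} (hV : IsOpen V) (hx : x ∈ V)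
    {f : (Fin n → ℝ) → ℂ} (h : ContDiffOn ℝ ∞ f V) : HasExtD (fderiv ℝ f) x (fun _ => 0) := by
  have hd := differentiableAt_of_contDiffOn hV hx (h.fderiv_of_isOpen (m := ∞) hV (by simp))
  refine ⟨hd, fun v => ?_⟩
  rw [extD_apply hd, ((h.contDiffAt (hV.mem_nhds hx)).isSymmSndFDerivAt
      (by rw [minSmoothness_of_isRCLikeNormedField]; exact two_le_infty)) (v 0) (v 1), sub_self]

theorem hasFDerivAt_star {f : (Fin n → ℝ) → ℂ} {f' : Cov n} (h : HasFDerivAt f f' x) :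
    HasFDerivAt (fun y => starRingEnd ℂ (f y)) ((Complex.conjCLE : ℂ →L[ℝ] ℂ).comp f') x :=
  (Complex.conjCLE : ℂ →L[ℝ] ℂ).hasFDerivAt.comp x h

theorem contDiffOn_star {V : Set (Fin n → ℝ)} {f : (Fin n → ℝ) → ℂ} (hf : ContDiffOn ℝ ∞ f V) :
    ContDiffOn ℝ ∞ (fun y => starRingEnd ℂ (f y)) V :=
  (Complex.conjCLE : ℂ →L[ℝ] ℂ).contDiff.comp_contDiffOn hf

end HasExtD

/-! ### Gauge transformations of Cartan's structure equations -/

/-- Cartan's structure equations on an open subset of `ℝⁿ` (with no independence condition). -/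
structure IsCartanSystem {n : ℕ} (V : Set (Fin n → ℝ)) (t r o₂ o₃ o₄ : OneForm n)
    (R S : (Fin n → ℝ) → ℂ) : Prop where
  isOpen : IsOpen V
  smooth_t : ContDiffOn ℝ ∞ t V
  smooth_r : ContDiffOn ℝ ∞ r V
  smooth_o₂ : ContDiffOn ℝ ∞ o₂ V
  smooth_o₃ : ContDiffOn ℝ ∞ o₃ V
  smooth_o₄ : ContDiffOn ℝ ∞ o₄ V
  smooth_R : ContDiffOn ℝ ∞ R V
  smooth_S : ContDiffOn ℝ ∞ S V
  real_r : ∀ x ∈ V, conj r x = r x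
  real_o₄ : ∀ x ∈ V, conj o₄ x = o₄ x
  d_t : ∀ x ∈ V, extD t x = wedge₁ (o₂ x) (t x) + wedge₁ (o₃ x) (r x)
  d_r : ∀ x ∈ V, extD r x =
    Complex.I • wedge₁ (t x) (conj t x) + wedge₁ (o₂ x + conj o₂ x) (r x)
  d_o₂ : ∀ x ∈ V, extD o₂ x =
    (2 * Complex.I) • wedge₁ (t x) (conj o₃ x) + Complex.I • wedge₁ (conj t x) (o₃ x)
      + wedge₁ (o₄ x) (r x)
  d_o₃ : ∀ x ∈ V, extD o₃ x =
    wedge₁ (o₄ x) (t x) + wedge₁ (o₃ x) (conj o₂ x) + R x • wedge₁ (conj t x) (r x)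
  d_o₄ : ∀ x ∈ V, extD o₄ x =
    Complex.I • wedge₁ (o₃ x) (conj o₃ x) + wedge₁ (o₄ x) (o₂ x + conj o₂ x)
      + (starRingEnd ℂ (S x)) • wedge₁ (t x) (r x) + S x • wedge₁ (conj t x) (r x)

theorem conj_apply_of_real {n : ℕ} {α : OneForm n} {x : Fin n → ℝ} (h : conj α x = α x)
    (u : Fin n → ℝ) : starRingEnd ℂ (α x u) = α x u :=
  (conj_apply α x u).symm.trans (by rw [h])

namespace IsCartanSystem

variable {n : ℕ} {V : Set (Fin n → ℝ)} {t r o₂ o₃ o₄ : OneForm n} {R S : (Fin n → ℝ) → ℂ}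
  (h : IsCartanSystem V t r o₂ o₃ o₄ R S)
include h

theorem pull {m : ℕ} {f : (Fin m → ℝ) → Fin n → ℝ} {U : Set (Fin m → ℝ)} (hU : IsOpen U)
    (hf : ContDiff ℝ ∞ f) (hfU : Set.MapsTo f U V) :
    IsCartanSystem U (pull f t) (CRFefferman.pull f r) (CRFefferman.pull f o₂)
      (CRFefferman.pull f o₃) (CRFefferman.pull f o₄) (R ∘ f) (S ∘ f) where
  isOpen := hU
  smooth_t := contDiffOn_pull hU hf.contDiffOn h.smooth_t hfU
  smooth_r := contDiffOn_pull hU hf.contDiffOn h.smooth_r hfU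
  smooth_o₂ := contDiffOn_pull hU hf.contDiffOn h.smooth_o₂ hfU
  smooth_o₃ := contDiffOn_pull hU hf.contDiffOn h.smooth_o₃ hfU
  smooth_o₄ := contDiffOn_pull hU hf.contDiffOn h.smooth_o₄ hfU
  smooth_R := h.smooth_R.comp hf.contDiffOn hfU
  smooth_S := h.smooth_S.comp hf.contDiffOn hfU
  real_r x hx := by
    ext u
    exact conj_apply_of_real (h.real_r _ (hfU hx)) _
  real_o₄ x hx := by
    ext u
    exact conj_apply_of_real (h.real_o₄ _ (hfU hx)) _
  d_t x hx := by
    rw [extD_pull (differentiableAt_of_contDiffOn h.isOpen (hfU hx) h.smooth_t) hf.contDiffAt,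
      h.d_t _ (hfU hx)]
    ext v
    simp [wedge₁_apply, CRFefferman.pull]
  d_r x hx := by
    rw [extD_pull (differentiableAt_of_contDiffOn h.isOpen (hfU hx) h.smooth_r) hf.contDiffAt,
      h.d_r _ (hfU hx)]
    ext v
    simp [wedge₁_apply, CRFefferman.pull]
  d_o₂ x hx := by
    rw [extD_pull (differentiableAt_of_contDiffOn h.isOpen (hfU hx) h.smooth_o₂) hf.contDiffAt,
      h.d_o₂ _ (hfU hx)]
    ext v
    simp [wedge₁_apply, CRFefferman.pull]
  d_o₃ x hx := by
    rw [extD_pull (differentiableAt_of_contDiffOn h.isOpen (hfU hx) h.smooth_o₃) hf.contDiffAt,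
      h.d_o₃ _ (hfU hx)]
    ext v
    simp [wedge₁_apply, CRFefferman.pull]
  d_o₄ x hx := by
    rw [extD_pull (differentiableAt_of_contDiffOn h.isOpen (hfU hx) h.smooth_o₄) hf.contDiffAt,
      h.d_o₄ _ (hfU hx)]
    ext v
    simp [wedge₁_apply, CRFefferman.pull]

variable {x : Fin n → ℝ} (hx : x ∈ V)

set_option maxHeartbeats 1000000 in
/-- The gauge transformation by a nonvanishing function `b`. -/
theorem dilate {b : (Fin n → ℝ) → ℂ} (hb : ContDiffOn ℝ ∞ b V) (h0 : ∀ x ∈ V, b x ≠ 0) :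
    IsCartanSystem V (fun x => b x • t x) (fun x => (b x * starRingEnd ℂ (b x)) • r x)
      (fun x => o₂ x + (b x)⁻¹ • fderiv ℝ b x) (fun x => (starRingEnd ℂ (b x))⁻¹ • o₃ x)
      (fun x => (b x * starRingEnd ℂ (b x))⁻¹ • o₄ x)
      (fun x => R x * (b x * starRingEnd ℂ (b x) ^ 3)⁻¹)
      (fun x => S x * (b x ^ 2 * starRingEnd ℂ (b x) ^ 3)⁻¹) := by
  have hc := contDiffOn_star hb
  have hc0 : ∀ x ∈ V, starRingEnd ℂ (b x) ≠ 0 := fun x hx => by simpa using h0 x hx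
  have hbb := hb.mul hc
  have hbb0 : ∀ x ∈ V, b x * starRingEnd ℂ (b x) ≠ 0 := fun x hx => mul_ne_zero (h0 x hx) (hc0 x hx)
  have df : ∀ {f : (Fin n → ℝ) → ℂ} (_ : ContDiffOn ℝ ∞ f V) {x} (_ : x ∈ V),
      DifferentiableAt ℝ f x := fun hf _ hx => differentiableAt_of_contDiffOn h.isOpen hx hf
  have dF : ∀ {f : OneForm n} (_ : ContDiffOn ℝ ∞ f V) {x} (_ : x ∈ V),
      DifferentiableAt ℝ f x := fun hf _ hx => differentiableAt_of_contDiffOn h.isOpen hx hf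
  have hdb : ContDiffOn ℝ ∞ (fderiv ℝ b) V := hb.fderiv_of_isOpen h.isOpen (by simp)
  have ib : ContDiffOn ℝ ∞ (fun x => (b x)⁻¹) V := hb.inv h0
  have ic : ContDiffOn ℝ ∞ (fun x => (starRingEnd ℂ (b x))⁻¹) V := hc.inv hc0
  have ibb : ContDiffOn ℝ ∞ (fun x => (b x * starRingEnd ℂ (b x))⁻¹) V := hbb.inv hbb0
  have finv : ∀ {f : (Fin n → ℝ) → ℂ} (_ : ContDiffOn ℝ ∞ f V) (_ : ∀ x ∈ V, f x ≠ 0) {x}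
      (_ : x ∈ V) (u), fderiv ℝ (fun y => (f y)⁻¹) x u = -(f x)⁻¹ ^ 2 * fderiv ℝ f x u := by
    intro f hf hf0 x hx u
    have e := ((hasDerivAt_inv (hf0 x hx)).hasFDerivAt.restrictScalars ℝ).comp x
      (df hf hx).hasFDerivAt
    have e' : fderiv ℝ (fun y => (f y)⁻¹) x = _ := e.fderiv
    rw [e']
    simp
    ring
  have fc : ∀ x ∈ V, ∀ u, fderiv ℝ (fun y => starRingEnd ℂ (b y)) x u =
      starRingEnd ℂ (fderiv ℝ b x u) := fun x hx u => fderiv_conj_fun (df hb hx) u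
  have fbb : ∀ x ∈ V, ∀ u, fderiv ℝ (fun y => b y * starRingEnd ℂ (b y)) x u =
      b x * starRingEnd ℂ (fderiv ℝ b x u) + starRingEnd ℂ (b x) * fderiv ℝ b x u := by
    intro x hx u
    have e := (df hb hx).hasFDerivAt.fun_mul (df hc hx).hasFDerivAt
    rw [e.fderiv]
    simp only [_root_.add_apply, _root_.smul_apply, smul_eq_mul, fc x hx]
  refine
  { isOpen := h.isOpen
    smooth_t := hb.smul h.smooth_t
    smooth_r := hbb.smul h.smooth_r
    smooth_o₂ := h.smooth_o₂.add ((hb.inv h0).smul hdb)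
    smooth_o₃ := (hc.inv hc0).smul h.smooth_o₃
    smooth_o₄ := (hbb.inv hbb0).smul h.smooth_o₄
    smooth_R := h.smooth_R.mul ((hb.mul (hc.pow 3)).inv fun x hx =>
      mul_ne_zero (h0 x hx) (pow_ne_zero 3 (hc0 x hx)))
    smooth_S := h.smooth_S.mul (((hb.pow 2).mul (hc.pow 3)).inv fun x hx =>
      mul_ne_zero (pow_ne_zero 2 (h0 x hx)) (pow_ne_zero 3 (hc0 x hx)))
    real_r := ?_
    real_o₄ := ?_
    d_t := ?_
    d_r := ?_
    d_o₂ := ?_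
    d_o₃ := ?_
    d_o₄ := ?_ }
  · intro x hx
    ext u
    have e := conj_apply_of_real (h.real_r x hx) u
    simp [e]
    exact Or.inl (mul_comm _ _)
  · intro x hx
    ext u
    have e := conj_apply_of_real (h.real_o₄ x hx) u
    simp [e]
    exact Or.inl (mul_comm _ _)
  · intro x hx
    have b0 := h0 x hx
    have c0 := hc0 x hx
    ext v
    rw [extD_smul_apply (df hb hx) (dF h.smooth_t hx), h.d_t x hx]
    simp
    field_simp
    ring
  · intro x hx
    have b0 := h0 x hx
    have c0 := hc0 x hx
    ext v
    rw [extD_smul_apply (df hbb hx) (dF h.smooth_r hx), h.d_r x hx]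
    simp [fbb x hx]
    field_simp
    ring
  · intro x hx
    have b0 := h0 x hx
    have c0 := hc0 x hx
    have e4 := fun u => conj_apply_of_real (h.real_o₄ x hx) u
    ext v
    rw [extD_add (dF h.smooth_o₂ hx) ((df ib hx).fun_smul (dF hdb hx)),
      ContinuousAlternatingMap.add_apply,
      extD_smul_apply (df ib hx) (dF hdb hx), h.d_o₂ x hx]
    simp [finv hb h0 hx, (hasExtD_fderiv h.isOpen hx hb).eq]
    field_simp
    ring
  · intro x hx
    have b0 := h0 x hx
    have c0 := hc0 x hx
    ext v
    rw [extD_smul_apply (df ic hx) (dF h.smooth_o₃ hx), h.d_o₃ x hx]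
    simp [finv hc hc0 hx, fc x hx]
    field_simp
    ring
  · intro x hx
    have b0 := h0 x hx
    have c0 := hc0 x hx
    ext v
    rw [extD_smul_apply (df ibb hx) (dF h.smooth_o₄ hx), h.d_o₄ x hx]
    simp [-mul_inv_rev, finv hbb hbb0 hx, fbb x hx]
    field_simp
    ring

end IsCartanSystem

theorem HasExtD.const_smul {n : ℕ} {x : Fin n → ℝ} {α : OneForm n}
    {T : (Fin 2 → Fin n → ℝ) → ℂ} (k : ℂ) (h : HasExtD α x T) :
    HasExtD (fun y => k • α y) x (fun v => k * T v) :=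
  ⟨h.diff.const_smul k, fun v => by
    rw [extD_const_smul k h.diff,
      ContinuousAlternatingMap.smul_apply, smul_eq_mul, h.eq]⟩

namespace IsCartanSystem

variable {n : ℕ} {V : Set (Fin n → ℝ)} {t r o₂ o₃ o₄ : OneForm n} {R S : (Fin n → ℝ) → ℂ}
  (h : IsCartanSystem V t r o₂ o₃ o₄ R S)
include h

/-- The gauge transformation by a real function `τ`. -/
theorem boost {τ : (Fin n → ℝ) → ℂ} (hτ : ContDiffOn ℝ ∞ τ V)
    (h0 : ∀ x, starRingEnd ℂ (τ x) = τ x) :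
    IsCartanSystem V t r (fun x => o₂ x + τ x • r x) (fun x => o₃ x + τ x • t x)
      (fun x => o₄ x + (fderiv ℝ τ x + (τ x • (o₂ x + conj o₂ x) + τ x ^ 2 • r x))) R S := by
  have hd : ContDiffOn ℝ ∞ (fderiv ℝ τ) V := hτ.fderiv_of_isOpen h.isOpen (by simp)
  have ex : ∀ {α : OneForm n} (_ : ContDiffOn ℝ ∞ α V) {x} (_ : x ∈ V), HasExtD α x
    (fun v => extD α x v) := fun hα _ hx => hasExtD_of_contDiffOn h.isOpen hx hα
  have hF : ∀ x ∈ V, HasFDerivAt τ (fderiv ℝ τ x) x := fun x hx =>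
    (differentiableAt_of_contDiffOn h.isOpen hx hτ).hasFDerivAt
  have dreal : ∀ x ∈ V, ∀ u, starRingEnd ℂ (fderiv ℝ τ x u) = fderiv ℝ τ x u := by
    intro x hx u
    rw [← fderiv_conj_fun (hF x hx).differentiableAt]
    simp only [h0]
  refine
  { isOpen := h.isOpen
    smooth_t := h.smooth_t
    smooth_r := h.smooth_r
    smooth_o₂ := h.smooth_o₂.add (hτ.smul h.smooth_r)
    smooth_o₃ := h.smooth_o₃.add (hτ.smul h.smooth_t)
    smooth_o₄ := h.smooth_o₄.add (hd.add ((hτ.smul (h.smooth_o₂.add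
      (contDiffOn_conj h.smooth_o₂))).add ((hτ.pow 2).smul h.smooth_r)))
    smooth_R := h.smooth_R
    smooth_S := h.smooth_S
    real_r := h.real_r
    real_o₄ := ?_
    d_t := ?_
    d_r := ?_
    d_o₂ := ?_
    d_o₃ := ?_
    d_o₄ := ?_ }
  all_goals
    intro x hx
    have er := fun u => conj_apply_of_real (h.real_r x hx) u
    have e4 := fun u => conj_apply_of_real (h.real_o₄ x hx) u
    ext v
  · simp [er, e4, h0, dreal x hx, add_comm]
  · rw [h.d_t x hx]
    simp
    ring
  · rw [h.d_r x hx]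
    simp [er, h0]
    ring
  · rw [((ex h.smooth_o₂ hx).add ((ex h.smooth_r hx).smul (hF x hx))).eq,
      h.d_o₂ x hx, h.d_r x hx]
    simp [h0]
    ring
  · rw [((ex h.smooth_o₃ hx).add ((ex h.smooth_t hx).smul (hF x hx))).eq,
      h.d_o₃ x hx, h.d_t x hx]
    simp [er, h0]
    ring
  · rw [((ex h.smooth_o₄ hx).add ((hasExtD_fderiv h.isOpen hx hτ).add
      ((((ex h.smooth_o₂ hx).add (ex h.smooth_o₂ hx).conj).smul (hF x hx)).add
      ((ex h.smooth_r hx).smul ((hF x hx).pow 2))))).eq,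
      h.d_o₄ x hx, h.d_o₂ x hx, h.d_r x hx]
    simp [er, e4, h0, Complex.conj_ofNat]
    ring

set_option maxHeartbeats 2000000 in
/-- The gauge transformation by a complex function `c`. -/
theorem shear {c : (Fin n → ℝ) → ℂ} (hc : ContDiffOn ℝ ∞ c V) :
    IsCartanSystem V (fun x => t x + c x • r x) r
      (fun x => o₂ x + ((-(2 * Complex.I)) • starRingEnd ℂ (c x) • t x
        + ((-Complex.I) • c x • conj t x
        + (-(3 * Complex.I / 2)) • (c x * starRingEnd ℂ (c x)) • r x)))
      (fun x => o₃ x + (c x • conj o₂ x + (fderiv ℝ c x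
        + ((Complex.I / 2) • (c x * starRingEnd ℂ (c x)) • t x + (Complex.I • c x ^ 2 • conj t x
        + (Complex.I / 2) • (c x ^ 2 * starRingEnd ℂ (c x)) • r x)))))
      (fun x => o₄ x + ((Complex.I / 2) • (c x * starRingEnd ℂ (c x)) •
          (o₂ x + (-1 : ℂ) • conj o₂ x)
        + (Complex.I • c x • conj o₃ x + ((-Complex.I) • starRingEnd ℂ (c x) • o₃ x
        + ((1 / 2 : ℂ) • (c x * starRingEnd ℂ (c x) ^ 2) • t x
        + ((1 / 2 : ℂ) • (c x ^ 2 * starRingEnd ℂ (c x)) • conj t x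
        + ((1 / 4 : ℂ) • (c x ^ 2 * starRingEnd ℂ (c x) ^ 2) • r x
        + ((-(Complex.I / 2)) • starRingEnd ℂ (c x) • fderiv ℝ c x
        + (Complex.I / 2) • c x • conj (fderiv ℝ c) x))))))))
      R (fun x => S x + (-Complex.I) * (starRingEnd ℂ (c x) * R x)) := by
  have hd : ContDiffOn ℝ ∞ (fderiv ℝ c) V := hc.fderiv_of_isOpen h.isOpen (by simp)
  have hs := contDiffOn_star hc
  have htb := contDiffOn_conj h.smooth_t
  have h2b := contDiffOn_conj h.smooth_o₂
  have h3b := contDiffOn_conj h.smooth_o₃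
  have hdb := contDiffOn_conj hd
  have ex : ∀ {α : OneForm n} (_ : ContDiffOn ℝ ∞ α V) {x} (_ : x ∈ V), HasExtD α x
    (fun v => extD α x v) := fun hα _ hx => hasExtD_of_contDiffOn h.isOpen hx hα
  have hF : ∀ x ∈ V, HasFDerivAt c (fderiv ℝ c x) x := fun x hx =>
    (differentiableAt_of_contDiffOn h.isOpen hx hc).hasFDerivAt
  have hG : ∀ x ∈ V, HasFDerivAt (fun y => starRingEnd ℂ (c y)) _ x := fun x hx =>
    hasFDerivAt_star (hF x hx)
  refine
  { isOpen := h.isOpen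
    smooth_t := h.smooth_t.add (hc.smul h.smooth_r)
    smooth_r := h.smooth_r
    smooth_o₂ := h.smooth_o₂.add (((hs.smul h.smooth_t).const_smul _).add
      (((hc.smul htb).const_smul _).add (((hc.mul hs).smul h.smooth_r).const_smul _)))
    smooth_o₃ := h.smooth_o₃.add ((hc.smul h2b).add (hd.add
      ((((hc.mul hs).smul h.smooth_t).const_smul _).add ((((hc.pow 2).smul htb).const_smul _).add
      ((((hc.pow 2).mul hs).smul h.smooth_r).const_smul _)))))
    smooth_o₄ := h.smooth_o₄.add ((((hc.mul hs).smul
        (h.smooth_o₂.add (h2b.const_smul _))).const_smul _).add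
      (((hc.smul h3b).const_smul _).add (((hs.smul h.smooth_o₃).const_smul _).add
      ((((hc.mul (hs.pow 2)).smul h.smooth_t).const_smul _).add
      (((((hc.pow 2).mul hs).smul htb).const_smul _).add
      (((((hc.pow 2).mul (hs.pow 2)).smul h.smooth_r).const_smul _).add
      (((hs.smul hd).const_smul _).add ((hc.smul hdb).const_smul _))))))))
    smooth_R := h.smooth_R
    smooth_S := h.smooth_S.add (contDiffOn_const.mul (hs.mul h.smooth_R))
    real_r := h.real_r
    real_o₄ := ?_
    d_t := ?_
    d_r := ?_
    d_o₂ := ?_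
    d_o₃ := ?_
    d_o₄ := ?_ }
  all_goals
    intro x hx
    have er := fun u => conj_apply_of_real (h.real_r x hx) u
    have e4 := fun u => conj_apply_of_real (h.real_o₄ x hx) u
    ext v
  · simp [er, e4, Complex.conj_ofNat]
    ring
  · rw [((ex h.smooth_t hx).add ((ex h.smooth_r hx).smul (hF x hx))).eq, h.d_t x hx, h.d_r x hx]
    simp
    ring
  · rw [h.d_r x hx]
    simp [er, Complex.conj_ofNat]
    ring
  · rw [((ex h.smooth_o₂ hx).add ((((ex h.smooth_t hx).smul (hG x hx)).const_smul _).add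
      ((((ex h.smooth_t hx).conj.smul (hF x hx)).const_smul _).add
      (((ex h.smooth_r hx).smul ((hF x hx).fun_mul (hG x hx))).const_smul _)))).eq,
      h.d_o₂ x hx, h.d_r x hx, h.d_t x hx]
    simp [er, Complex.conj_ofNat]
    ring_nf
    simp only [Complex.I_sq]
    ring
  · rw [((ex h.smooth_o₃ hx).add (((ex h.smooth_o₂ hx).conj.smul (hF x hx)).add
      ((hasExtD_fderiv h.isOpen hx hc).add
      ((((ex h.smooth_t hx).smul ((hF x hx).fun_mul (hG x hx))).const_smul _).add
      ((((ex h.smooth_t hx).conj.smul ((hF x hx).pow 2)).const_smul _).add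
      (((ex h.smooth_r hx).smul (((hF x hx).pow 2).fun_mul (hG x hx))).const_smul _)))))).eq,
      h.d_o₃ x hx, h.d_o₂ x hx, h.d_r x hx, h.d_t x hx]
    simp [er, e4, Complex.conj_ofNat]
    ring_nf
    simp only [Complex.I_sq]
    ring
  · rw [((ex h.smooth_o₄ hx).add (((((ex h.smooth_o₂ hx).add
      ((ex h.smooth_o₂ hx).conj.const_smul _)).smul ((hF x hx).fun_mul (hG x hx))).const_smul _).add
      ((((ex h.smooth_o₃ hx).conj.smul (hF x hx)).const_smul _).add
      ((((ex h.smooth_o₃ hx).smul (hG x hx)).const_smul _).add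
      ((((ex h.smooth_t hx).smul ((hF x hx).fun_mul ((hG x hx).pow 2))).const_smul _).add
      ((((ex h.smooth_t hx).conj.smul (((hF x hx).pow 2).fun_mul (hG x hx))).const_smul _).add
      ((((ex h.smooth_r hx).smul (((hF x hx).pow 2).fun_mul ((hG x hx).pow 2))).const_smul _).add
      ((((hasExtD_fderiv h.isOpen hx hc).smul (hG x hx)).const_smul _).add
      (((hasExtD_fderiv h.isOpen hx hc).conj.smul (hF x hx)).const_smul _))))))))).eq,
      h.d_o₄ x hx, h.d_o₃ x hx, h.d_o₂ x hx, h.d_r x hx, h.d_t x hx]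
    simp [er, e4, Complex.conj_ofNat]
    ring_nf
    simp only [Complex.I_sq, Complex.I_pow_three]
    ring

end IsCartanSystem

/-! ### Solution of the structure equations in three dimensions -/

namespace IsFrame₃

variable {V : Set (Fin 3 → ℝ)} {t r : OneForm 3} (hf : IsFrame₃ V t r)
include hf

theorem exists_extD_coeff {α : OneForm 3} (hα : ContDiffOn ℝ ∞ α V) : ∃ A B C : (Fin 3 → ℝ) → ℂ,
    ContDiffOn ℝ ∞ A V ∧ ContDiffOn ℝ ∞ B V ∧ ContDiffOn ℝ ∞ C V ∧ ∀ x ∈ V, extD α x =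
      A x • wedge₁ (t x) (conj t x) + B x • wedge₁ (t x) (r x) + C x • wedge₁ (conj t x) (r x) :=
  hf.exists_coeff (contDiffOn_extD hf.isOpen hα)

theorem real_apply {x : Fin 3 → ℝ} (hx : x ∈ V) (u : Fin 3 → ℝ) :
    starRingEnd ℂ (r x u) = r x u := conj_apply_of_real (hf.real x hx) u

/-- Multiplication by `r` isolates the `t∧t̄` coefficient, so `D` need not be expanded in the frame.
-/
theorem coeff_left {x : Fin 3 → ℝ} (hx : x ∈ V) {A B C A' : ℂ} {D : Cov 3}
    (h : ∀ v, (A • wedge₁ (t x) (conj t x) + B • wedge₁ (t x) (r x)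
      + C • wedge₁ (conj t x) (r x)) v =
      (A' • wedge₁ (t x) (conj t x) + wedge₁ D (r x)) v) : A = A' := by
  have h0 := hf.vol_ne x hx
  have h1 : wedge (r x) (A • wedge₁ (t x) (conj t x) + B • wedge₁ (t x) (r x)
        + C • wedge₁ (conj t x) (r x)) stdBasis₃ =
      wedge (r x) (A' • wedge₁ (t x) (conj t x) + wedge₁ D (r x)) stdBasis₃ := by
    rw [wedge_two_apply, wedge_two_apply, h, h, h]
  simp only [wedge_two_apply, wedge₁_apply, ContinuousAlternatingMap.add_apply,
    ContinuousAlternatingMap.smul_apply, smul_eq_mul, Matrix.cons_val_zero,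
    Matrix.cons_val_one] at h0 h1
  generalize conj t x = tb at *
  refine mul_right_cancel₀ h0 ?_
  linear_combination h1

section Bianchi

variable {x : Fin 3 → ℝ} (hx : x ∈ V) (hr : ∀ y ∈ V, extD r y = Complex.I • wedge₁ (t y) (conj t y))
include hx hr

/-- This is `d(dr) = 0` for `dr = i t∧t̄`. -/
theorem coeff_add_conj {A B C : ℂ} (ht : extD t x = A • wedge₁ (t x) (conj t x)
    + B • wedge₁ (t x) (r x) + C • wedge₁ (conj t x) (r x)) : B + starRingEnd ℂ B = 0 := by
  have h0 := hf.vol_ne x hx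
  have dt := differentiableAt_of_contDiffOn hf.isOpen hx hf.smooth_t
  have h := sum_wedge_extD_eq_zero hf.isOpen hx hf.smooth_r (m := 1) (a := ![t]) (b := ![conj t])
    (k := ![Complex.I]) (by simpa using hf.smooth_t) (by simpa using hf.smooth_tb)
    (by simpa using hr) stdBasis₃
  simp [wedge_two_apply, wedge₁_apply, extD_conj_apply dt, ht, hf.real_apply hx] at h h0
  refine mul_right_cancel₀ h0 ?_
  linear_combination -h

variable {o₂ o₃ o₄ : OneForm 3} (s₂ : ContDiffOn ℝ ∞ o₂ V) (s₃ : ContDiffOn ℝ ∞ o₃ V)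
  (s₄ : ContDiffOn ℝ ∞ o₄ V)
  (ht : ∀ y ∈ V, extD t y = wedge₁ (o₂ y) (t y) + wedge₁ (o₃ y) (r y))
  (h2 : ∀ y ∈ V, extD o₂ y = (2 * Complex.I) • wedge₁ (t y) (conj o₃ y)
    + Complex.I • wedge₁ (conj t y) (o₃ y) + wedge₁ (o₄ y) (r y))
  {A B C A' B' C' : ℂ}
  (h3 : extD o₃ x = wedge₁ (o₄ x) (t x) + wedge₁ (o₃ x) (conj o₂ x)
    + (A • wedge₁ (t x) (conj t x) + B • wedge₁ (t x) (r x) + C • wedge₁ (conj t x) (r x)))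
  (h4 : extD o₄ x = Complex.I • wedge₁ (o₃ x) (conj o₃ x) + wedge₁ (o₄ x) (o₂ x + conj o₂ x)
    + (A' • wedge₁ (t x) (conj t x) + B' • wedge₁ (t x) (r x) + C' • wedge₁ (conj t x) (r x)))
include s₂ s₃ ht h2 h3

/-- This is `d(dt) = 0`: with `o₂` imaginary, the only term that does not cancel is `A t∧t̄∧r`. -/
theorem bianchi_t (i2 : ∀ y ∈ V, conj o₂ y = - o₂ y) : A = 0 := by
  have h0 := hf.vol_ne x hx
  have dt := differentiableAt_of_contDiffOn hf.isOpen hx hf.smooth_t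
  have h := sum_wedge_extD_eq_zero hf.isOpen hx hf.smooth_t (m := 2) (a := ![o₂, o₃])
    (b := ![t, r]) (k := ![1, 1]) (by simp [Fin.forall_fin_two, s₂, s₃])
    (by simp [Fin.forall_fin_two, hf.smooth_t, hf.smooth_r]) (by simpa using ht) stdBasis₃
  have i := fun u => congrArg (fun T => T u) (i2 x hx)
  simp [Fin.sum_univ_two, wedge_two_apply, wedge₁_apply, h2 x hx, h3, ht x hx, hr x hx] at h h0 i
  refine mul_right_cancel₀ h0 ?_
  simp [i] at h
  linear_combination h

include s₄ h4

/-- The `t∧t̄∧r` coefficient of `d(do₂) = 0`. It is used twice: to show that `B` is real, and, after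
`B` has been removed, to show that `A' = 0`. -/
theorem bianchi_o₂ (i2 : ∀ y ∈ V, conj o₂ y = - o₂ y) (r4 : ∀ y ∈ V, conj o₄ y = o₄ y) :
    -2 * Complex.I * starRingEnd ℂ B + Complex.I * B + A' = 0 := by
  have hA := hf.bianchi_t hx hr s₂ s₃ ht h2 h3 i2
  have h0 := hf.vol_ne x hx
  have dt := differentiableAt_of_contDiffOn hf.isOpen hx hf.smooth_t
  have d3 := differentiableAt_of_contDiffOn hf.isOpen hx s₃
  have h := sum_wedge_extD_eq_zero hf.isOpen hx s₂ (m := 3) (a := ![t, conj t, o₄])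
    (b := ![conj o₃, o₃, r]) (k := ![2 * Complex.I, Complex.I, 1])
    (by simp [Fin.forall_fin_succ, s₄, hf.smooth_t, hf.smooth_tb])
    (by simp [Fin.forall_fin_succ, s₃, contDiffOn_conj s₃, hf.smooth_r])
    (by simpa [Fin.sum_univ_three] using h2) stdBasis₃
  have i := fun u => congrArg (fun T => T u) (i2 x hx)
  have e := hf.real_apply hx
  have e4 := conj_apply_of_real (r4 x hx)
  simp [hA, Fin.sum_univ_three, wedge_two_apply, wedge₁_apply, extD_conj_apply dt,
    extD_conj_apply d3, h4, h3, ht x hx, hr x hx, e, e4] at h h0 i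
  refine mul_right_cancel₀ h0 ?_
  simp [i] at h
  linear_combination h

end Bianchi

end IsFrame₃

namespace IsFrame₃

variable {V : Set (Fin 3 → ℝ)} {t r : OneForm 3} (hf : IsFrame₃ V t r)
include hf

/-- The forms `Ω₂`, `Ω₃` and a particular `Ω₄` satisfying the first three structure equations. -/
theorem exists_connection
    (hr : ∀ y ∈ V, extD r y = Complex.I • wedge₁ (t y) (conj t y)) : ∃ o₂ o₃ o₄ : OneForm 3,
    ContDiffOn ℝ ∞ o₂ V ∧ ContDiffOn ℝ ∞ o₃ V ∧ ContDiffOn ℝ ∞ o₄ V ∧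
    (∀ y ∈ V, conj o₂ y = -o₂ y) ∧ (∀ y ∈ V, conj o₄ y = o₄ y) ∧
    (∀ y ∈ V, extD t y = wedge₁ (o₂ y) (t y) + wedge₁ (o₃ y) (r y)) ∧
    (∀ y ∈ V, extD o₂ y = (2 * Complex.I) • wedge₁ (t y) (conj o₃ y)
      + Complex.I • wedge₁ (conj t y) (o₃ y) + wedge₁ (o₄ y) (r y)) := by
  obtain ⟨α, β, γ, sα, sβ, sγ, ht⟩ := hf.exists_extD_coeff hf.smooth_t
  have sα' := contDiffOn_star sα
  have hβ : ∀ x ∈ V, starRingEnd ℂ (β x) = -β x := fun x hx =>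
    eq_neg_of_add_eq_zero_right (hf.coeff_add_conj hx hr (ht x hx))
  -- The imaginary form `w` is chosen so that `w∧t` reproduces the `t∧t̄` part of `dt`.
  set w : OneForm 3 := fun y => starRingEnd ℂ (α y) • t y - α y • conj t y with hw
  have sw : ContDiffOn ℝ ∞ w V := (sα'.smul hf.smooth_t).sub (sα.smul hf.smooth_tb)
  have iw : ∀ y ∈ V, conj w y = -w y := fun y _ => by
    ext u
    simp [hw]
  obtain ⟨a, b, c, sa, -, -, dw⟩ := hf.exists_extD_coeff sw
  have ha : ∀ x ∈ V, starRingEnd ℂ (a x) = a x := fun x hx => by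
    have h := (hf.coeff_conj hx (dw x hx) (ε := -1) fun v => by
      rw [star_extD_of_imag hf.isOpen hx (differentiableAt_of_contDiffOn hf.isOpen hx sw) iw,
        neg_one_mul]).1
    simpa using h
  -- Comparison of the `t∧t̄` coefficients in the equation for `do₂` reads `a + iσ = -3i(β + σ)`,
  -- which determines `σ`.
  set σ : (Fin 3 → ℝ) → ℂ := fun y => (Complex.I / 4) * (a y + 3 * Complex.I * β y) with hσ
  have sσ : ContDiffOn ℝ ∞ σ V := contDiffOn_const.mul (sa.add (contDiffOn_const.mul sβ))
  have iσ : ∀ x ∈ V, starRingEnd ℂ (σ x) = -σ x := fun x hx => by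
    simp [hσ, ha x hx, hβ x hx, Complex.conj_ofNat]
    ring
  set o₂ : OneForm 3 := fun y => w y + σ y • r y with ho₂
  have s₂ : ContDiffOn ℝ ∞ o₂ V := sw.add (sσ.smul hf.smooth_r)
  have i₂ : ∀ y ∈ V, conj o₂ y = -o₂ y := fun y hy => by
    ext u
    simp [ho₂, hw, hf.real_apply hy, iσ y hy]
    ring
  obtain ⟨a', q, q', -, sq, sq', d₂⟩ := hf.exists_extD_coeff s₂
  have ha' : ∀ x ∈ V, a' x = a x + Complex.I * σ x := fun x hx => by
    refine hf.coeff_left hx (B := q x) (C := q' x)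
      (D := b x • t x + c x • conj t x + fderiv ℝ σ x) fun v => ?_
    have h1 := ((hasExtD_of_contDiffOn hf.isOpen hx sw).add
      ((hasExtD_of_contDiffOn hf.isOpen hx hf.smooth_r).smul
      (differentiableAt_of_contDiffOn hf.isOpen hx sσ).hasFDerivAt)).eq v
    rw [← d₂ x hx]
    refine h1.trans ?_
    simp [dw x hx, hr x hx]
    ring
  have hq : ∀ x ∈ V, starRingEnd ℂ (q' x) = -q x := fun x hx => by
    have h := (hf.coeff_conj hx (d₂ x hx) (ε := -1) fun v => by
      rw [star_extD_of_imag hf.isOpen hx (differentiableAt_of_contDiffOn hf.isOpen hx s₂) i₂,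
        neg_one_mul]).2.1
    simpa using h
  have hq' : ∀ x ∈ V, starRingEnd ℂ (q x) = -q' x := fun x hx => by
    have h := congrArg (starRingEnd ℂ) (hq x hx)
    rw [Complex.conj_conj, map_neg] at h
    rw [h, neg_neg]
  -- The `r` coefficient `κ` of `o₃` and the `t`, `t̄` coefficients of `o₄` solve the `t∧r` and
  -- `t̄∧r` parts of the equation for `do₂`. Reality of `o₄` gives `3iκ = 2q'`, hence the factor
  -- `-2i/3` and the thirds in `o₄`.
  refine ⟨o₂, fun y => (β y + σ y) • t y + γ y • conj t y
      + ((-(2 * Complex.I / 3)) * q' y) • r y,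
    fun y => (1 / 3 : ℂ) • (-q y) • t y + (1 / 3 : ℂ) • q' y • conj t y, s₂,
    (((sβ.add sσ).smul hf.smooth_t).add (sγ.smul hf.smooth_tb)).add
      ((contDiffOn_const.mul sq').smul hf.smooth_r),
    ((sq.neg.smul hf.smooth_t).const_smul _).add ((sq'.smul hf.smooth_tb).const_smul _),
    i₂, fun y hy => ?_, fun y hy => ?_, fun y hy => ?_⟩
  · ext u
    simp [hq y hy, hq' y hy, Complex.conj_ofNat]
    ring
  · rw [ht y hy]
    ext v
    simp [ho₂, hw]
    ring
  · rw [d₂ y hy]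
    ext v
    simp [ha' y hy, hf.real_apply hy, hq y hy, hβ y hy, iσ y hy]
    simp [hσ, Complex.conj_ofNat]
    ring_nf
    simp only [Complex.I_sq, Complex.I_pow_three]
    ring

/-- Cartan's structure equations have a solution over a frame with `dr = i t ∧ t̄`. -/
theorem exists_isCartanSystem
    (hr : ∀ y ∈ V, extD r y = Complex.I • wedge₁ (t y) (conj t y)) :
    ∃ (o₂ o₃ o₄ : OneForm 3) (R S : (Fin 3 → ℝ) → ℂ), IsCartanSystem V t r o₂ o₃ o₄ R S := by
  obtain ⟨o₂, o₃, w, s₂, s₃, sw, i₂, rw', ht, h₂⟩ := hf.exists_connection hr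
  have hX : ∀ {o₄ : OneForm 3}, ContDiffOn ℝ ∞ o₄ V → ∃ A B C : (Fin 3 → ℝ) → ℂ,
      ContDiffOn ℝ ∞ A V ∧ ContDiffOn ℝ ∞ B V ∧ ContDiffOn ℝ ∞ C V ∧ ∀ x ∈ V, extD o₃ x =
        wedge₁ (o₄ x) (t x) + wedge₁ (o₃ x) (conj o₂ x) + (A x • wedge₁ (t x) (conj t x)
        + B x • wedge₁ (t x) (r x) + C x • wedge₁ (conj t x) (r x)) := fun {o₄} s₄ => by
    obtain ⟨A, B, C, sA, sB, sC, h⟩ := hf.exists_coeff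
      (T := fun x => extD o₃ x - (wedge₁ (o₄ x) (t x) + wedge₁ (o₃ x) (conj o₂ x))) fun v =>
        (contDiffOn_extD hf.isOpen s₃ v).sub ((contDiffOn_wedge₁ s₄ hf.smooth_t v).add
          (contDiffOn_wedge₁ s₃ (contDiffOn_conj s₂) v))
    exact ⟨A, B, C, sA, sB, sC, fun x hx => by rw [← h x hx, add_sub_cancel]⟩
  have hY : ∀ {o₄ : OneForm 3}, ContDiffOn ℝ ∞ o₄ V → (∀ y ∈ V, conj o₄ y = o₄ y) →
      ∃ A B C : (Fin 3 → ℝ) → ℂ, ContDiffOn ℝ ∞ C V ∧ ∀ x ∈ V, extD o₄ x =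
        Complex.I • wedge₁ (o₃ x) (conj o₃ x) + wedge₁ (o₄ x) (o₂ x + conj o₂ x)
        + (A x • wedge₁ (t x) (conj t x) + B x • wedge₁ (t x) (r x)
        + C x • wedge₁ (conj t x) (r x)) ∧ starRingEnd ℂ (A x) = -A x ∧
        starRingEnd ℂ (C x) = B x := fun {o₄} s₄ r₄ => by
    obtain ⟨A, B, C, -, -, sC, h⟩ := hf.exists_coeff
      (T := fun x => extD o₄ x - (Complex.I • wedge₁ (o₃ x) (conj o₃ x)
        + wedge₁ (o₄ x) (o₂ x + conj o₂ x))) fun v =>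
        (contDiffOn_extD hf.isOpen s₄ v).sub (((contDiffOn_wedge₁ s₃ (contDiffOn_conj s₃)
          v).const_smul Complex.I).add
          (contDiffOn_wedge₁ s₄ (s₂.add (contDiffOn_conj s₂)) v))
    refine ⟨A, B, C, sC, fun x hx => ⟨by rw [← h x hx, add_sub_cancel], ?_⟩⟩
    have e4 := conj_apply_of_real (r₄ x hx)
    have h1 := hf.coeff_conj hx (h x hx) (ε := 1) fun v => by
      have e := star_extD_of_real hf.isOpen hx
        (differentiableAt_of_contDiffOn hf.isOpen hx s₄) r₄ v
      simp [e, e4]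
      ring
    simp only [one_mul] at h1
    exact ⟨neg_eq_iff_eq_neg.1 h1.1, h1.2.1⟩
  obtain ⟨A, X, R, -, sX, sR, h₃⟩ := hX sw
  obtain ⟨A', B', C', -, h₄⟩ := hY sw rw'
  have hA : ∀ x ∈ V, A x = 0 := fun x hx => hf.bianchi_t hx hr s₂ s₃ ht h₂ (h₃ x hx) i₂
  have rX : ∀ x ∈ V, starRingEnd ℂ (X x) = X x := fun x hx => by
    have h1 := hf.bianchi_o₂ hx hr s₂ s₃ sw ht h₂ (h₃ x hx) (h₄ x hx).1 i₂ rw'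
    have h2 := congrArg (starRingEnd ℂ) h1
    simp [(h₄ x hx).2.1, Complex.conj_ofNat] at h2
    have h3 : (3 * Complex.I) * (starRingEnd ℂ (X x)) = (3 * Complex.I) * X x := by
      linear_combination -h1 - h2
    exact mul_left_cancel₀ (by simp) h3
  -- The equation for `do₂` leaves the `r` component of `o₄` free. It is used to absorb the `t∧r`
  -- coefficient `X` of `do₃`, which is permitted because `X` is real.
  set o₄ : OneForm 3 := fun y => w y - X y • r y with ho₄
  have s₄ : ContDiffOn ℝ ∞ o₄ V := sw.sub (sX.smul hf.smooth_r)
  have r₄ : ∀ y ∈ V, conj o₄ y = o₄ y := fun y hy => by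
    ext u
    simp [ho₄, hf.real_apply hy, rX y hy, conj_apply_of_real (rw' y hy)]
  have h₂' : ∀ y ∈ V, extD o₂ y = (2 * Complex.I) • wedge₁ (t y) (conj o₃ y)
      + Complex.I • wedge₁ (conj t y) (o₃ y) + wedge₁ (o₄ y) (r y) := fun y hy => by
    rw [h₂ y hy]
    ext v
    simp [ho₄]
    ring
  have h₃' : ∀ y ∈ V, extD o₃ y = wedge₁ (o₄ y) (t y) + wedge₁ (o₃ y) (conj o₂ y)
      + ((0 : ℂ) • wedge₁ (t y) (conj t y) + (0 : ℂ) • wedge₁ (t y) (r y)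
      + R y • wedge₁ (conj t y) (r y)) := fun y hy => by
    rw [h₃ y hy, hA y hy]
    ext v
    simp [ho₄]
    ring
  obtain ⟨A₄, S', S, sS, h₄'⟩ := hY s₄ r₄
  have hA₄ : ∀ x ∈ V, A₄ x = 0 := fun x hx => by
    simpa using hf.bianchi_o₂ hx hr s₂ s₃ s₄ ht h₂' (h₃' x hx) (h₄' x hx).1 i₂ r₄
  refine ⟨o₂, o₃, o₄, R, S, hf.isOpen, hf.smooth_t, hf.smooth_r, s₂, s₃, s₄, sR, sS, hf.real, r₄,
    ht, fun x hx => ?_, h₂', fun x hx => ?_, fun x hx => ?_⟩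
  · have e := fun u => congrArg (fun T => T u) (i₂ x hx)
    rw [hr x hx]
    ext v
    simp at e
    simp [e]
  · rw [h₃' x hx]
    ext v
    simp
  · rw [(h₄' x hx).1, (h₄' x hx).2.2, hA₄ x hx]
    ext v
    simp
    ring

end IsFrame₃

/-! ### Normalized frames of a CR structure -/

theorem conj_ofRealForm {n : ℕ} (α : (Fin n → ℝ) → (Fin n → ℝ) →L[ℝ] ℝ) (x : Fin n → ℝ) :
    conj (ofRealForm α) x = ofRealForm α x := by
  ext u
  simp

namespace IsFrame₃

variable {V : Set (Fin 3 → ℝ)} {t r : OneForm 3} (hf : IsFrame₃ V t r)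
include hf

theorem smul {a : (Fin 3 → ℝ) → ℂ} (sa : ContDiffOn ℝ ∞ a V)
    (ra : ∀ x ∈ V, starRingEnd ℂ (a x) = a x) (a0 : ∀ x ∈ V, a x ≠ 0) :
    IsFrame₃ V t (fun x => a x • r x) where
  isOpen := hf.isOpen
  smooth_t := hf.smooth_t
  smooth_r := sa.smul hf.smooth_r
  real x hx := by
    ext u
    simp [ra x hx, hf.real_apply hx]
  vol_ne x hx := by
    rw [wedge_smul_left, ContinuousAlternatingMap.smul_apply, smul_eq_mul]
    exact mul_ne_zero (a0 x hx) (hf.vol_ne x hx)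

theorem add {k : (Fin 3 → ℝ) → ℂ} (sk : ContDiffOn ℝ ∞ k V) :
    IsFrame₃ V (fun x => t x + k x • r x) r where
  isOpen := hf.isOpen
  smooth_t := hf.smooth_t.add (sk.smul hf.smooth_r)
  smooth_r := hf.smooth_r
  real := hf.real
  vol_ne x hx := by
    have h := hf.vol_ne x hx
    contrapose! h
    rw [← h]
    simp [wedge_two_apply, wedge₁_apply, hf.real_apply hx]
    ring

end IsFrame₃

namespace CRStructure

variable {N : Set (Fin 3 → ℝ)} (hN : IsOpen N) (cr : CRStructure N)
include hN

theorem isFrame₃ : IsFrame₃ N cr.mu (ofRealForm cr.lam) where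
  isOpen := hN
  smooth_t := cr.mu_smooth
  smooth_r := contDiffOn_ofRealForm cr.lam_smooth
  real x _ := conj_ofRealForm _ x
  vol_ne x hx h := cr.indep x hx (alt_three_ext h)

/-- A frame adapted to a nondegenerate CR structure, with `dr = i t ∧ t̄`. -/
theorem exists_normalized_frame (hcr : cr.Nondegenerate) : ∃ t r : OneForm 3, IsFrame₃ N t r ∧
    (∀ y ∈ N, extD r y = Complex.I • wedge₁ (t y) (conj t y)) ∧
    ∀ y ∈ N, ∃ (a : ℝ) (c : ℂ), a ≠ 0 ∧ t y = cr.mu y + c • ofRealForm cr.lam y ∧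
      r y = (a : ℂ) • ofRealForm cr.lam y := by
  have hf := cr.isFrame₃ hN
  obtain ⟨h, B, C, sh, -, -, hd⟩ := hf.exists_extD_coeff hf.smooth_r
  have ih : ∀ x ∈ N, starRingEnd ℂ (h x) = -h x := fun x hx => by
    have e := (hf.coeff_conj hx (hd x hx) (ε := 1) fun v => by
      rw [star_extD_of_real hN hx (differentiableAt_of_contDiffOn hN hx hf.smooth_r) hf.real,
        one_mul]).1
    rw [one_mul] at e
    exact neg_eq_iff_eq_neg.1 e
  have h0 : ∀ x ∈ N, h x ≠ 0 := fun x hx e => hcr x hx (by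
    rw [hd x hx, e]
    refine alt_three_ext ?_
    simp [wedge_two_apply, wedge₁_apply]
    ring)
  -- Rescaling `λ` by `i/h` turns the coefficient `h` of `μ∧μ̄` in `dλ` into `i`; the factor is real
  -- because `h` is imaginary, and `h ≠ 0` is nondegeneracy.
  set a : (Fin 3 → ℝ) → ℂ := fun x => Complex.I * (h x)⁻¹ with ha
  have sa : ContDiffOn ℝ ∞ a N := contDiffOn_const.mul (sh.inv h0)
  have ra : ∀ x ∈ N, starRingEnd ℂ (a x) = a x := fun x hx => by
    simp [ha, ih x hx, inv_neg]
  have a0 : ∀ x ∈ N, a x ≠ 0 := fun x hx => mul_ne_zero Complex.I_ne_zero (inv_ne_zero (h0 x hx))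
  set r : OneForm 3 := fun x => a x • ofRealForm cr.lam x with hr
  have hf' : IsFrame₃ N cr.mu r := hf.smul sa ra a0
  obtain ⟨A, p, q, -, -, sq, hd'⟩ := hf'.exists_extD_coeff hf'.smooth_r
  have hA : ∀ x ∈ N, A x = Complex.I := fun x hx => by
    refine hf'.coeff_left hx (B := p x) (C := q x)
      (D := (a x)⁻¹ • fderiv ℝ a x + B x • cr.mu x + C x • conj cr.mu x) fun v => ?_
    rw [← hd' x hx, extD_smul_apply (differentiableAt_of_contDiffOn hN hx sa)
      (differentiableAt_of_contDiffOn hN hx hf.smooth_r), hd x hx]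
    have e := h0 x hx
    have e' := a0 x hx
    have e2 : a x * h x = Complex.I := by
      rw [ha]
      field_simp
    rw [← e2]
    simp [hr]
    field_simp
    ring
  have hq : ∀ x ∈ N, starRingEnd ℂ (q x) = p x := fun x hx => by
    simpa using (hf'.coeff_conj hx (hd' x hx) (ε := 1) fun v => by
      rw [star_extD_of_real hN hx (differentiableAt_of_contDiffOn hN hx hf'.smooth_r) hf'.real,
        one_mul]).2.1
  -- Replacing `μ` by `μ + k r` changes `i μ∧μ̄` by `i k̄ μ∧r - i k μ̄∧r`; with `k = iq` this equals
  -- `p μ∧r + q μ̄∧r`, since `p` is the conjugate of `q`.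
  refine ⟨fun x => cr.mu x + (Complex.I * q x) • r x, r, hf'.add (contDiffOn_const.mul sq),
    fun x hx => ?_, fun x hx => ⟨(a x).re, Complex.I * q x * a x, ?_, ?_, ?_⟩⟩
  · rw [hd' x hx, hA x hx]
    ext v
    simp [hf'.real_apply hx, hq x hx]
    linear_combination (q x * (starRingEnd ℂ (cr.mu x (v 0)) * r x (v 1)
      - starRingEnd ℂ (cr.mu x (v 1)) * r x (v 0))
      + p x * (cr.mu x (v 0) * r x (v 1) - cr.mu x (v 1) * r x (v 0))) * Complex.I_sq
  · intro e
    refine a0 x hx ?_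
    rw [← Complex.conj_eq_iff_re.1 (ra x hx), e, Complex.ofReal_zero]
  · simp only [hr, smul_smul]
  · rw [Complex.conj_eq_iff_re.1 (ra x hx)]

end CRStructure

/-! ### The Cartan coframe -/

section Conj

variable {n : ℕ}

theorem conj_fun_add (α β : OneForm n) (x : Fin n → ℝ) :
    conj (fun y => α y + β y) x = conj α x + conj β x := by
  ext u
  simp

theorem conj_fun_smul (f : (Fin n → ℝ) → ℂ) (α : OneForm n) (x : Fin n → ℝ) :
    conj (fun y => f y • α y) x = starRingEnd ℂ (f x) • conj α x := by
  ext u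
  simp

theorem conj_conj (α : OneForm n) : conj (conj α) = α := by
  ext x u
  simp

theorem ofRealForm_re {α : OneForm n} {x : Fin n → ℝ} (h : conj α x = α x) :
    ofRealForm (fun y => Complex.reCLM.comp (α y)) x = α x := by
  ext u
  exact Complex.conj_eq_iff_re.1 (conj_apply_of_real h u)

end Conj

theorem evalC_neg {n : ℕ} (α : Cov n) (Z : Fin n → ℂ) : evalC (-α) Z = -evalC α Z := by
  simp [evalC]

theorem CoframeData.det_coframeMatrix_ne_zero {F : CoframeData} {p : Fin 8 → ℝ}
    (h : ∀ Z : Fin 8 → ℂ, (∀ j, evalC (F.coframe j p) Z = 0) → Z = 0) :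
    (F.coframeMatrix p).det ≠ 0 := by
  intro h0
  obtain ⟨Z, hZ, e⟩ := Matrix.exists_mulVec_eq_zero_iff.2 h0
  refine hZ (h Z fun j => ?_)
  have e' := congrFun e j
  rw [Pi.zero_apply] at e'
  rw [← e']
  simp [evalC, CoframeData.coframeMatrix, Matrix.mulVec, dotProduct, mul_comm]

/-- The volume of the frame is the determinant of its coefficient matrix. -/
theorem IsFrame₃.eq_zero_of_evalC {V : Set (Fin 3 → ℝ)} {t r : OneForm 3} (hf : IsFrame₃ V t r)
    {x : Fin 3 → ℝ} (hx : x ∈ V) {Z : Fin 3 → ℂ} (h1 : evalC (t x) Z = 0)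
    (h2 : evalC (conj t x) Z = 0) (h3 : evalC (r x) Z = 0) : Z = 0 := by
  have h0 := hf.vol_ne x hx
  refine Matrix.eq_zero_of_mulVec_eq_zero (M := Matrix.of fun j k : Fin 3 =>
    ![r x, t x, conj t x] j (stdVec k)) ?_ ?_
  · contrapose! h0
    rw [← h0, Matrix.det_fin_three]
    simp only [wedge_two_apply, wedge₁_apply, stdBasis₃]
    simp
    ring
  · ext j
    fin_cases j
    · simpa [evalC, Matrix.mulVec, dotProduct, mul_comm] using h3
    · simpa [evalC, Matrix.mulVec, dotProduct, mul_comm] using h1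
    · simpa [evalC, Matrix.mulVec, dotProduct, mul_comm] using h2

/-- The projection `ℝ⁸ → ℝ³` to the first three coordinates. -/
def proj₃ : (Fin 8 → ℝ) →L[ℝ] Fin 3 → ℝ :=
  ContinuousLinearMap.pi fun i => ContinuousLinearMap.proj (Fin.castLE (by decide) i)

theorem proj₃_apply (p : Fin 8 → ℝ) (i : Fin 3) : proj₃ p i = p (Fin.castLE (by decide) i) := rfl

theorem evalC_pull_proj₃ (α : OneForm 3) (p : Fin 8 → ℝ) (Z : Fin 8 → ℂ) :
    evalC (pull proj₃ α p) Z = evalC (α (proj₃ p)) ![Z 0, Z 1, Z 2] := by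
  have h : ∀ k, pull proj₃ α p (stdVec k) = α (proj₃ p) (proj₃ (stdVec k)) := fun k => by
    rw [pull, proj₃.fderiv]
    rfl
  have hk : ∀ k : Fin 3, proj₃ (stdVec (Fin.castLE (by decide) k)) = stdVec k := fun k => by
    ext i
    simp [proj₃_apply, stdVec, Pi.single_apply, Fin.ext_iff]
  have hl : ∀ k : Fin 8, 3 ≤ k → proj₃ (stdVec k) = 0 := fun k hk => by
    ext i
    have : (Fin.castLE (by decide) i : Fin 8) ≠ k := by
      simp only [ne_eq, Fin.ext_iff, Fin.val_castLE]
      have := Fin.le_def.1 hk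
      have := i.2
      simp at *
      omega
    simp [proj₃_apply, stdVec, this]
  have h0 : proj₃ (stdVec 0) = stdVec 0 := hk 0
  have h1 : proj₃ (stdVec 1) = stdVec 1 := hk 1
  have h2 : proj₃ (stdVec 2) = stdVec 2 := hk 2
  simp [evalC, Fin.sum_univ_eight, Fin.sum_univ_three, h, h0, h1, h2, hl 3 (by decide),
    hl 4 (by decide), hl 5 (by decide), hl 6 (by decide), hl 7 (by decide)]

/-- The complex function `x_i + i x_j` on `ℝ⁸`. -/
def cplx (i j : Fin 8) : (Fin 8 → ℝ) →L[ℝ] ℂ :=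
  Complex.ofRealCLM.comp (ContinuousLinearMap.proj i)
    + Complex.I • Complex.ofRealCLM.comp (ContinuousLinearMap.proj j)

theorem cplx_apply (i j : Fin 8) (p : Fin 8 → ℝ) : cplx i j p = p i + Complex.I * p j := rfl

theorem sum_mul_stdVec (Z : Fin 8 → ℂ) (i : Fin 8) : ∑ k, Z k * (stdVec k i : ℝ) = Z i := by
  rw [Finset.sum_eq_single i (fun k _ h => by simp [stdVec, h.symm]) (by simp)]
  simp [stdVec]

theorem evalC_cplx (i j : Fin 8) (p : Fin 8 → ℝ) (Z : Fin 8 → ℂ) :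
    evalC (fderiv ℝ (cplx i j) p) Z = Z i + Complex.I * Z j := by
  rw [(cplx i j).fderiv]
  simp only [evalC, cplx_apply, mul_add, Finset.sum_add_distrib, sum_mul_stdVec,
    mul_left_comm _ Complex.I, ← Finset.mul_sum]

theorem evalC_conj_cplx (i j : Fin 8) (p : Fin 8 → ℝ) (Z : Fin 8 → ℂ) :
    evalC (conj (fderiv ℝ (cplx i j)) p) Z = Z i - Complex.I * Z j := by
  simp only [evalC, conj_apply, (cplx i j).fderiv, cplx_apply, map_add, map_mul, Complex.conj_I,
    Complex.conj_ofReal, mul_add, Finset.sum_add_distrib, sum_mul_stdVec,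
    mul_left_comm _ (-Complex.I), ← Finset.mul_sum]
  ring

/-- The coordinate `x_i` on `ℝ⁸`. -/
def coord (i : Fin 8) : (Fin 8 → ℝ) →L[ℝ] ℂ :=
  Complex.ofRealCLM.comp (ContinuousLinearMap.proj i)

theorem evalC_coord (i : Fin 8) (p : Fin 8 → ℝ) (Z : Fin 8 → ℂ) :
    evalC (fderiv ℝ (coord i) p) Z = Z i := by
  rw [(coord i).fderiv]
  exact sum_mul_stdVec Z i

/-- A solution of the structure equations that is adapted to a CR structure and linearly
independent is a Cartan coframe. -/
theorem IsCartanSystem.isCartanCoframe {N : Set (Fin 3 → ℝ)} {cr : CRStructure N}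
    {P : Set (Fin 8 → ℝ)} {π : (Fin 8 → ℝ) → Fin 3 → ℝ} {t r o₂ o₃ o₄ : OneForm 8}
    {R S : (Fin 8 → ℝ) → ℂ} (h : IsCartanSystem P t r o₂ o₃ o₄ R S) (hπ : ContDiffOn ℝ ∞ π P)
    (hm : Set.MapsTo π P N)
    (ha : ∀ p ∈ P, ∃ (a : ℝ) (b c : ℂ), a ≠ 0 ∧ b ≠ 0 ∧
      t p = b • CRFefferman.pull π cr.mu p + c • CRFefferman.pull π (ofRealForm cr.lam) p ∧
      r p = (a : ℂ) • CRFefferman.pull π (ofRealForm cr.lam) p)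
    (hi : ∀ p ∈ P, ∀ Z, evalC (t p) Z = 0 → evalC (conj t p) Z = 0 → evalC (r p) Z = 0 →
      evalC (o₂ p) Z = 0 → evalC (conj o₂ p) Z = 0 → evalC (o₃ p) Z = 0 →
      evalC (conj o₃ p) Z = 0 → evalC (o₄ p) Z = 0 → Z = 0) :
    IsCartanCoframe cr P π ⟨t, fun p => Complex.reCLM.comp (r p), o₂, o₃,
      fun p => Complex.reCLM.comp (o₄ p), R, S⟩ := by
  set F : CoframeData := ⟨t, fun p => Complex.reCLM.comp (r p), o₂, o₃,
      fun p => Complex.reCLM.comp (o₄ p), R, S⟩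
  have e3 : ∀ p ∈ P, F.th3 p = r p := fun p hp => ofRealForm_re (h.real_r p hp)
  have e4 : ∀ p ∈ P, F.Om4 p = o₄ p := fun p hp => ofRealForm_re (h.real_o₄ p hp)
  refine
  { isOpen := h.isOpen
    proj_smooth := hπ
    proj_mapsTo := hm
    th1_smooth := h.smooth_t
    th3_smooth := contDiffOn_const.clm_comp h.smooth_r
    Om2_smooth := h.smooth_o₂
    Om3_smooth := h.smooth_o₃
    Om4_smooth := contDiffOn_const.clm_comp h.smooth_o₄
    R_smooth := h.smooth_R
    S_smooth := h.smooth_S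
    adapted := fun p hp => by
      rw [e3 p hp]
      exact ha p hp
    coframe_indep := fun p hp => CoframeData.det_coframeMatrix_ne_zero fun Z hZ => ?_
    d_th1 := fun p hp => by
      rw [e3 p hp]
      exact h.d_t p hp
    d_th3 := fun p hp => by
      rw [extD_congr h.isOpen hp e3, e3 p hp]
      exact h.d_r p hp
    d_Om2 := fun p hp => by
      rw [e3 p hp, e4 p hp]
      exact h.d_o₂ p hp
    d_Om3 := fun p hp => by
      rw [e3 p hp, e4 p hp]
      exact h.d_o₃ p hp
    d_Om4 := fun p hp => by
      rw [extD_congr h.isOpen hp e4, e3 p hp, e4 p hp]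
      exact h.d_o₄ p hp }
  have h3 : evalC (F.th3 p) Z = 0 := hZ 2
  have h4 : evalC (F.Om4 p) Z = 0 := hZ 7
  rw [e3 p hp] at h3
  rw [e4 p hp] at h4
  exact hi p hp Z (hZ 0) (hZ 1) h3 (hZ 3) (hZ 4) (hZ 5) (hZ 6) h4

/-- Cartan's theorem: a nondegenerate CR structure has a Cartan coframe. -/
theorem CRStructure.exists_isCartanCoframe {N : Set (Fin 3 → ℝ)} (hN : IsOpen N)
    (cr : CRStructure N) (hcr : cr.Nondegenerate) :
    ∃ (P : Set (Fin 8 → ℝ)) (π : (Fin 8 → ℝ) → (Fin 3 → ℝ)) (F : CoframeData),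
      IsCartanCoframe cr P π F ∧ π '' P = N := by
  obtain ⟨t, r, hf, hr, hadapted⟩ := cr.exists_normalized_frame hN hcr
  obtain ⟨o₂, o₃, o₄, R, S, hs⟩ := hf.exists_isCartanSystem hr
  set b := cplx 3 4 with hb
  set c := cplx 5 6 with hc
  set τ := coord 7 with hτ
  set P : Set (Fin 8 → ℝ) := proj₃ ⁻¹' N ∩ {p | b p ≠ 0} with hP
  have hm : Set.MapsTo proj₃ P N := fun p hp => hp.1
  have b0 : ∀ p ∈ P, b p ≠ 0 := fun p hp => hp.2
  have oP : IsOpen P := (hN.preimage proj₃.continuous).inter (isOpen_ne_fun b.continuous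
    continuous_const)
  -- The fibre coordinates `b ∈ ℂ*`, `c ∈ ℂ` and `τ ∈ ℝ` serve as gauge parameters; their
  -- differentials enter `Ω₂`, `Ω₃` and `Ω₄` respectively.
  have h := (((hs.pull oP proj₃.contDiff hm).dilate b.contDiff.contDiffOn b0).shear
    c.contDiff.contDiffOn).boost τ.contDiff.contDiffOn fun x => Complex.conj_ofReal _
  refine ⟨P, proj₃, _, h.isCartanCoframe proj₃.contDiff.contDiffOn hm (fun p hp => ?_)
    (fun p hp Z h1 h2 h3 h4 h5 h6 h7 h8 => ?_), ?_⟩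
  · obtain ⟨a, k, a0, ht, hr'⟩ := hadapted _ (hm hp)
    have n0 : Complex.normSq (b p) ≠ 0 := by simpa using b0 p hp
    refine ⟨Complex.normSq (b p) * a, b p, b p * k + c p * (Complex.normSq (b p) * a),
      mul_ne_zero n0 a0, b0 p hp, ?_, ?_⟩
    · ext u
      simp only [pull, ht, hr', ← Complex.mul_conj]
      simp
      ring
    · ext u
      simp only [pull, hr', Complex.mul_conj]
      simp
      ring
  · have bp := b0 p hp
    have bp' : starRingEnd ℂ (b p) ≠ 0 := by simpa using bp
    -- Independence is triangular. The forms `r`, `t`, `t̄` remove the base directions; `Ω₂` and its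
    -- conjugate then give `db` and `db̄`, `Ω₃` and its conjugate give `dc` and `dc̄`, and `Ω₄`
    -- gives `dτ`.
    have hr0 : evalC (pull proj₃ r p) Z = 0 := by simpa [evalC_smul, bp] using h3
    have ht0 : evalC (pull proj₃ t p) Z = 0 := by simpa [evalC_add, evalC_smul, bp, hr0] using h1
    have htb0 : evalC (conj (pull proj₃ t) p) Z = 0 := by
      have e := conj_apply_of_real (hf.real _ (hm hp))
      have e' : evalC (conj (pull proj₃ r) p) Z = 0 := by
        rw [← hr0]
        simp [evalC, pull, e]
      simpa [conj_fun_add, conj_fun_smul, evalC_add, evalC_smul, bp, e'] using h2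
    have z : (![Z 0, Z 1, Z 2] : Fin 3 → ℂ) = 0 := by
      refine hf.eq_zero_of_evalC (hm hp) ?_ ?_ ?_
      · rw [← evalC_pull_proj₃, ht0]
      · rw [← evalC_pull_proj₃, ← htb0]
        rfl
      · rw [← evalC_pull_proj₃, hr0]
    have hp0 : ∀ α, evalC (pull proj₃ α p) Z = 0 := fun α => by
      rw [evalC_pull_proj₃, z]
      simp [evalC]
    have hpb0 : ∀ α, evalC (conj (pull proj₃ α) p) Z = 0 := fun α => hp0 (conj α)
    have d1 : evalC (fderiv ℝ b p) Z = 0 := by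
      simpa [-ContinuousLinearMap.fderiv, conj_fun_smul, evalC_add,
        evalC_smul, hp0, hpb0, bp] using h4
    have d2 : evalC (conj (fderiv ℝ b) p) Z = 0 := by
      simpa [-ContinuousLinearMap.fderiv, conj_fun_add, conj_fun_smul, conj_conj, evalC_add,
        evalC_smul, hp0, hpb0, bp] using h5
    have d3 : evalC (fderiv ℝ c p) Z = 0 := by
      simpa [-ContinuousLinearMap.fderiv, conj_fun_add, conj_fun_smul, evalC_add,
        evalC_smul, hp0, hpb0, d2] using h6
    have d4 : evalC (conj (fderiv ℝ c) p) Z = 0 := by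
      simpa [-ContinuousLinearMap.fderiv, conj_fun_add, conj_fun_smul, conj_conj, evalC_add,
        evalC_smul, hp0, hpb0, d1] using h7
    have d5 : evalC (fderiv ℝ τ p) Z = 0 := by
      simpa [-ContinuousLinearMap.fderiv, conj_fun_add, conj_fun_smul, conj_conj, evalC_add,
        evalC_smul, evalC_neg, hp0, hpb0, d1, d2, d3, d4] using h8
    rw [evalC_cplx] at d1 d3
    rw [evalC_conj_cplx] at d2 d4
    rw [evalC_coord] at d5
    have e : ∀ {x y : ℂ}, x + Complex.I * y = 0 → x - Complex.I * y = 0 → x = 0 ∧ y = 0 := by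
      intro x y h h'
      have hx : x = 0 := by linear_combination (h + h') / 2
      refine ⟨hx, ?_⟩
      simpa [hx] using h
    ext k
    fin_cases k
    · exact congrFun z 0
    · exact congrFun z 1
    · exact congrFun z 2
    · exact (e d1 d2).1
    · exact (e d1 d2).2
    · exact (e d3 d4).1
    · exact (e d3 d4).2
    · exact d5
  -- The point over `x` with `b = 1`, `c = 0` and `τ = 0` lies in `P`.
  · refine Set.Subset.antisymm hm.image_subset fun x hx => ⟨![x 0, x 1, x 2, 1, 0, 0, 0, 0], ?_⟩
    have e : proj₃ ![x 0, x 1, x 2, 1, 0, 0, 0, 0] = x := by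
      ext i
      fin_cases i <;> rfl
    refine ⟨⟨?_, ?_⟩, e⟩
    · rw [Set.mem_preimage, e]
      exact hx
    · simp [hb, cplx_apply]

end CRFefferman

end

theorem mainTheorem6 {N : Set (Fin 3 → ℝ)} (hN : IsOpen N) (cr : CRStructure N)
    (hcr : cr.Nondegenerate) :
    (∃ (P : Set (Fin 8 → ℝ)) (π : (Fin 8 → ℝ) → (Fin 3 → ℝ)) (F : CoframeData),
      IsCartanCoframe cr P π F ∧ π '' P = N) ∧
    ∀ (P : Set (Fin 8 → ℝ)) (π : (Fin 8 → ℝ) → (Fin 3 → ℝ)) (F : CoframeData),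
      IsCartanCoframe cr P π F →
      F.IsNormalConformal P F.confConn ∧
      (∀ p ∈ P, ∀ A B : Fin 6, F.ymCurrent A B p =
        (-(2 / Complex.I) * F.S1 p * matM A B) •
          wedge (F.th1 p) (wedge₁ (F.th2 p) (F.th3 p))) ∧
      (∀ p ∈ P,
        ⁅F.curvMinus p 2 1, F.curvPlus p 2 0⁆ =
          (Complex.I * F.R p * starRingEnd ℂ (F.R p)) • matM ∧
        (F.BastonMasonCommutator p ↔ F.R p = 0) ∧
        (F.S1 p = 0 ↔
          wedge (fderiv ℝ F.S p) (wedge (F.th2 p) (wedge (F.th3 p)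
            (wedge₁ ((2 : ℂ) • F.Om2 p + (3 : ℂ) • F.Om2b p) (F.Om3b p)))) = 0)) ∧
      ∀ (U : Set (Fin 4 → ℝ)) (s : (Fin 4 → ℝ) → (Fin 8 → ℝ)) (g : MetricField),
        IsLeafSection F P U s → IsFeffermanMetric F U s g →
        (∀ x ∈ U, g.bach x = 0 ↔ F.S1 (s x) = 0) ∧
        (g.IsConformallyEinstein U →
          ∀ x ∈ U, F.R (s x) = 0 ∧ ∀ i j : Fin 3, curvature F.suConn i j (s x) = 0) := by
  refine ⟨CRStructure.exists_isCartanCoframe hN cr hcr, fun P π F hF => ⟨hF.isNormalConformal,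
    fun p hp => hF.ymCurrent_eq hp,
    fun p hp => ⟨hF.commutator_curvMinus_curvPlus hp, hF.bastonMason_iff hp,
      hF.S1_eq_zero_iff hp⟩, fun U s g hs hg => ?_⟩⟩
  obtain ⟨φ, hφ, hpos, hm⟩ := hg
  refine ⟨fun x hx => IsFefferman.bach_eq_zero_iff ⟨hF, hs, hφ, hpos, hm⟩ hx, ?_⟩
  rintro ⟨ψ, hψ, hψ0, Λ, hΛ⟩ x hx
  -- The Einstein metric `ψ g` is itself a Fefferman metric, with conformal factor `ψ φ` and the
  -- same section.
  have H : IsFefferman cr P π F U s (fun y => ψ y * φ y) (fun y => ψ y • g y) :=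
    ⟨hF, hs, hψ.mul hφ, fun y hy => mul_pos (hψ0 y hy) (hpos y hy), fun y hy a b => by
      rw [Matrix.smul_apply, smul_eq_mul, hm y hy]; ring⟩
  obtain ⟨hR, hS⟩ := H.einstein_flat hx hΛ
  exact ⟨hR, hF.curvature_suConn_eq_zero (hs.mapsTo hx) hR hS⟩
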